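/- **Theorem (initial loading estimator).** Fix $K\ge 1$, factor numbers $r_1,\dots,r_K$ and constants $\epsilon\in(0,1)$, $\omega>0$. For each sample size $n$ and dimensions $p_1,\dots,p_K$ write $p=\prod_k p_k$, $p_{-k}=p/p_k$, and let $$\mathcal X_t=\mathcal F_t\times_1\mathbf\Lambda_1\times_2\cdots\times_K\mathbf\Lambda_K+\boldsymbol\xi_t\in\mathbb R^{p_1\times\cdots\times p_K},\qquad 1\le t\le n,$$ with deterministic $\mathcal F_t\in\mathbb R^{r_1\times\cdots\times r_K}$ and $\mathbf\Lambda_k\in\mathbb R^{p_k\times r_k}$, and a centred random field $\boldsymbol\xi=\{\xi_{\mathbf i,t}\}_{(\mathbf i,t)\in\mathbb N^K\times\mathbb Z}$. The model ($n$, $p_k$, $\mathbf\Lambda_k$, $\mathcal F_t$, $\boldsymbol\xi$, $M_n$) may vary along the asymptotic regime $\min(n,p_1,\dots,p_K)\to\infty$; $K$, $r_k$, $\epsilon$, $\omega$ and all constants below do not. Let $|\cdot|_2$ be the Euclidean norm of a tensor, $\|\cdot\|$ the spectral norm, $\|\cdot\|_\nu$ the $L^\nu$ norm of a random variable, and $\mathsf{mat}_k$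 the mode-$k$ unfolding. Assume, along the regime: 1. (Loadings) $p_k^{-1}\mathbf\Lambda_k^\top\mathbf\Lambda_k=\mathbf I_{r_k}$, and the entries of all $\mathbf\Lambda_k$ are bounded by a constant. 2. (Factors) $n^{-1}\sum_{t\le n}\mathsf{mat}_k(\mathcal F_t)\mathsf{mat}_k(\mathcal F_t)^\top$ is diagonal, and its $j$-th diagonal entry lies in $[\alpha^{(k)}_j,\beta^{(k)}_j]$, for constants $\alpha_j^{(k)}>0$, $\beta_j^{(k)}$ with $\alpha^{(k)}_j>\beta^{(k)}_{j+1}$. 3. (Tails) $\|\xi_{\mathbf i,t}\|_{2+2\epsilon}\le\omega$ for all $\mathbf i\in\prod_k\{1,\dots,p_k\}$ and $t\in\mathbb Z$; $n^{-1}\sum_{t\le n}|\mathcal F_t|_2^\nu\le\omega^\nu$ for $\nu\in\{1+\epsilon,2,2+2\epsilon\}$; and $\max(\max_{t\le n}|\mathcal F_t|_2,\omega)\le M_n$, where $M_n$ may diverge. For $\sigma$-algebras let $\alpha(\mathcal A,\mathcal B)=\sup_{A\in\mathcal A,B\in\mathcal B}|\mathsf P(A\cap B)-\mathsf P(A)\mathsf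 P(B)|$, and for $c>0$ put $S(c)=n^{-1}\sum_{t,u\le n}|\mathcal F_t|_2^{1+\epsilon}|\mathcal F_u|_2^{1+\epsilon}e^{-c|t-u|}$. Consider two dependence settings, with constants $c_0,c_\epsilon>0$: (I) *Cross-sectional independence.* The time series $\{\xi_{\mathbf i,t}\}_{t\in\mathbb Z}$, $\mathbf i\in\prod_k\{1,\dots,p_k\}$, are mutually independent; $\sup_{t\in\mathbb Z}\alpha(\sigma\{\xi_{\mathbf i,u}:u\le t\},\sigma\{\xi_{\mathbf i,v}:v\ge t+m\})\le e^{-c_0m}$ for all such $\mathbf i$ and all $m\ge 0$; and for every $k$, $S\big(\tfrac{c_0\epsilon}{1+\epsilon}\big)\le\omega^{2+2\epsilon}c_\epsilon$ and $S\big(\tfrac{c_0}{3\log(np_{-k})}\big)\le\omega^{2+2\epsilon}c_\epsilon\log(np_{-k})$. Set $$\tau^{(k)}_{n,p}=\omega\Big(\frac{np_{-k}}{\log(np_{-k})}\Big)^{\frac1{2+2\epsilon}},\qquad\psi^{(k)}_{n,p}=\omega^2\Big(\frac{\log(np_{-k})}{np_{-k}}\Big)^{\frac{\epsilon}{1+\epsilon}}.$$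 (II) *Mixing random field.* For all $m\ge0$ and all $\mathcal E_1,\mathcal E_2\subset\mathbb N^K\times\mathbb Z$ whose (minimum) distance in the maximum metric is at least $m$, the $\sigma$-algebras generated by $\boldsymbol\xi$ on $\mathcal E_1$ and on $\mathcal E_2$ have $\alpha$-mixing coefficient at most $e^{-c_0m}$; $S\big(\tfrac{c_0\epsilon}{K(1+\epsilon)}\big)\le\omega^{2+2\epsilon}c_\epsilon K$ and $S\big(\tfrac{c_0}{3K\log(np)}\big)\le\omega^{2+2\epsilon}c_\epsilon K\log(np)$. Set $$\tau^{(k)}_{n,p}=\omega\Big(\frac{np_{-k}}{\log^K(np)}\Big)^{\frac1{2+2\epsilon}},\qquad\psi^{(k)}_{n,p}=\omega^2\Big(\frac{\log^K(np)}{np_{-k}}\Big)^{\frac{\epsilon}{1+\epsilon}}.$$ In either setting assume $M_n\max_{k}\,(\tau^{(k)}_{n,p})^{-1}\log^{1/(2\epsilon)}(np_{-k})=o(1)$. Fix $k$ and let $\tau>0$ with $\tau\asymp\tau^{(k)}_{n,p}$. Let $\mathcal X_t^{\tau}$ be $\mathcal X_t$ with every entry $x$ replaced by $\mathrm{sign}(x)\min(|x|,\tau)$,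 and let $\widehat{\mathbf\Lambda}_k(\tau)=\sqrt{p_k}\,[\widehat{\mathbf e}_1,\dots,\widehat{\mathbf e}_{r_k}]$, where $\widehat{\mathbf e}_1,\widehat{\mathbf e}_2,\dots$ are orthonormal eigenvectors (any choice) of $(np_{-k})^{-1}\sum_{t\le n}\mathsf{mat}_k(\mathcal X^\tau_t)\mathsf{mat}_k(\mathcal X^\tau_t)^\top$ in decreasing order of the eigenvalues. Then there are random matrices $\widehat{\mathbf H}_k\in\mathbb R^{r_k\times r_k}$ (measurable whenever $\widehat{\mathbf\Lambda}_k(\tau)$ is) with $\widehat{\mathbf H}_k^\top\widehat{\mathbf H}_k=\mathbf I_{r_k}+o_P(1)$ entrywise, such that as $\min(n,p_1,\dots,p_K)\to\infty$ $$\frac1{\sqrt{p_k}}\big\|\widehat{\mathbf\Lambda}_k(\tau)-\mathbf\Lambda_k\widehat{\mathbf H}_k\big\|=\begin{cases}O_P\Big(\dfrac{M_n^{1-\epsilon}}{\sqrt{np_{-k}}}\vee\dfrac1{p_k}\vee\dfrac{\psi^{(k)}_{n,p}}{\sqrt{p_k}}\Big)&\text{in setting (I)},\\[2mm]O_P\Big(\psi^{(k)}_{n,p}\vee\dfrac1{p_k}\Big)&\text{in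 setting (II)}.\end{cases}$$ -/

import Mathlib

open MeasureTheory ProbabilityTheory Filter Topology Asymptotics

namespace TensorFactor

noncomputable section

/-! ### Tensors -/

/-- Real tensors of order `K` with dimensions `d 0, …, d (K - 1)`. -/
abbrev Tensor {K : ℕ} (d : Fin K → ℕ) : Type := (∀ k, Fin (d k)) → ℝ

/-- The mode-`k` unfolding: rows are indexed by the `k`-th index, columns (the mode-`k` fibres) by
the tuple of the remaining indices. Only `mat k X * (mat k X)ᵀ` is ever used, and it does not depend
on how the columns are enumerated. -/
def mat {K : ℕ} {d : Fin K → ℕ} (k : Fin K) (X : Tensor d) :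
    Matrix (Fin (d k)) (∀ j : {j : Fin K // j ≠ k}, Fin (d j)) ℝ :=
  Matrix.of fun i c => X ((Equiv.piSplitAt k fun j => Fin (d j)).symm (i, c))

/-- The Tucker product `F ×₁ Λ₁ ×₂ … ×_K Λ_K`. -/
def tucker {K : ℕ} {r p : Fin K → ℕ} (F : Tensor r)
    (Λ : ∀ k, Matrix (Fin (p k)) (Fin (r k)) ℝ) : Tensor p :=
  fun i => ∑ j : (∀ k, Fin (r k)), F j * ∏ k, Λ k (i k) (j k)

/-- The Euclidean norm of a tensor. -/
def tnorm {K : ℕ} {d : Fin K → ℕ} (X : Tensor d) : ℝ := √(∑ i, X i ^ 2)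

/-- `p = ∏ p_k`. -/
def dimAll {K : ℕ} (p : Fin K → ℕ) : ℕ := ∏ j, p j

/-- `p_{-k} = ∏_{j ≠ k} p_j`. -/
def dimExcept {K : ℕ} (p : Fin K → ℕ) (k : Fin K) : ℕ := ∏ j ∈ Finset.univ.erase k, p j

/-- The position in `ℕ^K` of an entry of a `p_1 × ⋯ × p_K` tensor. -/
def pos {K : ℕ} {p : Fin K → ℕ} (i : ∀ k, Fin (p k)) : Fin K → ℕ := fun k => (i k : ℕ)

/-- The spectral norm of a real matrix. -/
def specNorm {m n : ℕ} (A : Matrix (Fin m) (Fin n) ℝ) : ℝ :=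
  ‖LinearMap.toContinuousLinearMap (Matrix.toEuclideanLin A)‖

/-! ### Data, truncation and the estimator -/

/-- Truncation of a number at level `τ`. -/
def trunc (τ x : ℝ) : ℝ := (SignType.sign x : ℝ) * min |x| τ

/-- The observation `X_t = F_t ×₁ Λ₁ ⋯ ×_K Λ_K + ξ_t`, where `Ft = F_t` and `ξt = ξ_{·, t}`. -/
def obs {K : ℕ} {r p : Fin K → ℕ} (Ft : Tensor r) (Λ : ∀ k, Matrix (Fin (p k)) (Fin (r k)) ℝ)
    (ξt : (Fin K → ℕ) → ℝ) : Tensor p :=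
  fun i => tucker Ft Λ i + ξt (pos i)

/-- The mode-`k` sample second moment matrix
`(n p_{-k})⁻¹ ∑_{t ≤ n} mat_k(X_t^τ) mat_k(X_t^τ)ᵀ` of the data `X` truncated at `τ`. -/
def truncGram {K : ℕ} {p : Fin K → ℕ} (n : ℕ) (X : ℕ → Tensor p) (τ : ℝ) (k : Fin K) :
    Matrix (Fin (p k)) (Fin (p k)) ℝ :=
  ((n : ℝ) * dimExcept p k)⁻¹ • ∑ t ∈ Finset.Icc 1 n,
    mat k (fun i => trunc τ (X t i)) * (mat k (fun i => trunc τ (X t i))).transpose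

/-- `Λhat = √m [e_1, …, e_s]`, where `e_1, …, e_m` is an orthonormal basis of eigenvectors of the
symmetric matrix `Γ`, ordered by decreasing eigenvalue. -/
def IsPCLoading {m s : ℕ} (Γ : Matrix (Fin m) (Fin m) ℝ) (Λhat : Matrix (Fin m) (Fin s) ℝ) : Prop :=
  ∃ (E : Matrix (Fin m) (Fin m) ℝ) (μ : Fin m → ℝ),
    E.transpose * E = 1 ∧ Antitone μ ∧ Γ * E = E * Matrix.diagonal μ ∧
    ∀ (i : Fin m) (j : Fin s) (h : (j : ℕ) < m), Λhat i j = √(m : ℝ) * E i ⟨j, h⟩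

/-- `n⁻¹ ∑_{t ≤ n} mat_k(F_t) mat_k(F_t)ᵀ`. -/
def factorGram {K : ℕ} {r : Fin K → ℕ} (n : ℕ) (F : ℕ → Tensor r) (k : Fin K) :
    Matrix (Fin (r k)) (Fin (r k)) ℝ :=
  (n : ℝ)⁻¹ • ∑ t ∈ Finset.Icc 1 n, mat k (F t) * (mat k (F t)).transpose

/-! ### Strong mixing -/

/-- The `α`-mixing coefficient of two `σ`-algebras. -/
def alphaMix {Ω : Type*} [MeasurableSpace Ω] (P : Measure Ω) (𝒜 ℬ : MeasurableSpace Ω) : ℝ :=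
  sSup {x : ℝ | ∃ A B : Set Ω, MeasurableSet[𝒜] A ∧ MeasurableSet[ℬ] B ∧
    x = |P.real (A ∩ B) - P.real A * P.real B|}

/-- The strong mixing coefficient `α(m)` of a time series. -/
def seriesAlpha {Ω : Type*} [MeasurableSpace Ω] (P : Measure Ω) (Y : ℤ → Ω → ℝ) (m : ℕ) : ℝ :=
  ⨆ t : ℤ, alphaMix P
    (⨆ u : {u : ℤ // u ≤ t}, MeasurableSpace.comap (Y u) inferInstance)
    (⨆ v : {v : ℤ // t + m ≤ v}, MeasurableSpace.comap (Y v) inferInstance)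

/-- The maximum distance on `ℕ^K × ℤ`. -/
def siteDist {K : ℕ} (a b : (Fin K → ℕ) × ℤ) : ℕ :=
  max (Finset.univ.sup fun k => ((a.1 k : ℤ) - (b.1 k : ℤ)).natAbs) (a.2 - b.2).natAbs

/-- The distance between two sets of sites (`⊤` if one of them is empty). -/
def setDist {K : ℕ} (E₁ E₂ : Set ((Fin K → ℕ) × ℤ)) : ℕ∞ :=
  ⨅ a ∈ E₁, ⨅ b ∈ E₂, (siteDist a b : ℕ∞)

/-- The `σ`-algebra generated by a random field on a set of sites. -/
abbrev fieldSigma {Ω : Type*} {K : ℕ} (ξ : (Fin K → ℕ) → ℤ → Ω → ℝ) (E : Set ((Fin K → ℕ) × ℤ)) :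
    MeasurableSpace Ω :=
  ⨆ a : E, MeasurableSpace.comap (ξ a.1.1 a.1.2) inferInstance

/-- The strong mixing coefficient `α(m, ℓ₁, ℓ₂)` of a random field on `ℕ^K × ℤ`. -/
def fieldAlpha {Ω : Type*} [MeasurableSpace Ω] (P : Measure Ω) {K : ℕ}
    (ξ : (Fin K → ℕ) → ℤ → Ω → ℝ) (m : ℕ) (ℓ₁ ℓ₂ : ℕ∞) : ℝ :=
  sSup {x : ℝ | ∃ E₁ E₂ : Set ((Fin K → ℕ) × ℤ), E₁.encard ≤ ℓ₁ ∧ E₂.encard ≤ ℓ₂ ∧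
    (m : ℕ∞) ≤ setDist E₁ E₂ ∧ x = alphaMix P (fieldSigma ξ E₁) (fieldSigma ξ E₂)}

/-! ### Assumptions

A family of models is indexed by `ν : ι`: sample size `n ν`, dimensions `p ν`, loadings `Λ ν`,
factors `F ν t` for `1 ≤ t ≤ n ν` and noise `ξ ν i t`. The factor numbers `r`, and all constants,
do not depend on `ν`. -/

/-- Conditions on the loadings. -/
structure LoadingAssumption {K : ℕ} {ι : Type*} {r : Fin K → ℕ} {p : ι → Fin K → ℕ}
    (Λ : ∀ ν k, Matrix (Fin (p ν k)) (Fin (r k)) ℝ) : Prop where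
  orthonormal : ∀ ν k, (p ν k : ℝ)⁻¹ • ((Λ ν k).transpose * Λ ν k) = 1
  bounded : ∃ lam : ℝ, ∀ ν k i j, |Λ ν k i j| ≤ lam

/-- Conditions on the factors: the second moment matrices are diagonal, with diagonal entries in
fixed, disjoint, decreasing intervals `[a k j, b k j]` of positive numbers. -/
def FactorAssumption {K : ℕ} {ι : Type*} {r : Fin K → ℕ} (n : ι → ℕ)
    (F : ι → ℕ → Tensor r) : Prop :=
  ∃ a b : ∀ k, Fin (r k) → ℝ,
    (∀ k j, 0 < a k j) ∧ (∀ k j j', j < j' → b k j' < a k j) ∧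
    ∀ ν k, (factorGram (n ν) (F ν) k).IsDiag ∧
      ∀ j, a k j ≤ factorGram (n ν) (F ν) k j j ∧ factorGram (n ν) (F ν) k j j ≤ b k j

/-- The noise is a centred, measurable random field. -/
structure NoiseAssumption {Ω : Type*} [MeasurableSpace Ω] (P : Measure Ω) {K : ℕ} {ι : Type*}
    (p : ι → Fin K → ℕ) (ξ : ι → (Fin K → ℕ) → ℤ → Ω → ℝ) : Prop where
  measurable : ∀ ν i t, Measurable (ξ ν i t)
  centred : ∀ ν (i : ∀ k, Fin (p ν k)) t, ∫ ω, ξ ν (pos i) t ω ∂P = 0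

/-- Conditions on the tails of the noise and on the size of the factors. -/
structure TailAssumption {Ω : Type*} [MeasurableSpace Ω] (P : Measure Ω) {K : ℕ} {ι : Type*}
    {r : Fin K → ℕ} (n : ι → ℕ) (p : ι → Fin K → ℕ) (F : ι → ℕ → Tensor r)
    (ξ : ι → (Fin K → ℕ) → ℤ → Ω → ℝ) (ε w : ℝ) (M : ι → ℝ) : Prop where
  eps_pos : 0 < ε
  eps_lt_one : ε < 1
  w_pos : 0 < w
  noise : ∀ ν (i : ∀ k, Fin (p ν k)) t,
    eLpNorm (ξ ν (pos i) t) (ENNReal.ofReal (2 + 2 * ε)) P ≤ ENNReal.ofReal w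
  factor : ∀ ν, ∀ s ∈ ({1 + ε, 2, 2 + 2 * ε} : Set ℝ),
    (n ν : ℝ)⁻¹ * ∑ t ∈ Finset.Icc 1 (n ν), tnorm (F ν t) ^ s ≤ w ^ s
  M_pos : ∀ ν, 0 < M ν
  w_le_M : ∀ ν, w ≤ M ν
  factor_le_M : ∀ ν, ∀ t ∈ Finset.Icc 1 (n ν), tnorm (F ν t) ≤ M ν

/-- `n⁻¹ ∑_{t, u ≤ n} |F_t|^{1+ε} |F_u|^{1+ε} exp(-c |t - u|)`. -/
def factorDep {K : ℕ} {r : Fin K → ℕ} (n : ℕ) (F : ℕ → Tensor r) (ε c : ℝ) : ℝ :=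
  (n : ℝ)⁻¹ * ∑ t ∈ Finset.Icc 1 n, ∑ u ∈ Finset.Icc 1 n,
    tnorm (F t) ^ (1 + ε) * tnorm (F u) ^ (1 + ε) * Real.exp (-(c * |(t : ℝ) - (u : ℝ)|))

/-- Cross-sectional independence with exponentially `α`-mixing time series. -/
def IndepAssumption {Ω : Type*} [MeasurableSpace Ω] (P : Measure Ω) {K : ℕ} {ι : Type*}
    {r : Fin K → ℕ} (n : ι → ℕ) (p : ι → Fin K → ℕ) (F : ι → ℕ → Tensor r)
    (ξ : ι → (Fin K → ℕ) → ℤ → Ω → ℝ) (ε w : ℝ) : Prop :=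
  ∃ c₀ cε : ℝ, 0 < c₀ ∧ 0 < cε ∧ ∀ ν,
    iIndepFun (fun (i : ∀ k, Fin (p ν k)) (ω : Ω) (t : ℤ) => ξ ν (pos i) t ω) P ∧
    (∀ (i : ∀ k, Fin (p ν k)) (m : ℕ), seriesAlpha P (ξ ν (pos i)) m ≤ Real.exp (-(c₀ * m))) ∧
    ∀ k : Fin K,
      factorDep (n ν) (F ν) ε (c₀ * ε / (1 + ε)) ≤ w ^ (2 + 2 * ε) * cε ∧
      factorDep (n ν) (F ν) ε (c₀ / (3 * Real.log ((n ν : ℝ) * dimExcept (p ν) k))) ≤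
        w ^ (2 + 2 * ε) * cε * Real.log ((n ν : ℝ) * dimExcept (p ν) k)

/-- Exponentially `α`-mixing random field. -/
def FieldAssumption {Ω : Type*} [MeasurableSpace Ω] (P : Measure Ω) {K : ℕ} {ι : Type*}
    {r : Fin K → ℕ} (n : ι → ℕ) (p : ι → Fin K → ℕ) (F : ι → ℕ → Tensor r)
    (ξ : ι → (Fin K → ℕ) → ℤ → Ω → ℝ) (ε w : ℝ) : Prop :=
  ∃ c₀ cε : ℝ, 0 < c₀ ∧ 0 < cε ∧ ∀ ν,
    (∀ m : ℕ, fieldAlpha P (ξ ν) m ⊤ ⊤ ≤ Real.exp (-(c₀ * m))) ∧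
    factorDep (n ν) (F ν) ε (c₀ * ε / (K * (1 + ε))) ≤ w ^ (2 + 2 * ε) * cε * K ∧
    factorDep (n ν) (F ν) ε (c₀ / (3 * K * Real.log ((n ν : ℝ) * dimAll (p ν)))) ≤
      w ^ (2 + 2 * ε) * cε * K * Real.log ((n ν : ℝ) * dimAll (p ν))

/-! ### Truncation levels and rates -/

/-- Truncation level under cross-sectional independence. -/
def tauIndep {K : ℕ} (n : ℕ) (p : Fin K → ℕ) (ε w : ℝ) (k : Fin K) : ℝ :=
  w * (((n : ℝ) * dimExcept p k) / Real.log ((n : ℝ) * dimExcept p k)) ^ (1 / (2 + 2 * ε))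

/-- Truncation level for mixing random fields. -/
def tauField {K : ℕ} (n : ℕ) (p : Fin K → ℕ) (ε w : ℝ) (k : Fin K) : ℝ :=
  w * (((n : ℝ) * dimExcept p k) / Real.log ((n : ℝ) * dimAll p) ^ K) ^ (1 / (2 + 2 * ε))

/-- `ψ` under cross-sectional independence. -/
def psiIndep {K : ℕ} (n : ℕ) (p : Fin K → ℕ) (ε w : ℝ) (k : Fin K) : ℝ :=
  w ^ 2 * (Real.log ((n : ℝ) * dimExcept p k) / ((n : ℝ) * dimExcept p k)) ^ (ε / (1 + ε))

/-- `ψ` for mixing random fields. -/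
def psiField {K : ℕ} (n : ℕ) (p : Fin K → ℕ) (ε w : ℝ) (k : Fin K) : ℝ :=
  w ^ 2 * (Real.log ((n : ℝ) * dimAll p) ^ K / ((n : ℝ) * dimExcept p k)) ^ (ε / (1 + ε))

/-- `M max_k (τ^{(k)})⁻¹ log^{1/(2ε)}(n p_{-k}) = o(1)`, for given levels `τlev ν k`. -/
def GrowthCondition {K : ℕ} {ι : Type*} (l : Filter ι) (n : ι → ℕ) (p : ι → Fin K → ℕ) (ε : ℝ)
    (M : ι → ℝ) (τlev : ι → Fin K → ℝ) : Prop :=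
  Tendsto (fun ν => M ν * ⨆ k : Fin K,
    (τlev ν k)⁻¹ * Real.log ((n ν : ℝ) * dimExcept (p ν) k) ^ (1 / (2 * ε))) l (𝓝 0)

/-- `Z = O_P(a)` along `l`. For events that are not measurable, `P` is the outer measure. -/
def IsBigOP {Ω : Type*} [MeasurableSpace Ω] (P : Measure Ω) {ι : Type*} (l : Filter ι)
    (Z : ι → Ω → ℝ) (a : ι → ℝ) : Prop :=
  ∀ δ : ℝ, 0 < δ → ∃ C : ℝ, 0 < C ∧
    ∀ᶠ ν in l, P {ω | C * a ν < |Z ν ω|} ≤ ENNReal.ofReal δ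

end

end TensorFactor

open TensorFactor

/-
The columns of the unfoldings carry the signal `x_{is}` and a truncation error `e_{is}`. Their
Gram matrix differs from the signal part `Λ_k G Λ_kᵀ` by cross terms and an error Gram matrix.
Truncation at `τ` costs a bias of order `w ^ (2 + 2ε) / τ ^ (1 + 2ε)` and leaves fourth moments of
order `τ ^ (2 - 2ε)`; mixing makes the covariances of the errors, and of their products, summable
along the columns, by Davydov's inequality at short range and by the mixing coefficient times the
sup norm at long range. Chebyshev's inequality in the Frobenius norm therefore bounds the
perturbation by `p_k ρ`, apart from the expected error Gram matrix, whose norm Schur's test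
bounds. The leading eigenvalues are at least of order `p_k`, so projecting the eigenvalue equation
of `Λhat` onto the complement of the column space of `Λ_k` bounds `Λhat - Λ_k H` by the same `ρ`,
with `H = p_k⁻¹ Λ_kᵀ Λhat`.
-/

namespace TensorFactor

section SpectralPerturbation

open Matrix
open scoped Matrix.Norms.L2Operator

variable {m n : Type*} [Fintype m] [Fintype n]

theorem norm_toLp_sq_eq_dotProduct (x : n → ℝ) : ‖WithLp.toLp 2 x‖ ^ 2 = x ⬝ᵥ x := by
  simp [EuclideanSpace.norm_sq_eq, dotProduct, ← sq]

theorem dotProduct_self_nonneg_real (x : n → ℝ) : 0 ≤ x ⬝ᵥ x :=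
  Finset.sum_nonneg fun _ _ => mul_self_nonneg _

variable [DecidableEq n]

theorem l2_opNorm_le_of_dotProduct_le {A : Matrix m n ℝ} {C : ℝ} (hC : 0 ≤ C)
    (h : ∀ x, A *ᵥ x ⬝ᵥ A *ᵥ x ≤ C ^ 2 * (x ⬝ᵥ x)) : ‖A‖ ≤ C := by
  rw [l2_opNorm_def]
  refine ContinuousLinearMap.opNorm_le_bound _ hC fun x => ?_
  refine le_of_sq_le_sq ?_ (by positivity)
  rw [mul_pow]
  have hx := h x.ofLp
  rw [← norm_toLp_sq_eq_dotProduct, ← norm_toLp_sq_eq_dotProduct] at hx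
  exact hx

theorem abs_dotProduct_mulVec_le (A : Matrix m n ℝ) (x : m → ℝ) (y : n → ℝ) :
    |x ⬝ᵥ A *ᵥ y| ≤ ‖A‖ * (√(x ⬝ᵥ x) * √(y ⬝ᵥ y)) := by
  have hCS := abs_real_inner_le_norm (WithLp.toLp 2 (A *ᵥ y)) (WithLp.toLp 2 x)
  have hA := l2_opNorm_mulVec A (WithLp.toLp 2 y)
  rw [← norm_toLp_sq_eq_dotProduct, ← norm_toLp_sq_eq_dotProduct, Real.sqrt_sq (norm_nonneg _),
    Real.sqrt_sq (norm_nonneg _)]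
  calc |x ⬝ᵥ A *ᵥ y| ≤ ‖WithLp.toLp 2 (A *ᵥ y)‖ * ‖WithLp.toLp 2 x‖ := by
        simpa [EuclideanSpace.inner_eq_star_dotProduct] using hCS
    _ ≤ ‖A‖ * ‖WithLp.toLp 2 y‖ * ‖WithLp.toLp 2 x‖ := by gcongr; exact hA
    _ = ‖A‖ * (‖WithLp.toLp 2 x‖ * ‖WithLp.toLp 2 y‖) := by ring

theorem abs_apply_le_l2_opNorm (A : Matrix m n ℝ) (i : m) (j : n) : |A i j| ≤ ‖A‖ := by
  classical
  simpa using abs_dotProduct_mulVec_le A (Pi.single i 1) (Pi.single j 1)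

theorem l2_opNorm_le_sqrt_sum_sq (A : Matrix m n ℝ) : ‖A‖ ≤ √(∑ i, ∑ j, A i j ^ 2) := by
  refine l2_opNorm_le_of_dotProduct_le (Real.sqrt_nonneg _) fun x => ?_
  rw [Real.sq_sqrt (by positivity), Finset.sum_mul]
  refine Finset.sum_le_sum fun i _ => ?_
  simpa only [mulVec, dotProduct, ← sq] using
    Finset.sum_mul_sq_le_sq_mul_sq Finset.univ (A i) x

-- Schur's test: Cauchy–Schwarz with the weights `|A i j|` in every row.
theorem l2_opNorm_le_of_row_col_sums {A : Matrix m n ℝ} {C : ℝ} (hC : 0 ≤ C)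
    (hrow : ∀ i, ∑ j, |A i j| ≤ C) (hcol : ∀ j, ∑ i, |A i j| ≤ C) : ‖A‖ ≤ C := by
  refine l2_opNorm_le_of_dotProduct_le hC fun x => ?_
  have row_sq (i : m) : (A *ᵥ x) i * (A *ᵥ x) i ≤ C * ∑ j, |A i j| * x j ^ 2 := by
    calc (A *ᵥ x) i * (A *ᵥ x) i = (∑ j, A i j * x j) ^ 2 := (sq _).symm
      _ ≤ (∑ j, |A i j|) * ∑ j, |A i j| * x j ^ 2 := by
          refine Finset.sum_sq_le_sum_mul_sum_of_sq_le_mul _ (fun _ _ => abs_nonneg _)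
            (fun _ _ => by positivity) fun j _ => le_of_eq ?_
          rw [← mul_assoc, abs_mul_abs_self, mul_pow, sq (A i j)]
      _ ≤ C * ∑ j, |A i j| * x j ^ 2 :=
          mul_le_mul_of_nonneg_right (hrow i) (by positivity)
  calc A *ᵥ x ⬝ᵥ A *ᵥ x ≤ ∑ i, C * ∑ j, |A i j| * x j ^ 2 :=
        Finset.sum_le_sum fun i _ => row_sq i
    _ = C * ∑ j, (∑ i, |A i j|) * x j ^ 2 := by
        rw [← Finset.mul_sum, Finset.sum_comm]; simp only [Finset.sum_mul]
    _ ≤ C * ∑ j, C * x j ^ 2 := by gcongr with j; exact hcol j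
    _ = C ^ 2 * (x ⬝ᵥ x) := by rw [← Finset.mul_sum, sq, mul_assoc]; simp only [dotProduct, sq]

theorem mulVec_dotProduct_mulVec_self {A : Matrix m n ℝ} {c : ℝ}
    (hA : Aᵀ * A = c • 1) (x : n → ℝ) : A *ᵥ x ⬝ᵥ A *ᵥ x = c * (x ⬝ᵥ x) := by
  rw [dotProduct_mulVec, ← mulVec_transpose, mulVec_mulVec, hA, smul_mulVec, one_mulVec,
    smul_dotProduct, smul_eq_mul]

theorem l2_opNorm_le_sqrt_of_transpose_mul_self {A : Matrix m n ℝ} {c : ℝ}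
    (hc : 0 ≤ c) (hA : Aᵀ * A = c • 1) : ‖A‖ ≤ √c :=
  l2_opNorm_le_of_dotProduct_le (Real.sqrt_nonneg _) fun x => by
    rw [Real.sq_sqrt hc, mulVec_dotProduct_mulVec_self hA]

section Eigenvalues

variable {q s : ℕ} {Γ E : Matrix (Fin q) (Fin q) ℝ} {μ : Fin q → ℝ}

theorem exists_mulVec_apply_eq_zero_of_lt (hs : s ≤ q) (A : Matrix (Fin q) (Fin s) ℝ)
    (j : Fin s) : ∃ x : Fin s → ℝ, x ≠ 0 ∧ ∀ i : Fin q, (i : ℕ) < j → (A *ᵥ x) i = 0 := by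
  let L : (Fin s → ℝ) →ₗ[ℝ] (Fin (j : ℕ) → ℝ) :=
    (LinearMap.funLeft ℝ ℝ (Fin.castLE (j.2.le.trans hs))).comp (toLin' A)
  have hL : LinearMap.ker L ≠ ⊥ := LinearMap.ker_ne_bot_of_finrank_lt (by simp)
  obtain ⟨x, hxker, hx0⟩ := (Submodule.ne_bot_iff _).mp hL
  exact ⟨x, hx0, fun i hi => congrFun (LinearMap.mem_ker.mp hxker) ⟨i, hi⟩⟩

-- One half of the Courant–Fischer principle: the range of `A` contains a nonzero vector orthogonal
-- to the first `j` eigenvectors.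
theorem le_eigenvalue_of_forall_le (hE : Eᵀ * E = 1) (hμ : Antitone μ)
    (hΓE : Γ * E = E * diagonal μ) (hs : s ≤ q) {A : Matrix (Fin q) (Fin s) ℝ}
    (hA : ∀ x, x ≠ 0 → A *ᵥ x ≠ 0) {c : ℝ}
    (hc : ∀ x, c * (A *ᵥ x ⬝ᵥ A *ᵥ x) ≤ A *ᵥ x ⬝ᵥ Γ *ᵥ (A *ᵥ x)) (j : Fin s) :
    c ≤ μ (Fin.castLE hs j) := by
  have hE' : E * Eᵀ = 1 := mul_eq_one_comm.mp hE
  have hΓ : Γ = E * diagonal μ * Eᵀ := by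
    rw [← hΓE, Matrix.mul_assoc, hE', Matrix.mul_one]
  obtain ⟨x, hx0, hx⟩ := exists_mulVec_apply_eq_zero_of_lt hs (Eᵀ * A) j
  set v := A *ᵥ x with hv
  set y := Eᵀ *ᵥ v with hy
  have hyy : y ⬝ᵥ y = v ⬝ᵥ v := by
    simpa using mulVec_dotProduct_mulVec_self (A := Eᵀ) (c := 1) (by simpa using hE') v
  have hform : v ⬝ᵥ Γ *ᵥ v = ∑ i, μ i * (y i * y i) := by
    rw [hΓ, ← mulVec_mulVec, ← mulVec_mulVec, dotProduct_mulVec, ← mulVec_transpose, ← hy]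
    simp only [dotProduct, mulVec_diagonal, mul_left_comm]
  have hupper : v ⬝ᵥ Γ *ᵥ v ≤ μ (Fin.castLE hs j) * (v ⬝ᵥ v) := by
    rw [hform, ← hyy, dotProduct, Finset.mul_sum]
    refine Finset.sum_le_sum fun i _ => ?_
    rcases lt_or_ge (i : ℕ) j with hi | hi
    · have : y i = 0 := by rw [hy, hv, mulVec_mulVec]; exact hx i hi
      simp [this]
    · exact mul_le_mul_of_nonneg_right (hμ hi) (mul_self_nonneg _)
  have hvpos : 0 < v ⬝ᵥ v := (dotProduct_self_nonneg_real v).lt_of_ne'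
    (mt dotProduct_self_eq_zero.mp (hA x hx0))
  exact le_of_mul_le_mul_right ((hc x).trans hupper) hvpos

end Eigenvalues

section PCLoading

variable {q s : ℕ} {Γ R : Matrix (Fin q) (Fin q) ℝ} {Λ Λhat : Matrix (Fin q) (Fin s) ℝ}
  {G : Matrix (Fin s) (Fin s) ℝ} {a ρ : ℝ}

theorem IsPCLoading.transpose_mul_self (hs : s ≤ q) (h : IsPCLoading Γ Λhat) :
    Λhatᵀ * Λhat = (q : ℝ) • 1 := by
  obtain ⟨E, μ, hE, -, -, hΛhat⟩ := h
  ext i j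
  have hcols : (Λhatᵀ * Λhat) i j =
      (√(q : ℝ) * √(q : ℝ)) * (Eᵀ * E) (Fin.castLE hs i) (Fin.castLE hs j) := by
    simp only [mul_apply, transpose_apply, Finset.mul_sum]
    refine Finset.sum_congr rfl fun k _ => ?_
    rw [hΛhat k i (i.2.trans_le hs), hΛhat k j (j.2.trans_le hs), mul_mul_mul_comm]
    rfl
  rw [hcols, Real.mul_self_sqrt (Nat.cast_nonneg q), hE]
  simp [one_apply]

theorem IsPCLoading.exists_eigenvalues_ge (hs : s ≤ q) (h : IsPCLoading Γ Λhat)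
    {A : Matrix (Fin q) (Fin s) ℝ} (hA : ∀ x, x ≠ 0 → A *ᵥ x ≠ 0) {c : ℝ}
    (hc : ∀ x, c * (A *ᵥ x ⬝ᵥ A *ᵥ x) ≤ A *ᵥ x ⬝ᵥ Γ *ᵥ (A *ᵥ x)) :
    ∃ d : Fin s → ℝ, (∀ j, c ≤ d j) ∧ Γ * Λhat = Λhat * diagonal d := by
  obtain ⟨E, μ, hE, hμ, hΓE, hΛhat⟩ := h
  refine ⟨fun j => μ (Fin.castLE hs j), le_eigenvalue_of_forall_le hE hμ hΓE hs hA hc, ?_⟩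
  ext i j
  have hcol (k : Fin q) : Λhat k j = √(q : ℝ) * E k (Fin.castLE hs j) :=
    hΛhat k j (j.2.trans_le hs)
  have heig := congrFun (congrFun hΓE i) (Fin.castLE hs j)
  rw [mul_diagonal, mul_apply] at heig
  rw [mul_diagonal, mul_apply, hcol i, mul_assoc, ← heig, Finset.mul_sum]
  simp only [hcol, mul_left_comm]

/-- The rotation `q⁻¹ Λᵀ Λhat`: the coefficients of the orthogonal projection of the columns of
`Λhat` onto the column space of `Λ`, when `Λᵀ Λ = q I`. -/
noncomputable def pcRotation (Λ Λhat : Matrix (Fin q) (Fin s) ℝ) : Matrix (Fin s) (Fin s) ℝ :=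
  (q : ℝ)⁻¹ • (Λᵀ * Λhat)

/-- The orthogonal projection onto the complement of the column space of `Λ`, when
`Λᵀ Λ = q I`. -/
noncomputable def complProj (Λ : Matrix (Fin q) (Fin s) ℝ) : Matrix (Fin q) (Fin q) ℝ :=
  1 - (q : ℝ)⁻¹ • (Λ * Λᵀ)

theorem sub_mul_pcRotation (Λ Λhat : Matrix (Fin q) (Fin s) ℝ) :
    Λhat - Λ * pcRotation Λ Λhat = complProj Λ * Λhat := by
  rw [pcRotation, complProj, Matrix.sub_mul, Matrix.one_mul, Matrix.smul_mul, Matrix.mul_smul,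
    Matrix.mul_assoc]

theorem complProj_mul_self_eq_zero (hq : q ≠ 0) (hΛ : Λᵀ * Λ = (q : ℝ) • 1) :
    complProj Λ * Λ = 0 := by
  rw [complProj, Matrix.sub_mul, Matrix.one_mul, Matrix.smul_mul, Matrix.mul_assoc, hΛ,
    Matrix.mul_smul, Matrix.mul_one, inv_smul_smul₀ (Nat.cast_ne_zero.mpr hq), sub_self]

theorem isStarProjection_complProj (hq : q ≠ 0) (hΛ : Λᵀ * Λ = (q : ℝ) • 1) :
    IsStarProjection (complProj Λ) where
  isIdempotentElem := by
    rw [IsIdempotentElem]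
    nth_rewrite 2 [complProj]
    rw [Matrix.mul_sub, Matrix.mul_one, Matrix.mul_smul, ← Matrix.mul_assoc,
      complProj_mul_self_eq_zero hq hΛ, Matrix.zero_mul, smul_zero, sub_zero]
  isSelfAdjoint := by
    simp [IsSelfAdjoint, star_eq_conjTranspose, complProj, conjTranspose_eq_transpose_of_trivial]

theorem dotProduct_mulVec_ge_of_factor_model (hΛ : Λᵀ * Λ = (q : ℝ) • 1)
    (hG : ∀ x, a * (x ⬝ᵥ x) ≤ x ⬝ᵥ G *ᵥ x) (hΓ : Γ = Λ * G * Λᵀ + R) (hR : ‖R‖ ≤ q * ρ)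
    (x : Fin s → ℝ) :
    q * (a - ρ) * (Λ *ᵥ x ⬝ᵥ Λ *ᵥ x) ≤ Λ *ᵥ x ⬝ᵥ Γ *ᵥ (Λ *ᵥ x) := by
  set v := Λ *ᵥ x with hv
  have hvv : v ⬝ᵥ v = q * (x ⬝ᵥ x) := mulVec_dotProduct_mulVec_self hΛ x
  have hΛv : Λᵀ *ᵥ v = (q : ℝ) • x := by
    rw [hv, mulVec_mulVec, hΛ, smul_mulVec, one_mulVec]
  have hsignal : v ⬝ᵥ (Λ * G * Λᵀ) *ᵥ v = q ^ 2 * (x ⬝ᵥ G *ᵥ x) := by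
    rw [← mulVec_mulVec, ← mulVec_mulVec, dotProduct_mulVec, ← mulVec_transpose, hΛv, mulVec_smul,
      smul_dotProduct, dotProduct_smul, smul_eq_mul, smul_eq_mul, sq, mul_assoc]
  have hnoise : -(q * ρ * (v ⬝ᵥ v)) ≤ v ⬝ᵥ R *ᵥ v := by
    have := (abs_dotProduct_mulVec_le R v v).trans
      (mul_le_mul_of_nonneg_right hR (by positivity))
    rw [Real.mul_self_sqrt (dotProduct_self_nonneg_real v)] at this
    exact (abs_le.mp this).1
  rw [hΓ, add_mulVec, dotProduct_add, hsignal]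
  have := mul_le_mul_of_nonneg_left (hG x) (sq_nonneg (q : ℝ))
  calc q * (a - ρ) * (v ⬝ᵥ v) = q ^ 2 * (a * (x ⬝ᵥ x)) + -(q * ρ * (v ⬝ᵥ v)) := by
        rw [hvv]; ring
    _ ≤ _ := add_le_add this hnoise

theorem l2_opNorm_complProj_mul_le (hq : q ≠ 0) (hs : s ≤ q) (hΛ : Λᵀ * Λ = (q : ℝ) • 1)
    (hhat : IsPCLoading Γ Λhat) : ‖complProj Λ * Λhat‖ ≤ √q := by
  have hP := (isStarProjection_complProj hq hΛ).norm_le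
  have hΛhat := l2_opNorm_le_sqrt_of_transpose_mul_self (Nat.cast_nonneg q)
    (hhat.transpose_mul_self hs)
  simpa using (l2_opNorm_mul _ _).trans
    (mul_le_mul hP hΛhat (norm_nonneg _) zero_le_one)

theorem l2_opNorm_mul_le_of_mul_eq_mul_diagonal [DecidableEq m] {Q Γ R : Matrix m m ℝ}
    {A : Matrix m n ℝ} {d : n → ℝ} {b : ℝ} (hb : 0 < b) (hd : ∀ j, b ≤ d j)
    (hΓ : Γ * A = A * diagonal d) (hQ : Q * Γ = Q * R) :
    ‖Q * A‖ ≤ ‖Q‖ * (‖R‖ * (‖A‖ * b⁻¹)) := by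
  have hdpos (j : n) : 0 < d j := hb.trans_le (hd j)
  have hsolve : Q * A = Q * (R * (A * diagonal fun j => (d j)⁻¹)) := by
    have : diagonal d * diagonal (fun j => (d j)⁻¹) = 1 := by
      simp [diagonal_mul_diagonal, (hdpos _).ne']
    rw [← Matrix.mul_assoc _ R, ← hQ, Matrix.mul_assoc, ← Matrix.mul_assoc Γ, hΓ,
      Matrix.mul_assoc A, this, Matrix.mul_one]
  have hdinv : ‖diagonal fun j => (d j)⁻¹‖ ≤ b⁻¹ := by
    rw [l2_opNorm_diagonal]
    refine (pi_norm_le_iff_of_nonneg (by positivity)).mpr fun j => ?_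
    rw [Real.norm_of_nonneg (inv_pos.mpr (hdpos j)).le]
    exact inv_anti₀ hb (hd j)
  rw [hsolve]
  refine (l2_opNorm_mul _ _).trans ?_
  gcongr
  refine (l2_opNorm_mul _ _).trans ?_
  gcongr
  refine (l2_opNorm_mul _ _).trans ?_
  gcongr

-- `complProj Λ` annihilates the signal, and the leading eigenvalues are at least
-- `q (a - ρ) ≥ q a / 2`.
theorem l2_opNorm_complProj_mul_le_of_perturbation (hq : q ≠ 0) (hs : s ≤ q) (ha : 0 < a)
    (hΛ : Λᵀ * Λ = (q : ℝ) • 1) (hG : ∀ x, a * (x ⬝ᵥ x) ≤ x ⬝ᵥ G *ᵥ x)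
    (hΓ : Γ = Λ * G * Λᵀ + R) (hR : ‖R‖ ≤ q * ρ) (hhat : IsPCLoading Γ Λhat) :
    ‖complProj Λ * Λhat‖ ≤ √q * (2 / a * ρ) := by
  have hq' : (0 : ℝ) < q := by positivity
  rcases le_or_gt a (2 * ρ) with hρ | hρ
  · have : 1 ≤ 2 / a * ρ := by rw [div_mul_eq_mul_div, one_le_div ha]; exact hρ
    exact (l2_opNorm_complProj_mul_le hq hs hΛ hhat).trans
      (le_mul_of_one_le_right (Real.sqrt_nonneg _) this)
  have hinj (x : Fin s → ℝ) (hx : x ≠ 0) : Λ *ᵥ x ≠ 0 := fun h => hx <| by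
    have := mulVec_dotProduct_mulVec_self hΛ x
    rw [h, zero_dotProduct, zero_eq_mul] at this
    exact dotProduct_self_eq_zero.mp (this.resolve_left hq'.ne')
  obtain ⟨d, hd, hΓΛhat⟩ := hhat.exists_eigenvalues_ge hs hinj
    (dotProduct_mulVec_ge_of_factor_model hΛ hG hΓ hR)
  have hd' (j : Fin s) : q * a / 2 ≤ d j := le_trans (by nlinarith) (hd j)
  have hPΓ : complProj Λ * Γ = complProj Λ * R := by
    rw [hΓ, Matrix.mul_add, Matrix.mul_assoc Λ, ← Matrix.mul_assoc _ Λ,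
      complProj_mul_self_eq_zero hq hΛ, Matrix.zero_mul, zero_add]
  calc ‖complProj Λ * Λhat‖
      ≤ ‖complProj Λ‖ * (‖R‖ * (‖Λhat‖ * (q * a / 2)⁻¹)) :=
        l2_opNorm_mul_le_of_mul_eq_mul_diagonal (by positivity) hd' hΓΛhat hPΓ
    _ ≤ 1 * (q * ρ * (√q * (q * a / 2)⁻¹)) := by
        have := (norm_nonneg R).trans hR
        gcongr
        · exact (isStarProjection_complProj hq hΛ).norm_le
        · exact l2_opNorm_le_sqrt_of_transpose_mul_self hq'.le (hhat.transpose_mul_self hs)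
    _ = √q * (2 / a * ρ) := by field_simp

theorem transpose_mul_self_pcRotation (hq : q ≠ 0) (hs : s ≤ q) (hΛ : Λᵀ * Λ = (q : ℝ) • 1)
    (hhat : IsPCLoading Γ Λhat) :
    (pcRotation Λ Λhat)ᵀ * pcRotation Λ Λhat =
      1 - (q : ℝ)⁻¹ • ((complProj Λ * Λhat)ᵀ * (complProj Λ * Λhat)) := by
  have hP := isStarProjection_complProj hq hΛ
  have hPt : (complProj Λ)ᵀ = complProj Λ := hP.isSelfAdjoint
  have hq' : (q : ℝ) ≠ 0 := Nat.cast_ne_zero.mpr hq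
  rw [transpose_mul, hPt, Matrix.mul_assoc, ← Matrix.mul_assoc _ _ Λhat,
    hP.isIdempotentElem.eq, ← sub_mul_pcRotation, Matrix.mul_sub, hhat.transpose_mul_self hs,
    smul_sub, inv_smul_smul₀ hq', sub_sub_cancel, ← Matrix.mul_assoc, ← Matrix.smul_mul]
  simp [pcRotation]

theorem abs_pcRotation_gram_sub_one_le (hq : q ≠ 0) (hs : s ≤ q) (ha : 0 < a)
    (hΛ : Λᵀ * Λ = (q : ℝ) • 1) (hG : ∀ x, a * (x ⬝ᵥ x) ≤ x ⬝ᵥ G *ᵥ x)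
    (hΓ : Γ = Λ * G * Λᵀ + R) (hR : ‖R‖ ≤ q * ρ) (hhat : IsPCLoading Γ Λhat) (i j : Fin s) :
    |((pcRotation Λ Λhat)ᵀ * pcRotation Λ Λhat) i j - (1 : Matrix (Fin s) (Fin s) ℝ) i j|
      ≤ 2 / a * ρ := by
  have hq' : (0 : ℝ) < q := by positivity
  set Z := complProj Λ * Λhat
  have hZZ : |(Zᵀ * Z) i j| ≤ √q * (√q * (2 / a * ρ)) := by
    refine (abs_apply_le_l2_opNorm _ i j).trans ?_
    rw [← conjTranspose_eq_transpose_of_trivial, l2_opNorm_conjTranspose_mul_self]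
    exact mul_le_mul (l2_opNorm_complProj_mul_le hq hs hΛ hhat)
      (l2_opNorm_complProj_mul_le_of_perturbation hq hs ha hΛ hG hΓ hR hhat)
      (norm_nonneg _) (Real.sqrt_nonneg _)
  rw [transpose_mul_self_pcRotation hq hs hΛ hhat, Matrix.sub_apply, sub_sub_cancel_left, abs_neg,
    Matrix.smul_apply, smul_eq_mul, abs_mul, abs_inv, abs_of_pos hq', inv_mul_le_iff₀ hq']
  rwa [← mul_assoc, Real.mul_self_sqrt hq'.le] at hZZ

theorem specNorm_sub_mul_pcRotation_le (hq : q ≠ 0) (hs : s ≤ q) (ha : 0 < a)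
    (hΛ : Λᵀ * Λ = (q : ℝ) • 1) (hG : ∀ x, a * (x ⬝ᵥ x) ≤ x ⬝ᵥ G *ᵥ x)
    (hΓ : Γ = Λ * G * Λᵀ + R) (hR : ‖R‖ ≤ q * ρ) (hhat : IsPCLoading Γ Λhat) :
    1 / √(q : ℝ) * specNorm (Λhat - Λ * pcRotation Λ Λhat) ≤ 2 / a * ρ := by
  rw [one_div, inv_mul_le_iff₀ (by positivity), sub_mul_pcRotation]
  exact l2_opNorm_complProj_mul_le_of_perturbation hq hs ha hΛ hG hΓ hR hhat

end PCLoading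

end SpectralPerturbation

section StrongMixing

variable {Ω : Type*} {𝒜 ℬ 𝒜' ℬ' : MeasurableSpace Ω} [m0 : MeasurableSpace Ω] {P : Measure Ω}

theorem alphaMix_le_of_forall {α : ℝ} (h : ∀ A B, MeasurableSet[𝒜] A → MeasurableSet[ℬ] B →
    |P.real (A ∩ B) - P.real A * P.real B| ≤ α) : alphaMix P 𝒜 ℬ ≤ α := by
  refine csSup_le ⟨_, ∅, ∅, @MeasurableSet.empty _ 𝒜, @MeasurableSet.empty _ ℬ, rfl⟩ ?_
  rintro _ ⟨A, B, hA, hB, rfl⟩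
  exact h A B hA hB

variable [IsProbabilityMeasure P]

theorem abs_real_inter_sub_mul_le_one (A B : Set Ω) :
    |P.real (A ∩ B) - P.real A * P.real B| ≤ 1 := by
  have hmul : P.real A * P.real B ≤ 1 :=
    mul_le_one₀ measureReal_le_one measureReal_nonneg measureReal_le_one
  have hinter : P.real (A ∩ B) ≤ 1 := measureReal_le_one
  rw [abs_le]
  constructor <;> linarith [measureReal_nonneg (μ := P) (s := A ∩ B),
    mul_nonneg (measureReal_nonneg (μ := P) (s := A)) (measureReal_nonneg (μ := P) (s := B))]

theorem abs_real_inter_sub_mul_le_alphaMix {A B : Set Ω} (hA : MeasurableSet[𝒜] A)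
    (hB : MeasurableSet[ℬ] B) : |P.real (A ∩ B) - P.real A * P.real B| ≤ alphaMix P 𝒜 ℬ := by
  refine le_csSup ⟨1, ?_⟩ ⟨A, B, hA, hB, rfl⟩
  rintro _ ⟨A, B, -, -, rfl⟩
  exact abs_real_inter_sub_mul_le_one A B

theorem alphaMix_le_one : alphaMix P 𝒜 ℬ ≤ 1 :=
  alphaMix_le_of_forall fun A B _ _ => abs_real_inter_sub_mul_le_one A B

theorem alphaMix_mono (h𝒜 : 𝒜 ≤ 𝒜') (hℬ : ℬ ≤ ℬ') : alphaMix P 𝒜 ℬ ≤ alphaMix P 𝒜' ℬ' :=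
  alphaMix_le_of_forall fun A B hA hB =>
    abs_real_inter_sub_mul_le_alphaMix (h𝒜 A hA) (hℬ B hB)

theorem alphaMix_comm : alphaMix P 𝒜 ℬ = alphaMix P ℬ 𝒜 := by
  apply le_antisymm <;> refine alphaMix_le_of_forall fun A B hA hB => ?_ <;>
    rw [Set.inter_comm, mul_comm] <;> exact abs_real_inter_sub_mul_le_alphaMix hB hA

theorem alphaMix_comap_le_seriesAlpha (Y : ℤ → Ω → ℝ) {t u : ℤ} {m : ℕ} (h : t + m ≤ u) :
    alphaMix P (MeasurableSpace.comap (Y t) inferInstance)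
      (MeasurableSpace.comap (Y u) inferInstance) ≤ seriesAlpha P Y m := by
  refine le_trans ?_ (le_ciSup (f := fun t : ℤ => alphaMix P
    (⨆ u : {u : ℤ // u ≤ t}, MeasurableSpace.comap (Y u) inferInstance)
    (⨆ v : {v : ℤ // t + m ≤ v}, MeasurableSpace.comap (Y v) inferInstance)) ⟨1, ?_⟩ t)
  · exact alphaMix_mono
      (le_iSup (fun u : {u : ℤ // u ≤ t} => MeasurableSpace.comap (Y u) inferInstance) ⟨t, le_rfl⟩)
      (le_iSup (fun v : {v : ℤ // t + m ≤ v} => MeasurableSpace.comap (Y v) inferInstance) ⟨u, h⟩)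
  · rintro _ ⟨_, rfl⟩
    exact alphaMix_le_one

theorem alphaMix_comap_le_exp {Y : ℤ → Ω → ℝ} {c₀ : ℝ}
    (hY : ∀ m : ℕ, seriesAlpha P Y m ≤ Real.exp (-(c₀ * m))) (t u : ℤ) :
    alphaMix P (MeasurableSpace.comap (Y t) inferInstance)
      (MeasurableSpace.comap (Y u) inferInstance) ≤ Real.exp (-(c₀ * (t - u).natAbs)) := by
  rcases le_total t u with h | h
  · exact (alphaMix_comap_le_seriesAlpha Y (by lia)).trans (hY _)
  · rw [alphaMix_comm]
    exact (alphaMix_comap_le_seriesAlpha Y (by lia)).trans (hY _)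

theorem alphaMix_fieldSigma_le {K : ℕ} {ξ : (Fin K → ℕ) → ℤ → Ω → ℝ} {α : ℝ} {m : ℕ}
    (hα : fieldAlpha P ξ m ⊤ ⊤ ≤ α) {E₁ E₂ : Set ((Fin K → ℕ) × ℤ)}
    (hE : ∀ a ∈ E₁, ∀ b ∈ E₂, m ≤ siteDist a b) :
    alphaMix P (fieldSigma ξ E₁) (fieldSigma ξ E₂) ≤ α := by
  refine le_trans ?_ hα
  refine le_csSup ⟨1, ?_⟩ ⟨E₁, E₂, le_top, le_top, ?_, rfl⟩
  · rintro _ ⟨_, _, -, -, -, rfl⟩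
    exact alphaMix_le_one
  · exact le_iInf₂ fun a ha => le_iInf₂ fun b hb => by exact_mod_cast hE a ha b hb

end StrongMixing

section Covariance

variable {Ω : Type*} {𝒜 ℬ : MeasurableSpace Ω} [m0 : MeasurableSpace Ω] {P : Measure Ω}

theorem integrable_of_abs_le [IsFiniteMeasure P] {X : Ω → ℝ} {A : ℝ} (hX : Measurable X)
    (hA : ∀ ω, |X ω| ≤ A) : Integrable X P :=
  .of_bound hX.aestronglyMeasurable A (ae_of_all _ hA)

theorem memLp_two_of_abs_le [IsFiniteMeasure P] {X : Ω → ℝ} {A : ℝ} (hX : Measurable X)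
    (hA : ∀ ω, |X ω| ≤ A) : MemLp X 2 P :=
  .of_bound hX.aestronglyMeasurable A (ae_of_all _ hA)

theorem integral_abs_eq_two_mul_setIntegral {g : Ω → ℝ} (hgm : Measurable g)
    (hg : Integrable g P) (hg0 : ∫ ω, g ω ∂P = 0) :
    ∫ ω, |g ω| ∂P = 2 * ∫ ω in {ω | 0 < g ω}, g ω ∂P := by
  have hS : MeasurableSet {ω | 0 < g ω} := hgm measurableSet_Ioi
  have abs_eq (ω : Ω) : |g ω| = 2 * {ω | 0 < g ω}.indicator g ω - g ω := by
    by_cases h : 0 < g ω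
    · rw [Set.indicator_of_mem (by exact h), abs_of_pos h]; ring
    · rw [Set.indicator_of_notMem (by exact h), abs_of_nonpos (not_lt.mp h)]; ring
  simp_rw [abs_eq]
  rw [integral_sub ((hg.indicator hS).const_mul _) hg, integral_const_mul, hg0, sub_zero,
    integral_indicator hS]

variable [IsProbabilityMeasure P]

theorem covariance_eq_integral_mul_condExp (h𝒜 : 𝒜 ≤ m0) {X Y : Ω → ℝ} {A : ℝ}
    (hX : Measurable[𝒜] X) (hXA : ∀ ω, |X ω| ≤ A) (hY : Integrable Y P) :
    cov[X, Y; P] = ∫ ω, X ω * (P[fun ω => Y ω - P[Y] | 𝒜]) ω ∂P := by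
  have hXm : Measurable X := hX.mono h𝒜 le_rfl
  have hZ : Integrable (fun ω => Y ω - P[Y]) P := hY.sub (integrable_const _)
  have hXZ : Integrable (fun ω => X ω * (Y ω - P[Y])) P :=
    hZ.bdd_mul hXm.aestronglyMeasurable (ae_of_all _ hXA)
  calc cov[X, Y; P] = ∫ ω, (X ω * (Y ω - P[Y]) - P[X] * (Y ω - P[Y])) ∂P := by
        rw [covariance]; congr with ω; ring
    _ = ∫ ω, X ω * (Y ω - P[Y]) ∂P := by
        rw [integral_sub hXZ (hZ.const_mul _), integral_const_mul,
          integral_sub hY (integrable_const _)]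
        simp
    _ = ∫ ω, (P[X * fun ω => Y ω - P[Y] | 𝒜]) ω ∂P := (integral_condExp h𝒜).symm
    _ = _ := integral_congr_ae
        (condExp_mul_of_stronglyMeasurable_left hX.stronglyMeasurable hXZ hZ)

-- The extremal choice is `S = {E[Y - EY | 𝒜] > 0}`.
theorem exists_abs_covariance_le_indicator (h𝒜 : 𝒜 ≤ m0) {X Y : Ω → ℝ} {A : ℝ}
    (hX : Measurable[𝒜] X) (hXA : ∀ ω, |X ω| ≤ A) (hY : Integrable Y P) :
    ∃ S, MeasurableSet[𝒜] S ∧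
      |cov[X, Y; P]| ≤ 2 * A * |cov[S.indicator (fun _ => (1 : ℝ)), Y; P]| := by
  obtain ⟨ω₀⟩ : Nonempty Ω := nonempty_of_isProbabilityMeasure P
  have hA : 0 ≤ A := (abs_nonneg _).trans (hXA ω₀)
  set g : Ω → ℝ := P[fun ω => Y ω - P[Y] | 𝒜]
  have hg : Integrable g P := integrable_condExp
  have hgm : Measurable[𝒜] g := stronglyMeasurable_condExp.measurable
  have hg0 : ∫ ω, g ω ∂P = 0 := by
    rw [integral_condExp h𝒜, integral_sub hY (integrable_const _)]
    simp
  have hS : MeasurableSet[𝒜] {ω | 0 < g ω} := hgm measurableSet_Ioi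
  refine ⟨{ω | 0 < g ω}, hS, ?_⟩
  have cov_indicator : cov[{ω | 0 < g ω}.indicator (fun _ => (1 : ℝ)), Y; P] =
      ∫ ω in {ω | 0 < g ω}, g ω ∂P := by
    rw [covariance_eq_integral_mul_condExp h𝒜 (A := 1) (measurable_const.indicator hS)
      (fun ω => by by_cases h : ω ∈ {ω | 0 < g ω} <;> simp [h]) hY,
      ← integral_indicator (h𝒜 _ hS)]
    congr with ω
    by_cases h : ω ∈ {ω | 0 < g ω} <;> simp [h, g]
  calc |cov[X, Y; P]| = |∫ ω, X ω * g ω ∂P| := by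
        rw [covariance_eq_integral_mul_condExp h𝒜 hX hXA hY]
    _ ≤ ∫ ω, |X ω * g ω| ∂P := abs_integral_le_integral_abs
    _ ≤ ∫ ω, A * |g ω| ∂P := by
        refine integral_mono (hg.bdd_mul (hX.mono h𝒜 le_rfl).aestronglyMeasurable
          (ae_of_all _ hXA)).abs (hg.abs.const_mul _) fun ω => ?_
        simpa only [abs_mul] using mul_le_mul_of_nonneg_right (hXA ω) (abs_nonneg (g ω))
    _ = 2 * A * ∫ ω in {ω | 0 < g ω}, g ω ∂P := by
        rw [integral_const_mul,
          integral_abs_eq_two_mul_setIntegral (hgm.mono h𝒜 le_rfl) hg hg0]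
        ring
    _ ≤ _ := by
        rw [cov_indicator]
        exact mul_le_mul_of_nonneg_left (le_abs_self _) (by positivity)

theorem covariance_indicator_one {S T : Set Ω} (hS : MeasurableSet S) (hT : MeasurableSet T) :
    cov[S.indicator (fun _ => (1 : ℝ)), T.indicator (fun _ => (1 : ℝ)); P] =
      P.real (S ∩ T) - P.real S * P.real T := by
  have memLp_indicator {U : Set Ω} (hU : MeasurableSet U) :
      MemLp (U.indicator fun _ => (1 : ℝ)) 2 P := (memLp_const 1).indicator hU
  have mul_indicator : S.indicator (fun _ => (1 : ℝ)) * T.indicator (fun _ => 1) =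
      (S ∩ T).indicator fun _ => 1 := by
    ext ω
    by_cases h : ω ∈ S <;> by_cases h' : ω ∈ T <;> simp [h, h']
  rw [covariance_eq_sub (memLp_indicator hS) (memLp_indicator hT), mul_indicator,
    integral_indicator (hS.inter hT), integral_indicator hS, integral_indicator hT]
  simp

theorem abs_covariance_le_alphaMix (h𝒜 : 𝒜 ≤ m0) (hℬ : ℬ ≤ m0) {X Y : Ω → ℝ} {A B : ℝ}
    (hX : Measurable[𝒜] X) (hXA : ∀ ω, |X ω| ≤ A) (hY : Measurable[ℬ] Y)
    (hYB : ∀ ω, |Y ω| ≤ B) : |cov[X, Y; P]| ≤ 4 * A * B * alphaMix P 𝒜 ℬ := by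
  obtain ⟨ω₀⟩ : Nonempty Ω := nonempty_of_isProbabilityMeasure P
  have hA : 0 ≤ A := (abs_nonneg _).trans (hXA ω₀)
  have hB : 0 ≤ B := (abs_nonneg _).trans (hYB ω₀)
  obtain ⟨S, hS, hXS⟩ := exists_abs_covariance_le_indicator h𝒜 hX hXA
    (integrable_of_abs_le (P := P) (hY.mono hℬ le_rfl) hYB)
  obtain ⟨T, hT, hYT⟩ := exists_abs_covariance_le_indicator hℬ hY hYB
    ((integrable_const (μ := P) (1 : ℝ)).indicator (h𝒜 _ hS))
  rw [covariance_comm Y, covariance_comm (T.indicator _),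
    covariance_indicator_one (h𝒜 _ hS) (hℬ _ hT)] at hYT
  calc |cov[X, Y; P]| ≤ 2 * A * |cov[S.indicator (fun _ => (1 : ℝ)), Y; P]| := hXS
    _ ≤ 2 * A * (2 * B * alphaMix P 𝒜 ℬ) := by
        gcongr
        exact hYT.trans (by gcongr; exact abs_real_inter_sub_mul_le_alphaMix hS hT)
    _ = 4 * A * B * alphaMix P 𝒜 ℬ := by ring

theorem abs_covariance_le_integral_abs {X Y : Ω → ℝ} {A : ℝ} (hX : Measurable X)
    (hXA : ∀ ω, |X ω| ≤ A) (hY : Integrable Y P) : |cov[X, Y; P]| ≤ 2 * A * ∫ ω, |Y ω| ∂P := by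
  have hXi : Integrable X P := integrable_of_abs_le hX hXA
  have hEX : |P[X]| ≤ A := by
    simpa using norm_integral_le_of_norm_le_const (μ := P) (f := X) (ae_of_all _ hXA)
  have hZ (ω : Ω) : |X ω - P[X]| ≤ 2 * A :=
    (abs_sub _ _).trans (by linarith [hXA ω])
  have hXc : Integrable (fun ω => X ω - P[X]) P := hXi.sub (integrable_const _)
  have hZY : Integrable (fun ω => (X ω - P[X]) * Y ω) P :=
    hY.bdd_mul (hX.sub_const _).aestronglyMeasurable (ae_of_all _ hZ)
  calc |cov[X, Y; P]| = |∫ ω, (X ω - P[X]) * Y ω ∂P| := by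
        rw [covariance]
        simp_rw [mul_sub _ _ P[Y]]
        rw [integral_sub hZY (hXc.mul_const _), integral_mul_const,
          integral_sub hXi (integrable_const _)]
        simp
    _ ≤ ∫ ω, |(X ω - P[X]) * Y ω| ∂P := abs_integral_le_integral_abs
    _ ≤ ∫ ω, 2 * A * |Y ω| ∂P := by
        refine integral_mono hZY.abs (hY.abs.const_mul _) fun ω => ?_
        simpa only [abs_mul] using mul_le_mul_of_nonneg_right (hZ ω) (abs_nonneg (Y ω))
    _ = _ := integral_const_mul _ _

theorem abs_covariance_le_integral_sq {X Y : Ω → ℝ} (hX : MemLp X 2 P) (hY : MemLp Y 2 P) :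
    |cov[X, Y; P]| ≤ (∫ ω, X ω ^ 2 ∂P + ∫ ω, Y ω ^ 2 ∂P) / 2 := by
  have hX' : MemLp (fun ω => X ω - P[X]) 2 P := hX.sub (memLp_const _)
  have hY' : MemLp (fun ω => Y ω - P[Y]) 2 P := hY.sub (memLp_const _)
  have hVX : Var[X; P] ≤ ∫ ω, X ω ^ 2 ∂P := variance_le_expectation_sq hX.aestronglyMeasurable
  have hVY : Var[Y; P] ≤ ∫ ω, Y ω ^ 2 ∂P := variance_le_expectation_sq hY.aestronglyMeasurable
  calc |cov[X, Y; P]| ≤ ∫ ω, |(X ω - P[X]) * (Y ω - P[Y])| ∂P := abs_integral_le_integral_abs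
    _ ≤ ∫ ω, ((X ω - P[X]) ^ 2 + (Y ω - P[Y]) ^ 2) / 2 ∂P := by
        refine integral_mono (hX'.integrable_mul hY').abs
          ((hX'.integrable_sq.add hY'.integrable_sq).div_const 2) fun ω => ?_
        have := two_mul_le_add_sq |X ω - P[X]| |Y ω - P[Y]|
        simp only [sq_abs, abs_mul] at this ⊢
        linarith
    _ = (Var[X; P] + Var[Y; P]) / 2 := by
        rw [integral_div, integral_add hX'.integrable_sq hY'.integrable_sq,
          variance_eq_integral hX.aemeasurable, variance_eq_integral hY.aemeasurable]
    _ ≤ _ := by linarith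

end Covariance

section Moments

variable {Ω : Type*} [MeasurableSpace Ω] {P : Measure Ω} {X : Ω → ℝ} {q w : ℝ}

theorem integrable_abs_rpow_of_eLpNorm_le (hX : Measurable X) (hq : 0 < q)
    (h : eLpNorm X (ENNReal.ofReal q) P ≤ ENNReal.ofReal w) :
    Integrable (fun ω => |X ω| ^ q) P := by
  have hmem : MemLp X (ENNReal.ofReal q) P :=
    ⟨hX.aestronglyMeasurable, h.trans_lt ENNReal.ofReal_lt_top⟩
  simpa [ENNReal.toReal_ofReal hq.le] using
    hmem.integrable_norm_rpow (by simpa using hq) ENNReal.ofReal_ne_top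

theorem integral_abs_rpow_le_of_eLpNorm_le (hX : Measurable X) (hq : 0 < q) (hw : 0 ≤ w)
    (h : eLpNorm X (ENNReal.ofReal q) P ≤ ENNReal.ofReal w) :
    ∫ ω, |X ω| ^ q ∂P ≤ w ^ q := by
  have hmem : MemLp X (ENNReal.ofReal q) P :=
    ⟨hX.aestronglyMeasurable, h.trans_lt ENNReal.ofReal_lt_top⟩
  have hnonneg : 0 ≤ ∫ ω, |X ω| ^ q ∂P := integral_nonneg fun ω => by positivity
  rw [hmem.eLpNorm_eq_integral_rpow_norm (by simpa using hq) ENNReal.ofReal_ne_top,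
    ENNReal.toReal_ofReal hq.le, ENNReal.ofReal_le_ofReal_iff hw] at h
  exact (Real.rpow_inv_le_iff_of_pos hnonneg hw hq).mp h

theorem memLp_two_of_eLpNorm_le [IsFiniteMeasure P] (hX : Measurable X) (hq : 2 ≤ q)
    (h : eLpNorm X (ENNReal.ofReal q) P ≤ ENNReal.ofReal w) : MemLp X 2 P := by
  have hmem : MemLp X (ENNReal.ofReal q) P :=
    ⟨hX.aestronglyMeasurable, h.trans_lt ENNReal.ofReal_lt_top⟩
  exact hmem.mono_exponent (by simpa using ENNReal.ofReal_le_ofReal hq)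

theorem integral_sq_le_of_eLpNorm_le [IsProbabilityMeasure P] (hX : Measurable X) (hq : 2 ≤ q)
    (hw : 0 ≤ w) (h : eLpNorm X (ENNReal.ofReal q) P ≤ ENNReal.ofReal w) :
    ∫ ω, X ω ^ 2 ∂P ≤ w ^ 2 := by
  have h2 : eLpNorm X (ENNReal.ofReal 2) P ≤ ENNReal.ofReal w :=
    (eLpNorm_le_eLpNorm_of_exponent_le (ENNReal.ofReal_le_ofReal hq)
      hX.aestronglyMeasurable).trans h
  simpa using integral_abs_rpow_le_of_eLpNorm_le hX two_pos hw h2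

end Moments

section Truncation

theorem abs_sub_truncation_rpow_le {Ω : Type*} {X : Ω → ℝ} {q s T : ℝ} (hT : 0 < T) (hs : 0 < s)
    (hsq : s ≤ q) (ω : Ω) : |X ω - truncation X T ω| ^ s ≤ T ^ (s - q) * |X ω| ^ q := by
  rcases lt_or_ge |X ω| T with h | h
  · rw [truncation_eq_self h, sub_self, abs_zero, Real.zero_rpow hs.ne']
    positivity
  · have hX : 0 < |X ω| := hT.trans_le h
    have hle : |X ω - truncation X T ω| ≤ |X ω| := by
      rw [truncation, Function.comp_apply, Set.indicator_apply]
      split_ifs <;> simp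
    calc |X ω - truncation X T ω| ^ s ≤ |X ω| ^ s := by gcongr
      _ = |X ω| ^ (s - q) * |X ω| ^ q := by rw [← Real.rpow_add hX, sub_add_cancel]
      _ ≤ T ^ (s - q) * |X ω| ^ q := by
          have := Real.rpow_le_rpow_of_nonpos hT h (sub_nonpos.mpr hsq)
          gcongr

variable {Ω : Type*} {m0 : MeasurableSpace Ω} {P : Measure Ω} {X : Ω → ℝ} {q w s T : ℝ}

theorem measurable_truncation (hX : Measurable X) (T : ℝ) : Measurable (truncation X T) :=
  (measurable_id.indicator measurableSet_Ioc).comp hX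

theorem integral_abs_sub_truncation_rpow_le (hX : Measurable X) (hT : 0 < T)
    (hw : 0 ≤ w) (hs : 0 < s) (hsq : s ≤ q)
    (h : eLpNorm X (ENNReal.ofReal q) P ≤ ENNReal.ofReal w) :
    ∫ ω, |X ω - truncation X T ω| ^ s ∂P ≤ T ^ (s - q) * w ^ q := by
  have hq : 0 < q := hs.trans_le hsq
  calc ∫ ω, |X ω - truncation X T ω| ^ s ∂P ≤ ∫ ω, T ^ (s - q) * |X ω| ^ q ∂P :=
        integral_mono_of_nonneg (ae_of_all _ fun ω => by positivity)
          ((integrable_abs_rpow_of_eLpNorm_le hX hq h).const_mul _)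
          (ae_of_all _ fun ω => abs_sub_truncation_rpow_le hT hs hsq ω)
    _ ≤ T ^ (s - q) * w ^ q := by
        rw [integral_const_mul]
        have := integral_abs_rpow_le_of_eLpNorm_le hX hq hw h
        gcongr

end Truncation

section Davydov

variable {Ω : Type*} {𝒜 ℬ : MeasurableSpace Ω} [m0 : MeasurableSpace Ω] {P : Measure Ω}
  [IsProbabilityMeasure P] {X Y : Ω → ℝ} {q w T : ℝ}

theorem covariance_eq_add_four {X₁ X₂ Y₁ Y₂ : Ω → ℝ} (hX₁ : MemLp X₁ 2 P) (hX₂ : MemLp X₂ 2 P)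
    (hY₁ : MemLp Y₁ 2 P) (hY₂ : MemLp Y₂ 2 P) :
    cov[X₁ + X₂, Y₁ + Y₂; P] =
      cov[X₁, Y₁; P] + cov[X₁, Y₂; P] + cov[X₂, Y₁; P] + cov[X₂, Y₂; P] := by
  rw [covariance_add_left hX₁ hX₂ (hY₁.add hY₂), covariance_add_right hX₁ hY₁ hY₂,
    covariance_add_right hX₂ hY₁ hY₂]
  ring

theorem abs_covariance_le_of_truncation (h𝒜 : 𝒜 ≤ m0) (hℬ : ℬ ≤ m0) (hX : Measurable[𝒜] X)
    (hY : Measurable[ℬ] Y) (hq : 2 ≤ q) (hw : 0 ≤ w) (hT : 0 < T)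
    (hXw : eLpNorm X (ENNReal.ofReal q) P ≤ ENNReal.ofReal w)
    (hYw : eLpNorm Y (ENNReal.ofReal q) P ≤ ENNReal.ofReal w) :
    |cov[X, Y; P]| ≤ 4 * T ^ 2 * alphaMix P 𝒜 ℬ + 5 * (T ^ (2 - q) * w ^ q) := by
  have hXm : Measurable X := hX.mono h𝒜 le_rfl
  have hYm : Measurable Y := hY.mono hℬ le_rfl
  set X₁ := truncation X T
  set Y₁ := truncation Y T
  have hX₁T (ω : Ω) : |X₁ ω| ≤ T := (abs_truncation_le_bound X T ω).trans_eq (abs_of_pos hT)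
  have hY₁T (ω : Ω) : |Y₁ ω| ≤ T := (abs_truncation_le_bound Y T ω).trans_eq (abs_of_pos hT)
  have hX₁ : MemLp X₁ 2 P := memLp_two_of_abs_le (measurable_truncation hXm T) hX₁T
  have hY₁ : MemLp Y₁ 2 P := memLp_two_of_abs_le (measurable_truncation hYm T) hY₁T
  have hX₂ : MemLp (X - X₁) 2 P := (memLp_two_of_eLpNorm_le hXm hq hXw).sub hX₁
  have hY₂ : MemLp (Y - Y₁) 2 P := (memLp_two_of_eLpNorm_le hYm hq hYw).sub hY₁
  have low_low : |cov[X₁, Y₁; P]| ≤ 4 * T * T * alphaMix P 𝒜 ℬ := abs_covariance_le_alphaMix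
    h𝒜 hℬ (measurable_truncation hX T) hX₁T (measurable_truncation hY T) hY₁T
  have tail {Z : Ω → ℝ} (hZ : Measurable Z)
      (hZw : eLpNorm Z (ENNReal.ofReal q) P ≤ ENNReal.ofReal w) :
      2 * T * ∫ ω, |(Z - truncation Z T) ω| ∂P ≤ 2 * (T ^ (2 - q) * w ^ q) := by
    have h1 := integral_abs_sub_truncation_rpow_le hZ hT hw one_pos (by linarith) hZw
    simp only [Real.rpow_one] at h1
    calc 2 * T * ∫ ω, |(Z - truncation Z T) ω| ∂P ≤ 2 * T * (T ^ (1 - q) * w ^ q) := by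
          gcongr; exact h1
      _ = 2 * (T ^ (2 - q) * w ^ q) := by
          rw [show 2 - q = 1 + (1 - q) by ring, Real.rpow_add hT, Real.rpow_one]; ring
  have low_high : |cov[X₁, Y - Y₁; P]| ≤ 2 * (T ^ (2 - q) * w ^ q) :=
    (abs_covariance_le_integral_abs (measurable_truncation hXm T) hX₁T
      (hY₂.integrable one_le_two)).trans (tail hYm hYw)
  have high_low : |cov[X - X₁, Y₁; P]| ≤ 2 * (T ^ (2 - q) * w ^ q) := by
    rw [covariance_comm]
    exact (abs_covariance_le_integral_abs (measurable_truncation hYm T) hY₁T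
      (hX₂.integrable one_le_two)).trans (tail hXm hXw)
  have high_high : |cov[X - X₁, Y - Y₁; P]| ≤ T ^ (2 - q) * w ^ q := by
    have hXtail := integral_abs_sub_truncation_rpow_le hXm hT hw two_pos hq hXw
    have hYtail := integral_abs_sub_truncation_rpow_le hYm hT hw two_pos hq hYw
    simp only [Real.rpow_two, sq_abs] at hXtail hYtail
    exact (abs_covariance_le_integral_sq hX₂ hY₂).trans
      (by simp only [Pi.sub_apply]; linarith)
  rw [← add_sub_cancel X₁ X, ← add_sub_cancel Y₁ Y, covariance_eq_add_four hX₁ hX₂ hY₁ hY₂]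
  refine (abs_add_le _ _).trans (le_trans (add_le_add_left (abs_add_three _ _ _) _) ?_)
  linarith

-- Davydov's inequality: truncate at the level `w * α ^ (-1 / q)` that balances the two terms.
theorem abs_covariance_le_of_eLpNorm_le (h𝒜 : 𝒜 ≤ m0) (hℬ : ℬ ≤ m0) (hX : Measurable[𝒜] X)
    (hY : Measurable[ℬ] Y) (hq : 2 ≤ q) (hw : 0 < w)
    (hXw : eLpNorm X (ENNReal.ofReal q) P ≤ ENNReal.ofReal w)
    (hYw : eLpNorm Y (ENNReal.ofReal q) P ≤ ENNReal.ofReal w) {α : ℝ} (hα : 0 < α)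
    (hmix : alphaMix P 𝒜 ℬ ≤ α) : |cov[X, Y; P]| ≤ 9 * w ^ 2 * α ^ (1 - 2 / q) := by
  have hq0 : q ≠ 0 := by linarith
  have hT : 0 < w * α ^ (-1 / q) := by positivity
  have hlow : (w * α ^ (-1 / q)) ^ 2 * α = w ^ 2 * α ^ (1 - 2 / q) := by
    rw [mul_pow, ← Real.rpow_mul_natCast hα.le, mul_assoc, ← Real.rpow_add_one hα.ne']
    congr 2; push_cast; ring
  have hhigh : (w * α ^ (-1 / q)) ^ (2 - q) * w ^ q = w ^ 2 * α ^ (1 - 2 / q) := by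
    rw [Real.mul_rpow hw.le (by positivity), ← Real.rpow_mul hα.le, mul_right_comm,
      ← Real.rpow_add hw, sub_add_cancel, Real.rpow_two]
    congr 2; field_simp; ring
  calc |cov[X, Y; P]| ≤ 4 * (w * α ^ (-1 / q)) ^ 2 * alphaMix P 𝒜 ℬ +
          5 * ((w * α ^ (-1 / q)) ^ (2 - q) * w ^ q) :=
        abs_covariance_le_of_truncation h𝒜 hℬ hX hY hq hw.le hT hXw hYw
    _ ≤ 4 * ((w * α ^ (-1 / q)) ^ 2 * α) +
          5 * ((w * α ^ (-1 / q)) ^ (2 - q) * w ^ q) := by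
        rw [mul_assoc]; gcongr
    _ = 9 * w ^ 2 * α ^ (1 - 2 / q) := by rw [hlow, hhigh]; ring

end Davydov

/-- Exponential decay at rate `γ` that sets in only after the lag `ρ`. -/
noncomputable def delayedExp (γ ρ m : ℝ) : ℝ := Real.exp (-(γ * max (m - ρ) 0))

theorem delayedExp_pos (γ ρ m : ℝ) : 0 < delayedExp γ ρ m := Real.exp_pos _

theorem delayedExp_zero_lag (γ : ℝ) {m : ℝ} (hm : 0 ≤ m) :
    delayedExp γ 0 m = Real.exp (-(γ * m)) := by
  rw [delayedExp, sub_zero, max_eq_left hm]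

section ExponentialMixing

variable {Ω : Type*} {𝒜 ℬ : MeasurableSpace Ω} [m0 : MeasurableSpace Ω] {P : Measure Ω}
  [IsProbabilityMeasure P] {X Y : Ω → ℝ} {c m : ℝ}

theorem abs_covariance_le_exp_of_eLpNorm_le (h𝒜 : 𝒜 ≤ m0) (hℬ : ℬ ≤ m0) (hX : Measurable[𝒜] X)
    (hY : Measurable[ℬ] Y) {ε w : ℝ} (hε : 0 ≤ ε) (hw : 0 < w)
    (hXw : eLpNorm X (ENNReal.ofReal (2 + 2 * ε)) P ≤ ENNReal.ofReal w)
    (hYw : eLpNorm Y (ENNReal.ofReal (2 + 2 * ε)) P ≤ ENNReal.ofReal w)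
    (hmix : alphaMix P 𝒜 ℬ ≤ Real.exp (-(c * m))) :
    |cov[X, Y; P]| ≤ 9 * w ^ 2 * Real.exp (-(c * ε / (1 + ε) * m)) := by
  convert abs_covariance_le_of_eLpNorm_le h𝒜 hℬ hX hY (by linarith) hw hXw hYw
    (Real.exp_pos _) hmix using 2
  rw [← Real.exp_mul]
  congr 1
  field_simp
  ring

theorem integral_sq_mul_le {B U : ℝ} (hX : Measurable X) (hY : Measurable Y)
    (hXB : ∀ ω, |X ω| ≤ B) (hYB : ∀ ω, |Y ω| ≤ B) (hX4 : ∫ ω, X ω ^ 4 ∂P ≤ U)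
    (hY4 : ∫ ω, Y ω ^ 4 ∂P ≤ U) : ∫ ω, (X ω * Y ω) ^ 2 ∂P ≤ U := by
  have integrable_pow_four {Z : Ω → ℝ} (hZ : Measurable Z) (hZB : ∀ ω, |Z ω| ≤ B) :
      Integrable (fun ω => Z ω ^ 4) P :=
    integrable_of_abs_le (A := B ^ 4) (hZ.pow_const 4) fun ω => by
      rw [abs_pow]; exact pow_le_pow_left₀ (abs_nonneg _) (hZB ω) 4
  have hX4i := integrable_pow_four hX hXB
  have hY4i := integrable_pow_four hY hYB
  calc ∫ ω, (X ω * Y ω) ^ 2 ∂P ≤ ∫ ω, (X ω ^ 4 + Y ω ^ 4) / 2 ∂P :=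
        integral_mono_of_nonneg (ae_of_all _ fun ω => sq_nonneg _)
          ((hX4i.add hY4i).div_const 2)
          (ae_of_all _ fun ω => by nlinarith [sq_nonneg (X ω ^ 2 - Y ω ^ 2)])
    _ = (∫ ω, X ω ^ 4 ∂P + ∫ ω, Y ω ^ 4 ∂P) / 2 := by
        rw [integral_div, integral_add hX4i hY4i]
    _ ≤ U := by linarith

-- The mixing bound `4 B² exp (-c m)` beats the moment bound `U` once `m` exceeds the lag `ρ`.
theorem abs_covariance_le_delayedExp (h𝒜 : 𝒜 ≤ m0) (hℬ : ℬ ≤ m0) (hX : Measurable[𝒜] X)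
    (hY : Measurable[ℬ] Y) {B U ρ : ℝ} (hXB : ∀ ω, |X ω| ≤ B) (hYB : ∀ ω, |Y ω| ≤ B)
    (hX2 : ∫ ω, X ω ^ 2 ∂P ≤ U) (hY2 : ∫ ω, Y ω ^ 2 ∂P ≤ U)
    (hmix : alphaMix P 𝒜 ℬ ≤ Real.exp (-(c * m))) (hρ : 4 * B ^ 2 ≤ U * Real.exp (c * ρ)) :
    |cov[X, Y; P]| ≤ U * delayedExp c ρ m := by
  rw [delayedExp]
  rcases le_total m ρ with h | h
  · rw [max_eq_right (sub_nonpos.mpr h), mul_zero, neg_zero, Real.exp_zero, mul_one]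
    have := abs_covariance_le_integral_sq
      (memLp_two_of_abs_le (P := P) (hX.mono h𝒜 le_rfl) hXB)
      (memLp_two_of_abs_le (P := P) (hY.mono hℬ le_rfl) hYB)
    linarith
  · rw [max_eq_left (sub_nonneg.mpr h)]
    calc |cov[X, Y; P]| ≤ 4 * B * B * alphaMix P 𝒜 ℬ :=
          abs_covariance_le_alphaMix h𝒜 hℬ hX hXB hY hYB
      _ = 4 * B ^ 2 * alphaMix P 𝒜 ℬ := by ring
      _ ≤ 4 * B ^ 2 * Real.exp (-(c * m)) := by gcongr
      _ ≤ U * Real.exp (c * ρ) * Real.exp (-(c * m)) := by gcongr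
      _ = U * Real.exp (-(c * (m - ρ))) := by
          rw [mul_assoc, ← Real.exp_add]; congr 2; ring

end ExponentialMixing

section TruncationError

theorem trunc_eq_max_min {τ : ℝ} (hτ : 0 ≤ τ) (x : ℝ) : trunc τ x = max (-τ) (min x τ) := by
  unfold trunc
  rcases lt_trichotomy x 0 with h | rfl | h
  · rw [sign_neg h, abs_of_neg h, min_eq_left (h.le.trans hτ), ← neg_neg x, max_neg_neg, neg_neg x,
      min_comm]
    simp
  · simp [hτ]
  · rw [sign_pos h, abs_of_pos h, max_eq_right (by linarith [le_min h.le hτ])]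
    simp

theorem measurable_trunc {τ : ℝ} (hτ : 0 ≤ τ) : Measurable (trunc τ) := by
  rw [funext (trunc_eq_max_min hτ)]
  fun_prop

theorem trunc_of_abs_le {τ x : ℝ} (h : |x| ≤ τ) : trunc τ x = x := by
  rw [trunc, min_eq_left h, sign_mul_abs]

theorem abs_trunc_le {τ : ℝ} (hτ : 0 ≤ τ) (x : ℝ) : |trunc τ x| ≤ τ := by
  rw [trunc_eq_max_min hτ, abs_le]
  exact ⟨le_max_left _ _, max_le (by linarith) (min_le_right _ _)⟩

theorem abs_trunc_sub_trunc_le {τ : ℝ} (hτ : 0 ≤ τ) (x y : ℝ) :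
    |trunc τ x - trunc τ y| ≤ |x - y| := by
  rw [trunc_eq_max_min hτ, trunc_eq_max_min hτ]
  calc |max (-τ) (min x τ) - max (-τ) (min y τ)| ≤ max |(-τ) - (-τ)| |min x τ - min y τ| :=
        abs_max_sub_max_le_max _ _ _ _
    _ = |min x τ - min y τ| := by simp
    _ ≤ max |x - y| |τ - τ| := abs_min_sub_min_le_max _ _ _ _
    _ = |x - y| := by simp

theorem abs_trunc_sub_self {τ : ℝ} (hτ : 0 ≤ τ) (x : ℝ) : |trunc τ x - x| = max (|x| - τ) 0 := by
  rcases le_total |x| τ with h | h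
  · rw [trunc_of_abs_le h, sub_self, abs_zero, max_eq_right (sub_nonpos.mpr h)]
  · rw [trunc_eq_max_min hτ, max_eq_left (sub_nonneg.mpr h)]
    rcases le_total 0 x with hx | hx
    · rw [abs_of_nonneg hx] at h ⊢
      rw [min_eq_right h, max_eq_right (by linarith), abs_sub_comm, abs_of_nonneg (by linarith)]
    · rw [abs_of_nonpos hx] at h ⊢
      rw [min_eq_left (by linarith), max_eq_left (by linarith), abs_of_nonneg (by linarith)]
      ring

/-- The idiosyncratic part of an observation `χ + x`, with common component `χ`, after truncation
at level `τ`. -/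
noncomputable def truncErr (τ χ x : ℝ) : ℝ := trunc τ (χ + x) - χ

theorem measurable_truncErr {τ : ℝ} (hτ : 0 ≤ τ) (χ : ℝ) : Measurable (truncErr τ χ) :=
  ((measurable_trunc hτ).comp (measurable_const_add χ)).sub_const χ

theorem abs_truncErr_le_abs {τ χ : ℝ} (hχ : |χ| ≤ τ) (x : ℝ) : |truncErr τ χ x| ≤ |x| := by
  have h := abs_trunc_sub_trunc_le ((abs_nonneg χ).trans hχ) (χ + x) χ
  rwa [trunc_of_abs_le hχ, add_sub_cancel_left] at h

theorem abs_truncErr_le {τ χ : ℝ} (hχ : |χ| ≤ τ) (x : ℝ) : |truncErr τ χ x| ≤ 2 * τ :=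
  (abs_sub _ _).trans (by linarith [abs_trunc_le ((abs_nonneg χ).trans hχ) (χ + x)])

theorem abs_truncErr_sub_self_le {τ χ q : ℝ} (hτ : 0 < τ) (hχ : |χ| ≤ τ / 2) (hq : 1 ≤ q) (x : ℝ) :
    |truncErr τ χ x - x| ≤ (τ / 2) ^ (1 - q) * |x| ^ q := by
  have hle : |truncErr τ χ x - x| ≤ max (|x| - τ / 2) 0 := by
    rw [truncErr, sub_sub, abs_trunc_sub_self hτ.le]
    exact max_le_max_right 0 (by linarith [abs_add_le χ x])
  refine hle.trans (max_le ?_ (by positivity))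
  rcases le_or_gt |x| (τ / 2) with h | h
  · exact (sub_nonpos.mpr h).trans (by positivity)
  · have hx : 0 < |x| := (half_pos hτ).trans h
    calc |x| - τ / 2 ≤ |x| ^ (1 - q) * |x| ^ q := by
          rw [← Real.rpow_add hx, sub_add_cancel, Real.rpow_one]; linarith
      _ ≤ (τ / 2) ^ (1 - q) * |x| ^ q := by
          have := Real.rpow_le_rpow_of_nonpos (half_pos hτ) h.le (sub_nonpos.mpr hq)
          gcongr

variable {Ω : Type*} [MeasurableSpace Ω] {P : Measure Ω} {X : Ω → ℝ} {q w τ χ : ℝ}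

theorem eLpNorm_truncErr_le (hχ : |χ| ≤ τ) (h : eLpNorm X (ENNReal.ofReal q) P ≤ ENNReal.ofReal w) :
    eLpNorm (fun ω => truncErr τ χ (X ω)) (ENNReal.ofReal q) P ≤ ENNReal.ofReal w :=
  (eLpNorm_mono fun ω => abs_truncErr_le_abs hχ (X ω)).trans h

theorem integral_pow_four_le_of_abs_le {B : ℝ} (hX : Measurable X) (hB : 0 ≤ B)
    (hXB : ∀ ω, |X ω| ≤ B) (hq : 0 < q) (hq4 : q ≤ 4) (hw : 0 ≤ w)
    (h : eLpNorm X (ENNReal.ofReal q) P ≤ ENNReal.ofReal w) :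
    ∫ ω, X ω ^ 4 ∂P ≤ B ^ (4 - q) * w ^ q := by
  have pow_four_le (ω : Ω) : X ω ^ 4 ≤ B ^ (4 - q) * |X ω| ^ q :=
    calc X ω ^ 4 = |X ω| ^ (4 : ℝ) := by
          rw [← (show Even 4 by decide).pow_abs]; exact (Real.rpow_natCast _ 4).symm
      _ = |X ω| ^ (4 - q) * |X ω| ^ q := by
          rw [← Real.rpow_add_of_nonneg (abs_nonneg _) (by linarith) hq.le, sub_add_cancel]
      _ ≤ B ^ (4 - q) * |X ω| ^ q := by
          have := Real.rpow_le_rpow (abs_nonneg _) (hXB ω) (sub_nonneg.mpr hq4)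
          gcongr
  calc ∫ ω, X ω ^ 4 ∂P ≤ ∫ ω, B ^ (4 - q) * |X ω| ^ q ∂P :=
        integral_mono_of_nonneg (ae_of_all _ fun ω => by positivity)
          ((integrable_abs_rpow_of_eLpNorm_le hX hq h).const_mul _) (ae_of_all _ pow_four_le)
    _ ≤ B ^ (4 - q) * w ^ q := by
        rw [integral_const_mul]
        have := integral_abs_rpow_le_of_eLpNorm_le hX hq hw h
        gcongr

theorem abs_integral_truncErr_le [IsFiniteMeasure P] (hX : Measurable X) (hX0 : ∫ ω, X ω ∂P = 0)
    (hτ : 0 < τ) (hχ : |χ| ≤ τ / 2) (hq : 1 ≤ q) (hw : 0 ≤ w)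
    (h : eLpNorm X (ENNReal.ofReal q) P ≤ ENNReal.ofReal w) :
    |∫ ω, truncErr τ χ (X ω) ∂P| ≤ (τ / 2) ^ (1 - q) * w ^ q := by
  have hq0 : 0 < q := one_pos.trans_le hq
  have hXi : Integrable X P :=
    MemLp.integrable (by simpa using ENNReal.ofReal_le_ofReal hq)
      ⟨hX.aestronglyMeasurable, h.trans_lt ENNReal.ofReal_lt_top⟩
  have hZi : Integrable (fun ω => truncErr τ χ (X ω)) P :=
    integrable_of_abs_le ((measurable_truncErr hτ.le χ).comp hX)
      fun ω => abs_truncErr_le (hχ.trans (half_le_self hτ.le)) (X ω)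
  calc |∫ ω, truncErr τ χ (X ω) ∂P| = |∫ ω, (truncErr τ χ (X ω) - X ω) ∂P| := by
        rw [integral_sub hZi hXi, hX0, sub_zero]
    _ ≤ ∫ ω, |truncErr τ χ (X ω) - X ω| ∂P := abs_integral_le_integral_abs
    _ ≤ ∫ ω, (τ / 2) ^ (1 - q) * |X ω| ^ q ∂P :=
        integral_mono (hZi.sub hXi).abs
          ((integrable_abs_rpow_of_eLpNorm_le hX hq0 h).const_mul _)
          fun ω => abs_truncErr_sub_self_le hτ hχ hq (X ω)
    _ ≤ (τ / 2) ^ (1 - q) * w ^ q := by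
        rw [integral_const_mul]
        have := integral_abs_rpow_le_of_eLpNorm_le hX hq0 hw h
        gcongr

end TruncationError

section ExponentialSums

theorem delayedExp_anti {γ ρ m m' : ℝ} (hγ : 0 ≤ γ) (h : m' ≤ m) :
    delayedExp γ ρ m ≤ delayedExp γ ρ m' := by
  unfold delayedExp
  gcongr

theorem delayedExp_le_one {γ : ℝ} (hγ : 0 ≤ γ) (ρ m : ℝ) : delayedExp γ ρ m ≤ 1 :=
  Real.exp_le_one_iff.mpr (neg_nonpos.mpr (mul_nonneg hγ (le_max_right _ _)))

/-- Up to the lag, the value of the sum of `delayedExp γ ρ` over the natural numbers, bounded by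
one term at the lag and a geometric series beyond it. -/
noncomputable def expSumConst (γ : ℝ) : ℝ := 1 + (1 - Real.exp (-γ))⁻¹

variable {γ ρ : ℝ}

theorem expSumConst_pos (hγ : 0 < γ) : 0 < expSumConst γ := by
  have h : 0 < (1 - Real.exp (-γ))⁻¹ :=
    inv_pos.mpr (sub_pos.mpr (Real.exp_lt_one_iff.mpr (neg_neg_of_pos hγ)))
  unfold expSumConst
  linarith

theorem delayedExp_floor_add_one_add_le (hγ : 0 ≤ γ) (d : ℕ) :
    delayedExp γ ρ ((⌊ρ⌋₊ + 1 + d : ℕ) : ℝ) ≤ Real.exp (-γ) ^ d := by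
  have hd : (d : ℝ) ≤ ((⌊ρ⌋₊ + 1 + d : ℕ) : ℝ) - ρ := by
    push_cast; linarith [Nat.lt_floor_add_one ρ]
  rw [← Real.exp_nat_mul, delayedExp, Real.exp_le_exp]
  linarith [mul_le_mul_of_nonneg_left (hd.trans (le_max_left _ (0 : ℝ))) hγ]

theorem sum_delayedExp_le (hγ : 0 < γ) (hρ : 0 ≤ ρ) (s : Finset ℕ) :
    ∑ d ∈ s, delayedExp γ ρ d ≤ ρ + expSumConst γ := by
  obtain ⟨D, hD⟩ := s.exists_nat_subset_range
  have hr : Real.exp (-γ) < 1 := Real.exp_lt_one_iff.mpr (neg_neg_of_pos hγ)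
  calc ∑ d ∈ s, delayedExp γ ρ d
      ≤ ∑ d ∈ Finset.range (⌊ρ⌋₊ + 1 + D), delayedExp γ ρ d :=
        Finset.sum_le_sum_of_subset_of_nonneg (hD.trans (Finset.range_mono (by omega)))
          fun _ _ _ => (delayedExp_pos _ _ _).le
    _ = ∑ d ∈ Finset.range (⌊ρ⌋₊ + 1), delayedExp γ ρ d +
        ∑ d ∈ Finset.range D, delayedExp γ ρ ((⌊ρ⌋₊ + 1 + d : ℕ) : ℝ) :=
        Finset.sum_range_add _ _ _
    _ ≤ ∑ _d ∈ Finset.range (⌊ρ⌋₊ + 1), (1 : ℝ) + ∑ d ∈ Finset.range D, Real.exp (-γ) ^ d := by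
        gcongr
        · exact delayedExp_le_one hγ.le _ _
        · exact delayedExp_floor_add_one_add_le hγ.le _
    _ ≤ (⌊ρ⌋₊ + 1) + (1 - Real.exp (-γ))⁻¹ := by
        refine add_le_add (by simp) ?_
        rw [← tsum_geometric_of_lt_one (Real.exp_pos _).le hr]
        exact (summable_geometric_of_lt_one (Real.exp_pos _).le hr).sum_le_tsum _
          fun _ _ => by positivity
    _ ≤ ρ + expSumConst γ := by
        unfold expSumConst
        linarith [Nat.floor_le hρ]

theorem sum_delayedExp_natAbs_le {β : Type*} (hγ : 0 < γ) (hρ : 0 ≤ ρ) (s : Finset β) {φ : β → ℤ}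
    (hφ : Set.InjOn φ s) (a : ℤ) :
    ∑ x ∈ s, delayedExp γ ρ (a - φ x).natAbs ≤ 2 * (ρ + expSumConst γ) := by
  have one_sided {t : Finset β} (ht : Set.InjOn (fun x => (a - φ x).natAbs) t) :
      ∑ x ∈ t, delayedExp γ ρ (a - φ x).natAbs ≤ ρ + expSumConst γ := by
    rw [← Finset.sum_image (f := fun d : ℕ => delayedExp γ ρ d) ht]
    exact sum_delayedExp_le hγ hρ _
  have left : ∑ x ∈ s with φ x ≤ a, delayedExp γ ρ (a - φ x).natAbs ≤ ρ + expSumConst γ := by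
    refine one_sided fun x hx y hy h => ?_
    simp only [Finset.coe_filter, Set.mem_ofPred_eq] at hx hy h
    exact hφ hx.1 hy.1 (by omega)
  have right : ∑ x ∈ s with ¬ φ x ≤ a, delayedExp γ ρ (a - φ x).natAbs ≤ ρ + expSumConst γ := by
    refine one_sided fun x hx y hy h => ?_
    simp only [Finset.coe_filter, Set.mem_ofPred_eq] at hx hy h
    exact hφ hx.1 hy.1 (by omega)
  rw [← Finset.sum_filter_add_sum_filter_not s (fun x => φ x ≤ a)]
  linarith

variable {J : Type*} [Fintype J]

theorem sum_prod_delayedExp_natAbs_le (hγ : 0 < γ) (hρ : 0 ≤ ρ) (s : Finset (J → ℤ)) (a : J → ℤ) :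
    ∑ x ∈ s, ∏ j, delayedExp γ ρ (a j - x j).natAbs ≤
      (2 * (ρ + expSumConst γ)) ^ Fintype.card J := by
  classical
  let box (j : J) : Finset ℤ := s.image (· j)
  have subset_box : s ⊆ Fintype.piFinset box := fun x hx =>
    Fintype.mem_piFinset.mpr fun j => Finset.mem_image_of_mem (· j) hx
  have delayedExp_nonneg (m : ℝ) : 0 ≤ delayedExp γ ρ m := (delayedExp_pos _ _ _).le
  calc ∑ x ∈ s, ∏ j, delayedExp γ ρ (a j - x j).natAbs
      ≤ ∑ x ∈ Fintype.piFinset box, ∏ j, delayedExp γ ρ (a j - x j).natAbs :=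
        Finset.sum_le_sum_of_subset_of_nonneg subset_box
          fun _ _ _ => Finset.prod_nonneg fun _ _ => delayedExp_nonneg _
    _ = ∏ j, ∑ y ∈ box j, delayedExp γ ρ (a j - y).natAbs :=
        (Finset.prod_univ_sum box fun j y => delayedExp γ ρ (a j - y).natAbs).symm
    _ ≤ ∏ _j : J, 2 * (ρ + expSumConst γ) :=
        Finset.prod_le_prod (fun _ _ => Finset.sum_nonneg fun _ _ => delayedExp_nonneg _)
          fun j _ => sum_delayedExp_natAbs_le hγ hρ _ Function.injective_id.injOn (a j)
    _ = (2 * (ρ + expSumConst γ)) ^ Fintype.card J := by simp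

theorem delayedExp_le_prod [Nonempty J] (hγ : 0 ≤ γ) {m : ℝ} {d : J → ℝ} (hd : ∀ j, d j ≤ m) :
    delayedExp γ ρ m ≤ ∏ j, delayedExp (γ / Fintype.card J) ρ (d j) := by
  have hcard : (Fintype.card J : ℝ) ≠ 0 := by positivity
  calc delayedExp γ ρ m = ∏ _j : J, delayedExp (γ / Fintype.card J) ρ m := by
        simp only [delayedExp, Finset.prod_const, Finset.card_univ, ← Real.exp_nat_mul]
        congr 1
        field_simp
    _ ≤ _ := Finset.prod_le_prod (fun _ _ => (delayedExp_pos _ _ _).le)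
        fun j _ => delayedExp_anti (by positivity) (hd j)

theorem sum_delayedExp_le_of_natAbs_le [Nonempty J] {β : Type*} (hγ : 0 < γ) (hρ : 0 ≤ ρ)
    (s : Finset β) {φ : β → J → ℤ} (hφ : Set.InjOn φ s) (a : J → ℤ) {m : β → ℕ}
    (hm : ∀ x j, (a j - φ x j).natAbs ≤ m x) :
    ∑ x ∈ s, delayedExp γ ρ (m x) ≤
      (2 * (ρ + expSumConst (γ / Fintype.card J))) ^ Fintype.card J := by
  classical
  calc ∑ x ∈ s, delayedExp γ ρ (m x)
      ≤ ∑ x ∈ s, ∏ j, delayedExp (γ / Fintype.card J) ρ (a j - φ x j).natAbs :=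
        Finset.sum_le_sum fun x _ => delayedExp_le_prod hγ.le fun j => by exact_mod_cast hm x j
    _ = ∑ y ∈ s.image φ, ∏ j, delayedExp (γ / Fintype.card J) ρ (a j - y j).natAbs :=
        (Finset.sum_image (f := fun y : J → ℤ =>
          ∏ j, delayedExp (γ / Fintype.card J) ρ (a j - y j).natAbs) hφ).symm
    _ ≤ _ := sum_prod_delayedExp_natAbs_le (by positivity) hρ _ a

end ExponentialSums

section SampleGram

open scoped Matrix.Norms.L2Operator

variable {Ω : Type*} [MeasurableSpace Ω] {P : Measure Ω}
  {β m n : Type*}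

theorem variance_weighted_sum_le [IsFiniteMeasure P] (S : Finset β) {X : β → Ω → ℝ}
    (hX : ∀ s ∈ S, MemLp (X s) 2 P) (a : β → ℝ) {C : ℝ}
    (hcov : ∀ s ∈ S, ∑ s' ∈ S, |cov[X s, X s'; P]| ≤ C) :
    Var[fun ω => ∑ s ∈ S, a s * X s ω; P] ≤ C * ∑ s ∈ S, a s ^ 2 := by
  have young (s s' : β) : cov[fun ω => a s * X s ω, fun ω => a s' * X s' ω; P] ≤
      a s ^ 2 / 2 * |cov[X s, X s'; P]| + a s' ^ 2 / 2 * |cov[X s', X s; P]| := by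
    rw [covariance_const_mul_left, covariance_const_mul_right, covariance_comm (X s'), ← add_mul,
      ← mul_assoc]
    refine (le_abs_self _).trans ?_
    rw [abs_mul]
    refine mul_le_mul_of_nonneg_right (abs_le.mpr ⟨?_, ?_⟩) (abs_nonneg _) <;>
      nlinarith [sq_nonneg (a s - a s'), sq_nonneg (a s + a s')]
  calc Var[fun ω => ∑ s ∈ S, a s * X s ω; P]
      = ∑ s ∈ S, ∑ s' ∈ S, cov[fun ω => a s * X s ω, fun ω => a s' * X s' ω; P] :=
        variance_fun_sum' fun s hs => (hX s hs).const_mul (a s)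
    _ ≤ ∑ s ∈ S, ∑ s' ∈ S,
          (a s ^ 2 / 2 * |cov[X s, X s'; P]| + a s' ^ 2 / 2 * |cov[X s', X s; P]|) :=
        Finset.sum_le_sum fun s _ => Finset.sum_le_sum fun s' _ => young s s'
    _ = ∑ s ∈ S, a s ^ 2 * ∑ s' ∈ S, |cov[X s, X s'; P]| := by
        simp_rw [Finset.sum_add_distrib]
        rw [Finset.sum_comm (f := fun s s' => a s' ^ 2 / 2 * |cov[X s', X s; P]|),
          ← Finset.sum_add_distrib]
        refine Finset.sum_congr rfl fun s _ => ?_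
        rw [← Finset.mul_sum]
        ring
    _ ≤ ∑ s ∈ S, a s ^ 2 * C :=
        Finset.sum_le_sum fun s hs => mul_le_mul_of_nonneg_left (hcov s hs) (sq_nonneg _)
    _ = C * ∑ s ∈ S, a s ^ 2 := by rw [← Finset.sum_mul, mul_comm]

/-- The empirical inner product `|S|⁻¹ ∑_{s ∈ S} x_s y_s` of two samples. -/
noncomputable def sampleInner (S : Finset β) (x y : β → ℝ) : ℝ :=
  (S.card : ℝ)⁻¹ * ∑ s ∈ S, x s * y s

/-- The second moment matrix of a sample of vectors, with entries `|S|⁻¹ ∑_{s ∈ S} x_{is} x_{js}`;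
the rows of `x` are the coordinates and its columns the observations. -/
noncomputable def sampleGram (S : Finset β) (x : m → β → ℝ) : Matrix m m ℝ :=
  Matrix.of fun i j => sampleInner S (x i) (x j)

theorem sampleInner_comm (S : Finset β) (x y : β → ℝ) :
    sampleInner S x y = sampleInner S y x := by
  simp only [sampleInner, mul_comm]

theorem sampleInner_eq_sum (S : Finset β) (x y : β → ℝ) :
    sampleInner S x y = ∑ s ∈ S, ((S.card : ℝ)⁻¹ * y s) * x s := by
  rw [sampleInner, Finset.mul_sum]
  exact Finset.sum_congr rfl fun s _ => by ring

theorem sampleInner_add_add (S : Finset β) (x x' y y' : β → ℝ) :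
    sampleInner S (fun s => x s + x' s) (fun s => y s + y' s) = sampleInner S x y +
      sampleInner S x y' + sampleInner S x' y + sampleInner S x' y' := by
  simp only [sampleInner, add_mul, mul_add, Finset.sum_add_distrib]
  ring

theorem sampleInner_sq_le (S : Finset β) (x y : β → ℝ) :
    sampleInner S x y ^ 2 ≤ sampleInner S x x * sampleInner S y y := by
  simp only [sampleInner, mul_pow, ← sq]
  calc ((S.card : ℝ)⁻¹) ^ 2 * (∑ s ∈ S, x s * y s) ^ 2
      ≤ ((S.card : ℝ)⁻¹) ^ 2 * ((∑ s ∈ S, x s ^ 2) * ∑ s ∈ S, y s ^ 2) :=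
        mul_le_mul_of_nonneg_left (Finset.sum_mul_sq_le_sq_mul_sq S x y) (sq_nonneg _)
    _ = _ := by ring

theorem abs_sampleMean_le {S : Finset β} {x : β → ℝ} {B : ℝ} (hB : 0 ≤ B)
    (hx : ∀ s ∈ S, |x s| ≤ B) : |(S.card : ℝ)⁻¹ * ∑ s ∈ S, x s| ≤ B := by
  rw [abs_mul, abs_of_nonneg (by positivity : (0 : ℝ) ≤ (S.card : ℝ)⁻¹)]
  calc (S.card : ℝ)⁻¹ * |∑ s ∈ S, x s| ≤ (S.card : ℝ)⁻¹ * (S.card * B) := by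
        gcongr
        exact (Finset.abs_sum_le_sum_abs _ _).trans
          ((Finset.sum_le_card_nsmul S _ B hx).trans_eq (nsmul_eq_mul _ _))
    _ ≤ 1 * B := by
        rw [← mul_assoc]
        exact mul_le_mul_of_nonneg_right inv_mul_le_one hB
    _ = B := one_mul B

section Moments

variable {S : Finset β} {X Y : β → Ω → ℝ} {C B : ℝ}

theorem memLp_two_sampleInner_const (hX : ∀ s ∈ S, MemLp (X s) 2 P) (a : β → ℝ) :
    MemLp (fun ω => sampleInner S (X · ω) a) 2 P := by
  simp only [sampleInner_eq_sum]
  exact memLp_finsetSum S fun s hs => (hX s hs).const_mul _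

theorem memLp_two_mul {X Y : Ω → ℝ} (hX : MemLp X 4 P) (hY : MemLp Y 4 P) :
    MemLp (fun ω => X ω * Y ω) 2 P := by
  have : ENNReal.HolderTriple 4 4 2 := ⟨by
    rw [← two_mul, show (4 : ENNReal) = 2 * 2 by norm_num,
      ENNReal.mul_inv (by simp) (by simp), ← mul_assoc,
      ENNReal.mul_inv_cancel (by simp) (by simp), one_mul]⟩
  exact hY.mul' hX

theorem memLp_two_sampleInner (hX : ∀ s ∈ S, MemLp (X s) 4 P) (hY : ∀ s ∈ S, MemLp (Y s) 4 P) :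
    MemLp (fun ω => sampleInner S (X · ω) (Y · ω)) 2 P :=
  (memLp_finsetSum S fun s hs => memLp_two_mul (hX s hs) (hY s hs)).const_mul _

theorem variance_sampleMean_le [IsFiniteMeasure P] (hX : ∀ s ∈ S, MemLp (X s) 2 P)
    (hcov : ∀ s ∈ S, ∑ s' ∈ S, |cov[X s, X s'; P]| ≤ C) :
    Var[fun ω => (S.card : ℝ)⁻¹ * ∑ s ∈ S, X s ω; P] ≤ C / S.card := by
  have h := variance_weighted_sum_le S hX (fun _ => (S.card : ℝ)⁻¹) hcov
  simp_rw [← Finset.mul_sum] at h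
  refine h.trans_eq ?_
  rw [Finset.sum_const, nsmul_eq_mul]
  rcases eq_or_ne (S.card : ℝ) 0 with h0 | h0
  · simp [h0]
  · field_simp

theorem variance_sampleInner_const_le [IsFiniteMeasure P] (hX : ∀ s ∈ S, MemLp (X s) 2 P)
    (hcov : ∀ s ∈ S, ∑ s' ∈ S, |cov[X s, X s'; P]| ≤ C) (a : β → ℝ) :
    Var[fun ω => sampleInner S (X · ω) a; P] ≤ C / S.card * sampleInner S a a := by
  simp only [sampleInner_eq_sum S _ a]
  refine (variance_weighted_sum_le S hX _ hcov).trans_eq ?_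
  rw [div_mul_eq_mul_div, mul_div_assoc, Finset.sum_div]
  congr 1
  exact Finset.sum_congr rfl fun s _ => by ring

theorem integral_sampleInner_const (hX : ∀ s ∈ S, Integrable (X s) P) (a : β → ℝ) :
    ∫ ω, sampleInner S (X · ω) a ∂P = sampleInner S (fun s => ∫ ω, X s ω ∂P) a := by
  simp only [sampleInner_eq_sum S _ a]
  rw [integral_finsetSum S fun s hs => (hX s hs).const_mul _]
  simp only [integral_const_mul]

theorem sampleInner_self_le {x : β → ℝ} (hx : ∀ s ∈ S, |x s| ≤ B) :
    sampleInner S x x ≤ B ^ 2 := by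
  refine (le_abs_self _).trans (abs_sampleMean_le (sq_nonneg B) fun s hs => ?_)
  rw [abs_mul_self, ← sq, ← sq_abs]
  exact pow_le_pow_left₀ (abs_nonneg _) (hx s hs) 2

theorem integral_sq_sampleInner_const_le [IsProbabilityMeasure P]
    (hX : ∀ s ∈ S, MemLp (X s) 2 P) (hcov : ∀ s ∈ S, ∑ s' ∈ S, |cov[X s, X s'; P]| ≤ C)
    (hbias : ∀ s ∈ S, |∫ ω, X s ω ∂P| ≤ B) (a : β → ℝ) :
    ∫ ω, sampleInner S (X · ω) a ^ 2 ∂P ≤ (C / S.card + B ^ 2) * sampleInner S a a := by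
  have hvar := variance_eq_sub (memLp_two_sampleInner_const hX a)
  simp only [Pi.pow_apply] at hvar
  have hmean : (∫ ω, sampleInner S (X · ω) a ∂P) ^ 2 ≤ B ^ 2 * sampleInner S a a := by
    rw [integral_sampleInner_const (fun s hs => (hX s hs).integrable one_le_two)]
    exact (sampleInner_sq_le S _ a).trans
      (mul_le_mul_of_nonneg_right (sampleInner_self_le hbias)
        (mul_nonneg (by positivity) (Finset.sum_nonneg fun s _ => mul_self_nonneg _)))
  linarith [variance_sampleInner_const_le hX hcov a]

end Moments

theorem measure_lt_l2_opNorm_le [Fintype m] [Fintype n] [DecidableEq n] [IsFiniteMeasure P]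
    {A : Ω → Matrix m n ℝ} (hA : ∀ i j, Integrable (fun ω => A ω i j ^ 2) P) {T : ℝ} (hT : 0 < T) :
    P {ω | T < ‖A ω‖} ≤ ENNReal.ofReal ((∑ i, ∑ j, ∫ ω, A ω i j ^ 2 ∂P) / T ^ 2) := by
  have hint : Integrable (fun ω => ∑ i, ∑ j, A ω i j ^ 2) P :=
    integrable_finsetSum _ fun i _ => integrable_finsetSum _ fun j _ => hA i j
  have hsum : ∫ ω, ∑ i, ∑ j, A ω i j ^ 2 ∂P = ∑ i, ∑ j, ∫ ω, A ω i j ^ 2 ∂P := by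
    rw [integral_finsetSum _ fun i _ => integrable_finsetSum _ fun j _ => hA i j]
    exact Finset.sum_congr rfl fun i _ => integral_finsetSum _ fun j _ => hA i j
  have hmarkov := mul_meas_ge_le_integral_of_nonneg
    (ae_of_all P fun ω => by positivity : 0 ≤ᵐ[P] fun ω => ∑ i, ∑ j, A ω i j ^ 2) hint (T ^ 2)
  calc P {ω | T < ‖A ω‖} ≤ P {ω | T ^ 2 ≤ ∑ i, ∑ j, A ω i j ^ 2} :=
        measure_mono fun ω (hω : T < ‖A ω‖) =>
          ((Real.lt_sqrt hT.le).mp (hω.trans_le (l2_opNorm_le_sqrt_sum_sq _))).le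
    _ = ENNReal.ofReal (P.real {ω | T ^ 2 ≤ ∑ i, ∑ j, A ω i j ^ 2}) :=
        (ofReal_measureReal).symm
    _ ≤ ENNReal.ofReal ((∑ i, ∑ j, ∫ ω, A ω i j ^ 2 ∂P) / T ^ 2) := by
        refine ENNReal.ofReal_le_ofReal ((le_div_iff₀ (by positivity)).mpr ?_)
        rwa [mul_comm, ← hsum]

/-- Errors `e` with bias at most `B` whose covariances are summable along the sample (`C₁`) and
along the coordinates (`C₂`), and whose sample second moments have total variance at most `V`. -/
structure WeakError [Fintype m] (P : Measure Ω) (S : Finset β) (e : m → β → Ω → ℝ)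
    (B C₁ C₂ V : ℝ) : Prop where
  memLp : ∀ i, ∀ s ∈ S, MemLp (e i s) 4 P
  bias : ∀ i, ∀ s ∈ S, |∫ ω, e i s ω ∂P| ≤ B
  cov_sample : ∀ i, ∀ s ∈ S, ∑ s' ∈ S, |cov[e i s, e i s'; P]| ≤ C₁
  cov_coord : ∀ i, ∀ s ∈ S, ∑ j, |cov[e i s, e j s; P]| ≤ C₂
  variance : ∑ i, ∑ j, Var[fun ω => sampleInner S (e i · ω) (e j · ω); P] ≤ V

/-- The expected second moment matrix of the errors `e`. -/
noncomputable def meanErrorGram (P : Measure Ω) (S : Finset β) (e : m → β → Ω → ℝ) :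
    Matrix m m ℝ :=
  Matrix.of fun i j => ∫ ω, sampleInner S (e i · ω) (e j · ω) ∂P

/-- The change of the second moment matrix of a signal `χ` caused by errors `e`, up to the expected
second moment matrix of the errors. -/
noncomputable def centredPerturbation (P : Measure Ω) (S : Finset β) (χ : m → β → ℝ)
    (e : m → β → Ω → ℝ) (ω : Ω) : Matrix m m ℝ :=
  sampleGram S (fun i s => χ i s + e i s ω) - sampleGram S χ - meanErrorGram P S e

theorem centredPerturbation_apply (S : Finset β) (χ : m → β → ℝ) (e : m → β → Ω → ℝ) (ω : Ω)
    (i j : m) : centredPerturbation P S χ e ω i j = sampleInner S (e i · ω) (χ j) +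
      sampleInner S (e j · ω) (χ i) + (sampleInner S (e i · ω) (e j · ω) -
        ∫ ω', sampleInner S (e i · ω') (e j · ω') ∂P) := by
  simp only [centredPerturbation, sampleGram, meanErrorGram, Matrix.sub_apply, Matrix.of_apply,
    sampleInner_add_add, sampleInner_comm S (χ i) (e j · ω)]
  ring

theorem integral_sq_add_add_le {X Y Z : Ω → ℝ} (hX : MemLp X 2 P) (hY : MemLp Y 2 P)
    (hZ : MemLp Z 2 P) : ∫ ω, (X ω + Y ω + Z ω) ^ 2 ∂P ≤
      3 * (∫ ω, X ω ^ 2 ∂P + ∫ ω, Y ω ^ 2 ∂P + ∫ ω, Z ω ^ 2 ∂P) := by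
  have hXY : Integrable (fun ω => X ω ^ 2 + Y ω ^ 2) P := hX.integrable_sq.add hY.integrable_sq
  rw [← integral_add hX.integrable_sq hY.integrable_sq, ← integral_add hXY hZ.integrable_sq,
    ← integral_const_mul]
  refine integral_mono ((hX.add hY).add hZ).integrable_sq
    ((hXY.add hZ.integrable_sq).const_mul 3) fun ω => ?_
  simp only
  nlinarith [sq_nonneg (X ω - Y ω), sq_nonneg (X ω - Z ω), sq_nonneg (Y ω - Z ω)]

namespace WeakError

variable [Fintype m] [IsProbabilityMeasure P] {S : Finset β} {e : m → β → Ω → ℝ} {B C₁ C₂ V C₃ : ℝ}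
  {χ : m → β → ℝ}

theorem memLp_two (h : WeakError P S e B C₁ C₂ V) (i : m) {s : β} (hs : s ∈ S) :
    MemLp (e i s) 2 P :=
  (h.memLp i s hs).mono_exponent (by norm_num)

theorem l2_opNorm_meanErrorGram_le [DecidableEq m] (h : WeakError P S e B C₁ C₂ V)
    (hC₂ : 0 ≤ C₂) :
    ‖meanErrorGram P S e‖ ≤ C₂ + Fintype.card m * B ^ 2 := by
  have row (i : m) : ∑ j, |∫ ω, sampleInner S (e i · ω) (e j · ω) ∂P| ≤
      C₂ + Fintype.card m * B ^ 2 := by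
    have moment {s : β} (hs : s ∈ S) (j : m) :
        |∫ ω, e i s ω * e j s ω ∂P| ≤ |cov[e i s, e j s; P]| + B ^ 2 := by
      have hcov := covariance_eq_sub (h.memLp_two i hs) (h.memLp_two j hs)
      simp only [Pi.mul_apply] at hcov
      have hbias : |(∫ ω, e i s ω ∂P) * ∫ ω, e j s ω ∂P| ≤ B ^ 2 := by
        rw [abs_mul, sq]
        exact mul_le_mul (h.bias i s hs) (h.bias j s hs) (abs_nonneg _)
          ((abs_nonneg _).trans (h.bias i s hs))
      rw [← sub_add_cancel (∫ ω, e i s ω * e j s ω ∂P), ← hcov]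
      exact (abs_add_le _ _).trans (add_le_add_right hbias _)
    calc ∑ j, |∫ ω, sampleInner S (e i · ω) (e j · ω) ∂P|
        ≤ ∑ j, (S.card : ℝ)⁻¹ * ∑ s ∈ S, |∫ ω, e i s ω * e j s ω ∂P| := by
          refine Finset.sum_le_sum fun j _ => ?_
          simp only [sampleInner]
          rw [integral_const_mul, integral_finsetSum S fun s hs =>
            (memLp_two_mul (h.memLp i s hs) (h.memLp j s hs)).integrable one_le_two, abs_mul,
            abs_of_nonneg (by positivity : (0 : ℝ) ≤ (S.card : ℝ)⁻¹)]
          gcongr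
          exact Finset.abs_sum_le_sum_abs _ _
      _ = (S.card : ℝ)⁻¹ * ∑ s ∈ S, ∑ j, |∫ ω, e i s ω * e j s ω ∂P| := by
          rw [← Finset.mul_sum, Finset.sum_comm]
      _ ≤ C₂ + Fintype.card m * B ^ 2 := by
          refine (le_abs_self _).trans (abs_sampleMean_le (by positivity) fun s hs => ?_)
          rw [abs_of_nonneg (Finset.sum_nonneg fun j _ => abs_nonneg _)]
          refine (Finset.sum_le_sum fun j _ => moment hs j).trans ?_
          rw [Finset.sum_add_distrib, Finset.sum_const, nsmul_eq_mul, Finset.card_univ]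
          exact add_le_add_left (h.cov_coord i s hs) _
  refine l2_opNorm_le_of_row_col_sums (by positivity) row fun j => ?_
  simpa only [meanErrorGram, Matrix.of_apply, sampleInner_comm S] using row j

theorem memLp_centredPerturbation (h : WeakError P S e B C₁ C₂ V) (i j : m) :
    MemLp (fun ω => centredPerturbation P S χ e ω i j) 2 P := by
  simp only [centredPerturbation_apply]
  exact ((memLp_two_sampleInner_const (fun s hs => h.memLp_two i hs) _).add
    (memLp_two_sampleInner_const (fun s hs => h.memLp_two j hs) _)).add
    ((memLp_two_sampleInner (h.memLp i) (h.memLp j)).sub (memLp_const _))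

theorem integral_sq_centredPerturbation_le (h : WeakError P S e B C₁ C₂ V) (hC₁ : 0 ≤ C₁)
    (hχ : ∀ i, sampleInner S (χ i) (χ i) ≤ C₃) (i j : m) :
    ∫ ω, centredPerturbation P S χ e ω i j ^ 2 ∂P ≤
      3 * (2 * ((C₁ / S.card + B ^ 2) * C₃) +
        Var[fun ω => sampleInner S (e i · ω) (e j · ω); P]) := by
  have hY := memLp_two_sampleInner (h.memLp i) (h.memLp j)
  have hcross (i j : m) :
      ∫ ω, sampleInner S (e i · ω) (χ j) ^ 2 ∂P ≤ (C₁ / S.card + B ^ 2) * C₃ :=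
    (integral_sq_sampleInner_const_le (fun s hs => h.memLp_two i hs) (h.cov_sample i)
      (h.bias i) _).trans (mul_le_mul_of_nonneg_left (hχ j) (by positivity))
  simp only [centredPerturbation_apply]
  refine (integral_sq_add_add_le
    (memLp_two_sampleInner_const (fun s hs => h.memLp_two i hs) (χ j))
    (memLp_two_sampleInner_const (fun s hs => h.memLp_two j hs) (χ i))
    (hY.sub (memLp_const _))).trans ?_
  rw [variance_eq_integral hY.aemeasurable]
  simp only [Pi.sub_apply]
  linarith [hcross i j, hcross j i]

theorem measure_lt_l2_opNorm_sampleGram_sub_le [DecidableEq m] (h : WeakError P S e B C₁ C₂ V)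
    (hC₁ : 0 ≤ C₁) (hC₂ : 0 ≤ C₂) (hχ : ∀ i, sampleInner S (χ i) (χ i) ≤ C₃) {T : ℝ}
    (hT : 0 < T) :
    P {ω | T + (C₂ + Fintype.card m * B ^ 2) <
        ‖sampleGram S (fun i s => χ i s + e i s ω) - sampleGram S χ‖} ≤
      ENNReal.ofReal
        (3 * (2 * Fintype.card m ^ 2 * ((C₁ / S.card + B ^ 2) * C₃) + V) / T ^ 2) := by
  have hsum : ∑ i, ∑ j, ∫ ω, centredPerturbation P S χ e ω i j ^ 2 ∂P ≤
      3 * (2 * Fintype.card m ^ 2 * ((C₁ / S.card + B ^ 2) * C₃) + V) := by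
    refine (Finset.sum_le_sum fun i _ => Finset.sum_le_sum fun j _ =>
      h.integral_sq_centredPerturbation_le hC₁ hχ i j).trans ?_
    simp only [← Finset.mul_sum, Finset.sum_add_distrib, Finset.sum_const, Finset.card_univ,
      nsmul_eq_mul]
    linarith [h.variance]
  refine le_trans (measure_mono fun ω hω => ?_) ((measure_lt_l2_opNorm_le
    (fun i j => (h.memLp_centredPerturbation (χ := χ) i j).integrable_sq) hT).trans
    (ENNReal.ofReal_le_ofReal (div_le_div_of_nonneg_right hsum (sq_nonneg T))))
  have htri := norm_le_norm_sub_add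
    (sampleGram S (fun i s => χ i s + e i s ω) - sampleGram S χ) (meanErrorGram P S e)
  simp only [Set.mem_ofPred_eq, centredPerturbation] at hω ⊢
  linarith [h.l2_opNorm_meanErrorGram_le hC₂]

end WeakError

end SampleGram

section Unfolding

open Matrix

variable {K : ℕ} {r p : Fin K → ℕ}

/-- The index of the tensor entry in row `i` and column `c` of the mode-`k` unfolding. -/
def fullIdx (k : Fin K) (i : Fin (p k)) (c : ∀ j : {j : Fin K // j ≠ k}, Fin (p j)) :
    ∀ j, Fin (p j) :=
  (Equiv.piSplitAt k fun j => Fin (p j)).symm (i, c)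

theorem fullIdx_self (k : Fin K) (i : Fin (p k)) (c : ∀ j : {j : Fin K // j ≠ k}, Fin (p j)) :
    fullIdx k i c k = i := by
  simp [fullIdx, Equiv.piSplitAt]

theorem fullIdx_of_ne (k : Fin K) (i : Fin (p k)) (c : ∀ j : {j : Fin K // j ≠ k}, Fin (p j))
    (j : {j : Fin K // j ≠ k}) : fullIdx k i c j = c j := by
  simp [fullIdx, Equiv.piSplitAt, j.2]

theorem fullIdx_inj (k : Fin K) {i i' : Fin (p k)}
    {c c' : ∀ j : {j : Fin K // j ≠ k}, Fin (p j)} :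
    fullIdx k i c = fullIdx k i' c' ↔ i = i' ∧ c = c' := by
  rw [fullIdx, fullIdx, Equiv.apply_eq_iff_eq, Prod.mk.injEq]

theorem mat_apply (k : Fin K) (X : Tensor p) (i : Fin (p k))
    (c : ∀ j : {j : Fin K // j ≠ k}, Fin (p j)) : mat k X i c = X (fullIdx k i c) := rfl

/-- The Kronecker product of the loading matrices of all modes but the `k`-th. -/
def loadingProd (Λ : ∀ k, Matrix (Fin (p k)) (Fin (r k)) ℝ) (k : Fin K) :
    Matrix (∀ j : {j : Fin K // j ≠ k}, Fin (p j)) (∀ j : {j : Fin K // j ≠ k}, Fin (r j)) ℝ :=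
  of fun c d => ∏ j : {j : Fin K // j ≠ k}, Λ j (c j) (d j)

theorem mat_tucker (F : Tensor r) (Λ : ∀ k, Matrix (Fin (p k)) (Fin (r k)) ℝ) (k : Fin K) :
    mat k (tucker F Λ) = Λ k * mat k F * (loadingProd Λ k)ᵀ := by
  ext i c
  have term (a : Fin (r k)) (d : ∀ j : {j : Fin K // j ≠ k}, Fin (r j)) :
      F (fullIdx k a d) * ∏ j, Λ j (fullIdx k i c j) (fullIdx k a d j) =
        Λ k i a * mat k F a d * loadingProd Λ k c d := by
    rw [Fintype.prod_eq_mul_prod_subtype_ne _ k, mat_apply, loadingProd, of_apply]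
    simp only [fullIdx_self, fullIdx_of_ne]
    ring
  rw [mat_apply, tucker, ← (Equiv.piSplitAt k fun j => Fin (r j)).symm.sum_comp,
    Fintype.sum_prod_type_right]
  simp only [mul_apply, Finset.sum_mul, transpose_apply]
  exact Finset.sum_congr rfl fun d _ => Finset.sum_congr rfl fun a _ => term a d

theorem dimExcept_eq_prod_subtype (p : Fin K → ℕ) (k : Fin K) :
    dimExcept p k = ∏ j : {j : Fin K // j ≠ k}, p j :=
  Finset.prod_subtype _ (by simp) _

theorem card_columns (p : Fin K → ℕ) (k : Fin K) :
    Fintype.card (∀ j : {j : Fin K // j ≠ k}, Fin (p j)) = dimExcept p k := by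
  simp only [Fintype.card_pi, Fintype.card_fin, dimExcept_eq_prod_subtype]

theorem loadingProd_transpose_mul_self {Λ : ∀ k, Matrix (Fin (p k)) (Fin (r k)) ℝ}
    (hΛ : ∀ k, (Λ k)ᵀ * Λ k = (p k : ℝ) • 1) (k : Fin K) :
    (loadingProd Λ k)ᵀ * loadingProd Λ k = (dimExcept p k : ℝ) • 1 := by
  have mode (j : Fin K) (a b : Fin (r j)) :
      ∑ x, Λ j x a * Λ j x b = (p j : ℝ) * if a = b then 1 else 0 := by
    simpa only [mul_apply, transpose_apply, Matrix.smul_apply, one_apply,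
      smul_eq_mul] using
      congrFun (congrFun (hΛ j) a) b
  ext d d'
  have swap := Finset.prod_univ_sum (fun _ : {j : Fin K // j ≠ k} => Finset.univ)
    (fun (j : {j : Fin K // j ≠ k}) (x : Fin (p j)) => Λ j x (d j) * Λ j x (d' j))
  rw [Fintype.piFinset_univ] at swap
  simp only [mul_apply, transpose_apply, loadingProd, of_apply, ← Finset.prod_mul_distrib,
    Matrix.smul_apply, one_apply, smul_eq_mul]
  rw [← swap]
  simp only [mode, Finset.prod_mul_distrib, dimExcept_eq_prod_subtype, Nat.cast_prod]
  congr 1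
  rw [Finset.prod_ite_zero]
  simp [funext_iff]

/-- The columns of the mode-`k` unfoldings of the observations at times `1, …, n`. -/
def columnSites (n : ℕ) (p : Fin K → ℕ) (k : Fin K) :
    Finset (ℕ × (∀ j : {j : Fin K // j ≠ k}, Fin (p j))) :=
  Finset.Icc 1 n ×ˢ Finset.univ

theorem card_columnSites (n : ℕ) (p : Fin K → ℕ) (k : Fin K) :
    ((columnSites n p k).card : ℝ) = n * dimExcept p k := by
  simp only [columnSites, Finset.card_product, Nat.card_Icc, Finset.card_univ, card_columns,
    add_tsub_cancel_right, Nat.cast_mul]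

/-- The mode-`k` unfoldings of a sequence of tensors, put side by side: the columns of the resulting
matrix are indexed by a time and a column of the unfolding. -/
def unfoldSample (X : ℕ → Tensor p) (k : Fin K) (i : Fin (p k))
    (s : ℕ × (∀ j : {j : Fin K // j ≠ k}, Fin (p j))) : ℝ :=
  X s.1 (fullIdx k i s.2)

theorem sampleGram_unfoldSample (n : ℕ) (X : ℕ → Tensor p) (k : Fin K) :
    sampleGram (columnSites n p k) (unfoldSample X k) =
      ((n : ℝ) * dimExcept p k)⁻¹ • ∑ t ∈ Finset.Icc 1 n, mat k (X t) * (mat k (X t))ᵀ := by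
  ext i j
  rw [sampleGram, of_apply, sampleInner, card_columnSites, columnSites, Finset.sum_product]
  simp only [unfoldSample, Matrix.smul_apply, Matrix.sum_apply, mul_apply, transpose_apply,
    mat_apply, smul_eq_mul]

theorem sampleGram_unfoldSample_tucker (n : ℕ) (F : ℕ → Tensor r)
    {Λ : ∀ k, Matrix (Fin (p k)) (Fin (r k)) ℝ}
    (hΛ : ∀ k, (Λ k)ᵀ * Λ k = (p k : ℝ) • 1) {k : Fin K} (hd : dimExcept p k ≠ 0) :
    sampleGram (columnSites n p k) (unfoldSample (fun t => tucker (F t) Λ) k) =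
      Λ k * factorGram n F k * (Λ k)ᵀ := by
  have hgram (t : ℕ) : mat k (tucker (F t) Λ) * (mat k (tucker (F t) Λ))ᵀ =
      (dimExcept p k : ℝ) • (Λ k * (mat k (F t) * (mat k (F t))ᵀ) * (Λ k)ᵀ) := by
    calc mat k (tucker (F t) Λ) * (mat k (tucker (F t) Λ))ᵀ
        = Λ k * (mat k (F t) * ((loadingProd Λ k)ᵀ * loadingProd Λ k) * (mat k (F t))ᵀ) *
            (Λ k)ᵀ := by
          simp only [mat_tucker, transpose_mul, transpose_transpose, Matrix.mul_assoc]
      _ = _ := by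
          rw [loadingProd_transpose_mul_self hΛ]
          simp only [Matrix.mul_smul, Matrix.smul_mul, Matrix.mul_one]
  rw [sampleGram_unfoldSample]
  simp only [hgram]
  rw [← Finset.smul_sum, smul_smul, factorGram, Matrix.mul_smul, Matrix.smul_mul,
    Matrix.mul_sum, Matrix.sum_mul, mul_inv, mul_assoc,
    inv_mul_cancel₀ (Nat.cast_ne_zero.mpr hd), mul_one]

theorem abs_tucker_le (F : Tensor r) {Λ : ∀ k, Matrix (Fin (p k)) (Fin (r k)) ℝ} {L : ℝ}
    (hL : ∀ k i j, |Λ k i j| ≤ L) (i : ∀ k, Fin (p k)) :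
    |tucker F Λ i| ≤ |L| ^ K * √(Fintype.card (∀ k, Fin (r k))) * tnorm F := by
  have hprod (j : ∀ k, Fin (r k)) : |∏ k, Λ k (i k) (j k)| ≤ |L| ^ K := by
    rw [Finset.abs_prod]
    exact (Finset.prod_le_prod (fun _ _ => abs_nonneg _) fun k _ =>
      (hL k _ _).trans (le_abs_self L)).trans_eq (by simp)
  calc |tucker F Λ i| ≤ ∑ j : (∀ k, Fin (r k)), |F j| * |L| ^ K := by
        refine (Finset.abs_sum_le_sum_abs _ _).trans (Finset.sum_le_sum fun j _ => ?_)
        rw [abs_mul]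
        exact mul_le_mul_of_nonneg_left (hprod j) (abs_nonneg _)
    _ = |L| ^ K * ∑ j, 1 * |F j| := by simp only [one_mul, ← Finset.sum_mul, mul_comm]
    _ ≤ |L| ^ K * (√(Fintype.card (∀ k, Fin (r k))) * tnorm F) := by
        refine mul_le_mul_of_nonneg_left ?_ (by positivity)
        simpa [tnorm] using
          Real.sum_mul_le_sqrt_mul_sqrt Finset.univ (fun _ => (1 : ℝ)) (fun j => |F j|)
    _ = _ := (mul_assoc _ _ _).symm

theorem sampleInner_unfoldSample_le {n : ℕ} {X : ℕ → Tensor p} {g : ℕ → ℝ} {k : Fin K}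
    (hd : dimExcept p k ≠ 0) (hX : ∀ t i, X t i ^ 2 ≤ g t) (i : Fin (p k)) :
    sampleInner (columnSites n p k) (unfoldSample X k i) (unfoldSample X k i) ≤
      (n : ℝ)⁻¹ * ∑ t ∈ Finset.Icc 1 n, g t := by
  have hd' : (dimExcept p k : ℝ) ≠ 0 := Nat.cast_ne_zero.mpr hd
  calc sampleInner (columnSites n p k) (unfoldSample X k i) (unfoldSample X k i)
      = ((n : ℝ) * dimExcept p k)⁻¹ *
          ∑ t ∈ Finset.Icc 1 n, ∑ c, X t (fullIdx k i c) ^ 2 := by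
        rw [sampleInner, card_columnSites, columnSites, Finset.sum_product]
        simp only [unfoldSample, sq]
    _ ≤ ((n : ℝ) * dimExcept p k)⁻¹ * ∑ t ∈ Finset.Icc 1 n, dimExcept p k * g t := by
        gcongr with t
        refine (Finset.sum_le_card_nsmul _ _ (g t) fun c _ => hX t _).trans_eq ?_
        rw [Finset.card_univ, card_columns, nsmul_eq_mul]
    _ = (n : ℝ)⁻¹ * ∑ t ∈ Finset.Icc 1 n, g t := by
        rw [← Finset.mul_sum, mul_inv, mul_assoc, inv_mul_cancel_left₀ hd']

end Unfolding

section ErrorMoments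

variable {Ω : Type*} {𝒜 ℬ : MeasurableSpace Ω} [m0 : MeasurableSpace Ω] {P : Measure Ω}

/-- Bounds on an error variable that has been truncated: the uniform bound `T`, the bounds `w` and
`U` on the moments of order `2 + 2ε` and `4`, and the bound `B` on the bias. -/
structure TruncatedMoments (P : Measure Ω) (ε w T U B : ℝ) (e : Ω → ℝ) : Prop where
  measurable : Measurable e
  abs_le : ∀ ω, |e ω| ≤ T
  eLpNorm_le : eLpNorm e (ENNReal.ofReal (2 + 2 * ε)) P ≤ ENNReal.ofReal w
  fourth_moment : ∫ ω, e ω ^ 4 ∂P ≤ U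
  bias : |∫ ω, e ω ∂P| ≤ B

variable {ε w T U B c m : ℝ} {e e' e₁ e₂ e₁' e₂' : Ω → ℝ}

theorem TruncatedMoments.abs_mul_le (h : TruncatedMoments P ε w T U B e)
    (h' : TruncatedMoments P ε w T U B e') (ω : Ω) : |e ω * e' ω| ≤ T ^ 2 := by
  rw [abs_mul, sq]
  exact mul_le_mul (h.abs_le ω) (h'.abs_le ω) (abs_nonneg _) ((abs_nonneg _).trans (h.abs_le ω))

variable [IsProbabilityMeasure P]

theorem TruncatedMoments.memLp (h : TruncatedMoments P ε w T U B e) (q : ENNReal) :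
    MemLp e q P :=
  MemLp.of_bound h.measurable.aestronglyMeasurable T (ae_of_all _ h.abs_le)

theorem TruncatedMoments.integral_sq_le (h : TruncatedMoments P ε w T U B e) (hε : 0 ≤ ε)
    (hw : 0 ≤ w) : ∫ ω, e ω ^ 2 ∂P ≤ w ^ 2 :=
  integral_sq_le_of_eLpNorm_le h.measurable (by linarith) hw h.eLpNorm_le

theorem TruncatedMoments.integral_sq_mul_le (h : TruncatedMoments P ε w T U B e)
    (h' : TruncatedMoments P ε w T U B e') : ∫ ω, (e ω * e' ω) ^ 2 ∂P ≤ U :=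
  TensorFactor.integral_sq_mul_le h.measurable h'.measurable h.abs_le h'.abs_le h.fourth_moment
    h'.fourth_moment

theorem TruncatedMoments.abs_integral_mul_le (h : TruncatedMoments P ε w T U B e)
    (h' : TruncatedMoments P ε w T U B e') (hε : 0 ≤ ε) (hw : 0 ≤ w) :
    |∫ ω, e ω * e' ω ∂P| ≤ w ^ 2 := by
  have hsq {f : Ω → ℝ} (hf : TruncatedMoments P ε w T U B f) :
      Integrable (fun ω => f ω ^ 2) P := (hf.memLp 2).integrable_sq
  calc |∫ ω, e ω * e' ω ∂P| ≤ ∫ ω, |e ω * e' ω| ∂P := abs_integral_le_integral_abs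
    _ ≤ ∫ ω, (e ω ^ 2 + e' ω ^ 2) / 2 ∂P := by
        refine integral_mono_of_nonneg (ae_of_all _ fun ω => abs_nonneg _)
          (((hsq h).add (hsq h')).div_const 2) (ae_of_all _ fun ω => ?_)
        dsimp only
        rw [abs_mul, ← sq_abs (e ω), ← sq_abs (e' ω)]
        linarith [two_mul_le_add_sq |e ω| |e' ω|]
    _ = (∫ ω, e ω ^ 2 ∂P + ∫ ω, e' ω ^ 2 ∂P) / 2 := by
        rw [integral_div, integral_add (hsq h) (hsq h')]
    _ ≤ w ^ 2 := by linarith [h.integral_sq_le hε hw, h'.integral_sq_le hε hw]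

theorem TruncatedMoments.abs_integral_mul_integral_le (h : TruncatedMoments P ε w T U B e)
    (h' : TruncatedMoments P ε w T U B e') (hε : 0 ≤ ε) (hw : 0 ≤ w) :
    |(∫ ω, e ω ∂P) * ∫ ω, e' ω ∂P| ≤ w ^ 2 := by
  have sq_integral_le {f : Ω → ℝ} (hf : TruncatedMoments P ε w T U B f) :
      (∫ ω, f ω ∂P) ^ 2 ≤ w ^ 2 := by
    have hvar := variance_eq_sub (hf.memLp 2)
    simp only [Pi.pow_apply] at hvar
    linarith [variance_nonneg f P, hf.integral_sq_le hε hw]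
  rw [abs_mul, sq]
  exact mul_le_mul (abs_le_of_sq_le_sq (sq_integral_le h) hw)
    (abs_le_of_sq_le_sq (sq_integral_le h') hw) (abs_nonneg _) hw

theorem TruncatedMoments.abs_covariance_le (h : TruncatedMoments P ε w T U B e)
    (h' : TruncatedMoments P ε w T U B e') (hε : 0 ≤ ε) (hw : 0 < w) (h𝒜 : 𝒜 ≤ m0) (hℬ : ℬ ≤ m0)
    (he : Measurable[𝒜] e) (he' : Measurable[ℬ] e') (hmix : alphaMix P 𝒜 ℬ ≤ Real.exp (-(c * m)))
    (hm : 0 ≤ m) :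
    |cov[e, e'; P]| ≤ 9 * w ^ 2 * delayedExp (c * ε / (1 + ε)) 0 m := by
  rw [delayedExp_zero_lag _ hm]
  exact abs_covariance_le_exp_of_eLpNorm_le h𝒜 hℬ he he' hε hw h.eLpNorm_le h'.eLpNorm_le hmix

theorem TruncatedMoments.abs_covariance_mul_le (h₁ : TruncatedMoments P ε w T U B e₁)
    (h₂ : TruncatedMoments P ε w T U B e₂) (h₁' : TruncatedMoments P ε w T U B e₁')
    (h₂' : TruncatedMoments P ε w T U B e₂') (h𝒜 : 𝒜 ≤ m0) (hℬ : ℬ ≤ m0)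
    (he₁ : Measurable[𝒜] e₁) (he₂ : Measurable[𝒜] e₂) (he₁' : Measurable[ℬ] e₁')
    (he₂' : Measurable[ℬ] e₂') (hmix : alphaMix P 𝒜 ℬ ≤ Real.exp (-(c * m))) {ρ : ℝ}
    (hρ : 4 * T ^ 4 ≤ U * Real.exp (c * ρ)) :
    |cov[fun ω => e₁ ω * e₂ ω, fun ω => e₁' ω * e₂' ω; P]| ≤ U * delayedExp c ρ m :=
  abs_covariance_le_delayedExp h𝒜 hℬ (he₁.mul he₂) (he₁'.mul he₂') (h₁.abs_mul_le h₂)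
    (h₁'.abs_mul_le h₂') (h₁.integral_sq_mul_le h₂) (h₁'.integral_sq_mul_le h₂') hmix
    (by rwa [← pow_mul])

-- With `X = (X₁, X₂)` independent of `Y = (Y₁, Y₂)`, both `E[X₁Y₁X₂Y₂]` and `E[X₁Y₁] E[X₂Y₂]`
-- factor, and the difference of the two products telescopes.
theorem covariance_mul_mul_of_indepFun {X₁ X₂ Y₁ Y₂ : Ω → ℝ} (hX₁ : MemLp X₁ 4 P)
    (hX₂ : MemLp X₂ 4 P) (hY₁ : MemLp Y₁ 4 P) (hY₂ : MemLp Y₂ 4 P)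
    (hind : IndepFun (fun ω => (X₁ ω, X₂ ω)) (fun ω => (Y₁ ω, Y₂ ω)) P) :
    cov[fun ω => X₁ ω * Y₁ ω, fun ω => X₂ ω * Y₂ ω; P] =
      cov[X₁, X₂; P] * ∫ ω, Y₁ ω * Y₂ ω ∂P +
        (∫ ω, X₁ ω ∂P) * (∫ ω, X₂ ω ∂P) * cov[Y₁, Y₂; P] := by
  have two_le_four : (2 : ENNReal) ≤ 4 := by norm_num
  have product_mean {φ ψ : ℝ × ℝ → ℝ} (hφ : Measurable φ) (hψ : Measurable ψ) :
      ∫ ω, φ (X₁ ω, X₂ ω) * ψ (Y₁ ω, Y₂ ω) ∂P =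
        (∫ ω, φ (X₁ ω, X₂ ω) ∂P) * ∫ ω, ψ (Y₁ ω, Y₂ ω) ∂P :=
    (hind.comp hφ hψ).integral_fun_mul_eq_mul_integral
      (hφ.comp_aemeasurable (hX₁.aemeasurable.prodMk hX₂.aemeasurable)).aestronglyMeasurable
      (hψ.comp_aemeasurable (hY₁.aemeasurable.prodMk hY₂.aemeasurable)).aestronglyMeasurable
  have mean₁ := product_mean measurable_fst measurable_fst
  have mean₂ := product_mean measurable_snd measurable_snd
  have mean₁₂ := product_mean (φ := fun x => x.1 * x.2) (ψ := fun x => x.1 * x.2)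
    (by fun_prop) (by fun_prop)
  rw [covariance_eq_sub (memLp_two_mul hX₁ hY₁) (memLp_two_mul hX₂ hY₂),
    covariance_eq_sub (hX₁.mono_exponent two_le_four) (hX₂.mono_exponent two_le_four),
    covariance_eq_sub (hY₁.mono_exponent two_le_four) (hY₂.mono_exponent two_le_four)]
  simp only [Pi.mul_apply, mul_mul_mul_comm (X₁ _) (Y₁ _)] at mean₁₂ ⊢
  rw [mean₁, mean₂, mean₁₂]
  ring

theorem TruncatedMoments.abs_covariance_mul_le_of_indepFun (h₁ : TruncatedMoments P ε w T U B e₁)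
    (h₂ : TruncatedMoments P ε w T U B e₂) (h₁' : TruncatedMoments P ε w T U B e₁')
    (h₂' : TruncatedMoments P ε w T U B e₂') (hε : 0 ≤ ε) (hw : 0 ≤ w) {A : ℝ}
    (hind : IndepFun (fun ω => (e₁ ω, e₁' ω)) (fun ω => (e₂ ω, e₂' ω)) P)
    (hcov₁ : |cov[e₁, e₁'; P]| ≤ A) (hcov₂ : |cov[e₂, e₂'; P]| ≤ A) :
    |cov[fun ω => e₁ ω * e₂ ω, fun ω => e₁' ω * e₂' ω; P]| ≤ 2 * w ^ 2 * A := by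
  rw [covariance_mul_mul_of_indepFun (h₁.memLp 4) (h₁'.memLp 4) (h₂.memLp 4) (h₂'.memLp 4) hind]
  refine (abs_add_le _ _).trans ?_
  rw [abs_mul, abs_mul (_ * _)]
  have hA : 0 ≤ A := (abs_nonneg _).trans hcov₁
  linarith [mul_le_mul hcov₁ (h₂.abs_integral_mul_le h₂' hε hw) (abs_nonneg _) hA,
    mul_le_mul (h₁.abs_integral_mul_integral_le h₁' hε hw) hcov₂ (abs_nonneg _) (sq_nonneg w)]

end ErrorMoments

section NoiseError

variable {Ω : Type*} {K : ℕ} {p : Fin K → ℕ}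

/-- The idiosyncratic part of the mode-`k` unfoldings of the data `χ_{i,t} + ξ_{i,t}`, with common
component `χ`, after truncation at level `τ`. -/
noncomputable def noiseErr (τ : ℝ) (χ : ℕ → Tensor p) (ξ : (Fin K → ℕ) → ℤ → Ω → ℝ) (k : Fin K)
    (i : Fin (p k)) (s : ℕ × (∀ j : {j : Fin K // j ≠ k}, Fin (p j))) (ω : Ω) : ℝ :=
  truncErr τ (unfoldSample χ k i s) (ξ (pos (fullIdx k i s.2)) s.1 ω)

theorem unfoldSample_add_noiseErr (τ : ℝ) (χ : ℕ → Tensor p) (ξ : (Fin K → ℕ) → ℤ → Ω → ℝ)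
    (k : Fin K) (ω : Ω) :
    (fun i s => unfoldSample χ k i s + noiseErr τ χ ξ k i s ω) =
      unfoldSample (fun t i => trunc τ (χ t i + ξ (pos i) t ω)) k := by
  ext i s
  rw [noiseErr, truncErr, add_sub_cancel, unfoldSample, unfoldSample]

variable {τ : ℝ} {χ : ℕ → Tensor p} {ξ : (Fin K → ℕ) → ℤ → Ω → ℝ} {k : Fin K}

theorem measurable_comap_noiseErr (hτ : 0 ≤ τ) (i : Fin (p k))
    (s : ℕ × (∀ j : {j : Fin K // j ≠ k}, Fin (p j))) :
    Measurable[MeasurableSpace.comap (ξ (pos (fullIdx k i s.2)) s.1) inferInstance]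
      (noiseErr τ χ ξ k i s) :=
  (measurable_truncErr hτ _).comp (comap_measurable _)

theorem truncatedMoments_noiseErr [MeasurableSpace Ω] {P : Measure Ω} [IsFiniteMeasure P]
    {ε w : ℝ} (hε : 0 ≤ ε) (hε1 : ε ≤ 1) (hw : 0 ≤ w) (hτ : 0 < τ) (hξ : ∀ i t, Measurable (ξ i t))
    (hξ0 : ∀ (i : ∀ k, Fin (p k)) t, ∫ ω, ξ (pos i) t ω ∂P = 0)
    (hξw : ∀ (i : ∀ k, Fin (p k)) t,
      eLpNorm (ξ (pos i) t) (ENNReal.ofReal (2 + 2 * ε)) P ≤ ENNReal.ofReal w)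
    {i : Fin (p k)} {s : ℕ × (∀ j : {j : Fin K // j ≠ k}, Fin (p j))}
    (hχ : |unfoldSample χ k i s| ≤ τ / 2) :
    TruncatedMoments P ε w (2 * τ) ((2 * τ) ^ (4 - (2 + 2 * ε)) * w ^ (2 + 2 * ε))
      ((τ / 2) ^ (1 - (2 + 2 * ε)) * w ^ (2 + 2 * ε)) (noiseErr τ χ ξ k i s) := by
  have hχτ := hχ.trans (half_le_self hτ.le)
  have hmeas : Measurable (noiseErr τ χ ξ k i s) := (measurable_truncErr hτ.le _).comp (hξ _ _)
  have hLp := eLpNorm_truncErr_le hχτ (hξw (fullIdx k i s.2) s.1)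
  exact
    { measurable := hmeas
      abs_le := fun ω => abs_truncErr_le hχτ _
      eLpNorm_le := hLp
      fourth_moment := integral_pow_four_le_of_abs_le hmeas (by positivity)
        (fun ω => abs_truncErr_le hχτ _) (by positivity) (by linarith) hw hLp
      bias := abs_integral_truncErr_le (hξ _ _) (hξ0 _ _) hτ hχ (by linarith) hw (hξw _ _) }

end NoiseError

section MixingField

variable {K : ℕ} {p : Fin K → ℕ}

/-- The site in `ℕ^K × ℤ` of the noise variable in row `i` and column `s` of the unfolding. -/
def unfoldSite (k : Fin K) (i : Fin (p k)) (s : ℕ × (∀ j : {j : Fin K // j ≠ k}, Fin (p j))) :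
    (Fin K → ℕ) × ℤ :=
  (pos (fullIdx k i s.2), s.1)

/-- The position of a column in `ℤ^K`: time takes the place of the coordinate `k`, which is constant
along a column. -/
def columnPos (k : Fin K) (s : ℕ × (∀ j : {j : Fin K // j ≠ k}, Fin (p j))) (j : Fin K) : ℤ :=
  if h : j = k then s.1 else (s.2 ⟨j, h⟩ : ℕ)

/-- The maximum distance of two columns. -/
def columnDist (k : Fin K) (s s' : ℕ × (∀ j : {j : Fin K // j ≠ k}, Fin (p j))) : ℕ :=
  Finset.univ.sup fun j => (columnPos k s j - columnPos k s' j).natAbs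

theorem columnPos_injective (k : Fin K) : Function.Injective (columnPos (p := p) k) := by
  intro s s' h
  refine Prod.ext ?_ (funext fun j => Fin.ext ?_)
  · simpa [columnPos] using congrFun h k
  · simpa [columnPos, j.2] using congrFun h j

theorem natAbs_sub_le_siteDist (a b : (Fin K → ℕ) × ℤ) (j : Fin K) :
    ((a.1 j : ℤ) - b.1 j).natAbs ≤ siteDist a b :=
  le_max_of_le_left
    (Finset.le_sup (f := fun j => ((a.1 j : ℤ) - b.1 j).natAbs) (Finset.mem_univ j))

theorem natAbs_sub_row_le_siteDist (k : Fin K) (i i' : Fin (p k))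
    (s s' : ℕ × (∀ j : {j : Fin K // j ≠ k}, Fin (p j))) :
    ((i : ℤ) - (i' : ℤ)).natAbs ≤ siteDist (unfoldSite k i s) (unfoldSite k i' s') := by
  simpa only [unfoldSite, pos, fullIdx_self] using
    natAbs_sub_le_siteDist (unfoldSite k i s) (unfoldSite k i' s') k

theorem columnDist_le_siteDist (k : Fin K) (i i' : Fin (p k))
    (s s' : ℕ × (∀ j : {j : Fin K // j ≠ k}, Fin (p j))) :
    columnDist k s s' ≤ siteDist (unfoldSite k i s) (unfoldSite k i' s') := by
  refine Finset.sup_le fun j _ => ?_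
  rcases eq_or_ne j k with rfl | hj
  · simp only [columnPos, dif_pos]
    exact le_max_right _ _
  · simpa only [columnPos, dif_neg hj, unfoldSite, pos, fullIdx_of_ne k _ _ ⟨j, hj⟩] using
      natAbs_sub_le_siteDist (unfoldSite k i s) (unfoldSite k i' s') j

theorem sum_delayedExp_columnDist_le {γ ρ : ℝ} (hγ : 0 < γ) (hρ : 0 ≤ ρ) (k : Fin K)
    (S : Finset (ℕ × (∀ j : {j : Fin K // j ≠ k}, Fin (p j))))
    (s : ℕ × (∀ j : {j : Fin K // j ≠ k}, Fin (p j))) :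
    ∑ s' ∈ S, delayedExp γ ρ (columnDist k s s') ≤ (2 * (ρ + expSumConst (γ / K))) ^ K := by
  have : Nonempty (Fin K) := ⟨k⟩
  simpa only [Fintype.card_fin] using
    sum_delayedExp_le_of_natAbs_le hγ hρ S (columnPos_injective k).injOn (columnPos k s)
      (m := columnDist k s) fun s' j =>
        Finset.le_sup (f := fun j => (columnPos k s j - columnPos k s' j).natAbs)
          (Finset.mem_univ j)

variable {Ω : Type*} {ξ : (Fin K → ℕ) → ℤ → Ω → ℝ} {τ : ℝ} {χ : ℕ → Tensor p} {k : Fin K}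

theorem measurable_fieldSigma_noiseErr (hτ : 0 ≤ τ) {E : Set ((Fin K → ℕ) × ℤ)} {i : Fin (p k)}
    {s : ℕ × (∀ j : {j : Fin K // j ≠ k}, Fin (p j))} (hE : unfoldSite k i s ∈ E) :
    Measurable[fieldSigma ξ E] (noiseErr τ χ ξ k i s) :=
  (measurable_comap_noiseErr hτ i s).mono
    (le_iSup (fun a : E => MeasurableSpace.comap (ξ a.1.1 a.1.2) inferInstance) ⟨_, hE⟩) le_rfl

variable [m0 : MeasurableSpace Ω]

theorem fieldSigma_le (hξ : ∀ i t, Measurable (ξ i t)) (E : Set ((Fin K → ℕ) × ℤ)) :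
    fieldSigma ξ E ≤ m0 :=
  iSup_le fun _ => (hξ _ _).comap_le

variable {P : Measure Ω} [IsProbabilityMeasure P] {c₀ ε w T U B : ℝ}

theorem abs_covariance_noiseErr_le_of_field (hξ : ∀ i t, Measurable (ξ i t))
    (hα : ∀ m : ℕ, fieldAlpha P ξ m ⊤ ⊤ ≤ Real.exp (-(c₀ * m))) (hε : 0 ≤ ε) (hw : 0 < w)
    (hτ : 0 ≤ τ) {i i' : Fin (p k)} {s s' : ℕ × (∀ j : {j : Fin K // j ≠ k}, Fin (p j))}
    (he : TruncatedMoments P ε w T U B (noiseErr τ χ ξ k i s))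
    (he' : TruncatedMoments P ε w T U B (noiseErr τ χ ξ k i' s')) {m : ℕ}
    (hm : m ≤ siteDist (unfoldSite k i s) (unfoldSite k i' s')) :
    |cov[noiseErr τ χ ξ k i s, noiseErr τ χ ξ k i' s'; P]| ≤
      9 * w ^ 2 * delayedExp (c₀ * ε / (1 + ε)) 0 m := by
  refine he.abs_covariance_le he' hε hw (fieldSigma_le hξ {unfoldSite k i s})
    (fieldSigma_le hξ {unfoldSite k i' s'}) (measurable_fieldSigma_noiseErr hτ rfl)
    (measurable_fieldSigma_noiseErr hτ rfl) (alphaMix_fieldSigma_le (hα m) ?_) m.cast_nonneg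
  rintro _ rfl _ rfl
  exact hm

theorem abs_covariance_noiseErr_mul_le_of_field (hξ : ∀ i t, Measurable (ξ i t))
    (hα : ∀ m : ℕ, fieldAlpha P ξ m ⊤ ⊤ ≤ Real.exp (-(c₀ * m))) (hτ : 0 ≤ τ) {i j : Fin (p k)}
    {s s' : ℕ × (∀ j : {j : Fin K // j ≠ k}, Fin (p j))}
    (he : ∀ i, TruncatedMoments P ε w T U B (noiseErr τ χ ξ k i s))
    (he' : ∀ i, TruncatedMoments P ε w T U B (noiseErr τ χ ξ k i s')) {ρ : ℝ}
    (hρ : 4 * T ^ 4 ≤ U * Real.exp (c₀ * ρ)) :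
    |cov[fun ω => noiseErr τ χ ξ k i s ω * noiseErr τ χ ξ k j s ω,
      fun ω => noiseErr τ χ ξ k i s' ω * noiseErr τ χ ξ k j s' ω; P]| ≤
      U * delayedExp c₀ ρ (columnDist k s s') := by
  refine (he i).abs_covariance_mul_le (he j) (he' i) (he' j)
    (fieldSigma_le hξ {unfoldSite k i s, unfoldSite k j s})
    (fieldSigma_le hξ {unfoldSite k i s', unfoldSite k j s'})
    (measurable_fieldSigma_noiseErr hτ (Or.inl rfl))
    (measurable_fieldSigma_noiseErr hτ (Or.inr rfl))
    (measurable_fieldSigma_noiseErr hτ (Or.inl rfl))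
    (measurable_fieldSigma_noiseErr hτ (Or.inr rfl))
    (alphaMix_fieldSigma_le (hα (columnDist k s s')) ?_) hρ
  rintro _ (rfl | rfl) _ (rfl | rfl) <;> exact columnDist_le_siteDist k _ _ s s'

theorem weakError_noiseErr_of_field (hξ : ∀ i t, Measurable (ξ i t)) (hc₀ : 0 < c₀)
    (hα : ∀ m : ℕ, fieldAlpha P ξ m ⊤ ⊤ ≤ Real.exp (-(c₀ * m))) (hε : 0 < ε) (hw : 0 < w)
    (hτ : 0 ≤ τ) {n : ℕ}
    (he : ∀ i, ∀ s ∈ columnSites n p k, TruncatedMoments P ε w T U B (noiseErr τ χ ξ k i s))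
    (hU : 0 ≤ U) {ρ : ℝ} (hρ0 : 0 ≤ ρ) (hρ : 4 * T ^ 4 ≤ U * Real.exp (c₀ * ρ)) :
    WeakError P (columnSites n p k) (noiseErr τ χ ξ k) B
      (9 * w ^ 2 * (2 * expSumConst (c₀ * ε / (1 + ε) / K)) ^ K)
      (9 * w ^ 2 * (2 * expSumConst (c₀ * ε / (1 + ε))))
      (p k ^ 2 * (U * (2 * (ρ + expSumConst (c₀ / K))) ^ K / (n * dimExcept p k))) where
  memLp i s hs := (he i s hs).memLp 4
  bias i s hs := (he i s hs).bias
  cov_sample i s hs := by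
    have hγ : 0 < c₀ * ε / (1 + ε) := by positivity
    have hsum := sum_delayedExp_columnDist_le hγ le_rfl k (columnSites n p k) s
    rw [zero_add] at hsum
    refine (Finset.sum_le_sum fun s' hs' => abs_covariance_noiseErr_le_of_field hξ hα hε.le hw hτ
      (he i s hs) (he i s' hs') (columnDist_le_siteDist k i i s s')).trans ?_
    rw [← Finset.mul_sum]
    gcongr
  cov_coord i s hs := by
    have hγ : 0 < c₀ * ε / (1 + ε) := by positivity
    have hsum := sum_delayedExp_natAbs_le hγ le_rfl (Finset.univ : Finset (Fin (p k)))
      (φ := fun j => (j : ℤ)) (fun j _ j' _ h => Fin.ext (Int.ofNat.inj h)) (i : ℤ)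
    rw [zero_add] at hsum
    refine (Finset.sum_le_sum fun j _ => abs_covariance_noiseErr_le_of_field hξ hα hε.le hw hτ
      (he i s hs) (he j s hs) (natAbs_sub_row_le_siteDist k i j s s)).trans ?_
    rw [← Finset.mul_sum]
    gcongr
  variance := by
    have hvar (i j : Fin (p k)) := variance_sampleMean_le (S := columnSites n p k)
      (fun s hs => memLp_two_mul ((he i s hs).memLp 4) ((he j s hs).memLp 4)) fun s hs =>
        calc ∑ s' ∈ columnSites n p k,
              |cov[fun ω => noiseErr τ χ ξ k i s ω * noiseErr τ χ ξ k j s ω,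
                fun ω => noiseErr τ χ ξ k i s' ω * noiseErr τ χ ξ k j s' ω; P]|
            ≤ ∑ s' ∈ columnSites n p k, U * delayedExp c₀ ρ (columnDist k s s') :=
              Finset.sum_le_sum fun s' hs' => abs_covariance_noiseErr_mul_le_of_field hξ hα hτ
                (fun i => he i s hs) (fun i => he i s' hs') hρ
          _ ≤ U * (2 * (ρ + expSumConst (c₀ / K))) ^ K := by
              rw [← Finset.mul_sum]
              exact mul_le_mul_of_nonneg_left (sum_delayedExp_columnDist_le hc₀ hρ0 k _ s) hU
    refine (Finset.sum_le_sum fun i _ => Finset.sum_le_sum fun j _ => hvar i j).trans_eq ?_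
    simp only [card_columnSites, Finset.sum_const, Finset.card_univ, Fintype.card_fin, nsmul_eq_mul]
    ring

end MixingField

section IndependentSeries

variable {K : ℕ} {p : Fin K → ℕ} {Ω : Type*} [MeasurableSpace Ω] {P : Measure Ω}
  {ξ : (Fin K → ℕ) → ℤ → Ω → ℝ} {τ : ℝ} {χ : ℕ → Tensor p} {k : Fin K}

theorem sum_le_of_same_column {γ ρ A : ℝ} (hγ : 0 < γ) (hρ : 0 ≤ ρ) (hA : 0 ≤ A)
    {S : Finset (ℕ × (∀ j : {j : Fin K // j ≠ k}, Fin (p j)))}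
    (s : ℕ × (∀ j : {j : Fin K // j ≠ k}, Fin (p j)))
    {f : ℕ × (∀ j : {j : Fin K // j ≠ k}, Fin (p j)) → ℝ}
    (hsame : ∀ s' ∈ S, s'.2 = s.2 → f s' ≤ A * delayedExp γ ρ ((s.1 : ℤ) - s'.1).natAbs)
    (hdiff : ∀ s' ∈ S, s'.2 ≠ s.2 → f s' = 0) :
    ∑ s' ∈ S, f s' ≤ A * (2 * (ρ + expSumConst γ)) := by
  have time_injOn : Set.InjOn (fun s' : ℕ × (∀ j : {j : Fin K // j ≠ k}, Fin (p j)) => (s'.1 : ℤ))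
      (S.filter fun s' => s'.2 = s.2) := by
    intro a ha b hb hab
    exact Prod.ext (Int.ofNat.inj hab)
      ((Finset.mem_filter.mp ha).2.trans (Finset.mem_filter.mp hb).2.symm)
  calc ∑ s' ∈ S, f s' = ∑ s' ∈ S.filter fun s' => s'.2 = s.2, f s' :=
        (Finset.sum_filter_of_ne fun s' hs' hf => by_contra fun h => hf (hdiff s' hs' h)).symm
    _ ≤ ∑ s' ∈ S.filter fun s' => s'.2 = s.2, A * delayedExp γ ρ ((s.1 : ℤ) - s'.1).natAbs :=
        Finset.sum_le_sum fun s' hs' =>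
          hsame s' (Finset.mem_filter.mp hs').1 (Finset.mem_filter.mp hs').2
    _ ≤ A * (2 * (ρ + expSumConst γ)) := by
        rw [← Finset.mul_sum]
        exact mul_le_mul_of_nonneg_left (sum_delayedExp_natAbs_le hγ hρ _ time_injOn _) hA

theorem measurable_truncErr_path (hτ : 0 ≤ τ) (i : Fin (p k))
    (s : ℕ × (∀ j : {j : Fin K // j ≠ k}, Fin (p j))) :
    Measurable fun x : ℤ → ℝ => truncErr τ (unfoldSample χ k i s) (x s.1) :=
  (measurable_truncErr hτ _).comp (measurable_pi_apply _)

theorem indepFun_noiseErr_prodMk (hξ : ∀ i t, Measurable (ξ i t))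
    (hind : iIndepFun (fun (i : ∀ k, Fin (p k)) ω t => ξ (pos i) t ω) P) (hτ : 0 ≤ τ)
    {i₁ i₂ j₁ j₂ : Fin (p k)} {s₁ s₂ u₁ u₂ : ℕ × (∀ j : {j : Fin K // j ≠ k}, Fin (p j))}
    (h₁₁ : fullIdx k i₁ s₁.2 ≠ fullIdx k j₁ u₁.2) (h₁₂ : fullIdx k i₁ s₁.2 ≠ fullIdx k j₂ u₂.2)
    (h₂₁ : fullIdx k i₂ s₂.2 ≠ fullIdx k j₁ u₁.2) (h₂₂ : fullIdx k i₂ s₂.2 ≠ fullIdx k j₂ u₂.2) :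
    IndepFun (fun ω => (noiseErr τ χ ξ k i₁ s₁ ω, noiseErr τ χ ξ k i₂ s₂ ω))
      (fun ω => (noiseErr τ χ ξ k j₁ u₁ ω, noiseErr τ χ ξ k j₂ u₂ ω)) P :=
  (hind.indepFun_prodMk_prodMk (fun i => measurable_pi_lambda _ fun t => hξ (pos i) t) _ _ _ _
    h₁₁ h₁₂ h₂₁ h₂₂).comp
    ((measurable_truncErr_path hτ i₁ s₁).prodMap (measurable_truncErr_path hτ i₂ s₂))
    ((measurable_truncErr_path hτ j₁ u₁).prodMap (measurable_truncErr_path hτ j₂ u₂))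

variable [IsProbabilityMeasure P] {c₀ ε w T U B : ℝ}

theorem covariance_noiseErr_eq_zero
    (hind : iIndepFun (fun (i : ∀ k, Fin (p k)) ω t => ξ (pos i) t ω) P) (hτ : 0 ≤ τ)
    {i j : Fin (p k)} {s u : ℕ × (∀ j : {j : Fin K // j ≠ k}, Fin (p j))}
    (he : TruncatedMoments P ε w T U B (noiseErr τ χ ξ k i s))
    (he' : TruncatedMoments P ε w T U B (noiseErr τ χ ξ k j u))
    (h : fullIdx k i s.2 ≠ fullIdx k j u.2) :
    cov[noiseErr τ χ ξ k i s, noiseErr τ χ ξ k j u; P] = 0 :=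
  ((hind.indepFun h).comp (measurable_truncErr_path hτ i s)
    (measurable_truncErr_path hτ j u)).covariance_eq_zero (he.memLp 2) (he'.memLp 2)

theorem covariance_noiseErr_mul_eq_zero (hξ : ∀ i t, Measurable (ξ i t))
    (hind : iIndepFun (fun (i : ∀ k, Fin (p k)) ω t => ξ (pos i) t ω) P) (hτ : 0 ≤ τ)
    {i j : Fin (p k)} {s s' : ℕ × (∀ j : {j : Fin K // j ≠ k}, Fin (p j))}
    (he : ∀ i, TruncatedMoments P ε w T U B (noiseErr τ χ ξ k i s))
    (he' : ∀ i, TruncatedMoments P ε w T U B (noiseErr τ χ ξ k i s')) (h : s'.2 ≠ s.2) :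
    cov[fun ω => noiseErr τ χ ξ k i s ω * noiseErr τ χ ξ k j s ω,
      fun ω => noiseErr τ χ ξ k i s' ω * noiseErr τ χ ξ k j s' ω; P] = 0 := by
  have index_ne (a b : Fin (p k)) : fullIdx k a s.2 ≠ fullIdx k b s'.2 :=
    fun heq => h ((fullIdx_inj k).mp heq).2.symm
  exact ((indepFun_noiseErr_prodMk hξ hind hτ (index_ne i i) (index_ne i j) (index_ne j i)
    (index_ne j j)).comp measurable_mul measurable_mul).covariance_eq_zero
      (memLp_two_mul ((he i).memLp 4) ((he j).memLp 4))
      (memLp_two_mul ((he' i).memLp 4) ((he' j).memLp 4))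

theorem alphaMix_comap_column_le (hα : ∀ (i : ∀ k, Fin (p k)) (m : ℕ),
      seriesAlpha P (ξ (pos i)) m ≤ Real.exp (-(c₀ * m))) (i : Fin (p k))
    {s s' : ℕ × (∀ j : {j : Fin K // j ≠ k}, Fin (p j))} (h : s'.2 = s.2) :
    alphaMix P (MeasurableSpace.comap (ξ (pos (fullIdx k i s.2)) s.1) inferInstance)
      (MeasurableSpace.comap (ξ (pos (fullIdx k i s'.2)) s'.1) inferInstance) ≤
      Real.exp (-(c₀ * ((s.1 : ℤ) - s'.1).natAbs)) := by
  rw [h]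
  exact alphaMix_comap_le_exp (hα _) _ _

theorem abs_covariance_noiseErr_le_of_same_column (hξ : ∀ i t, Measurable (ξ i t))
    (hα : ∀ (i : ∀ k, Fin (p k)) (m : ℕ), seriesAlpha P (ξ (pos i)) m ≤ Real.exp (-(c₀ * m)))
    (hε : 0 ≤ ε) (hw : 0 < w) (hτ : 0 ≤ τ) {i : Fin (p k)}
    {s s' : ℕ × (∀ j : {j : Fin K // j ≠ k}, Fin (p j))}
    (he : TruncatedMoments P ε w T U B (noiseErr τ χ ξ k i s))
    (he' : TruncatedMoments P ε w T U B (noiseErr τ χ ξ k i s')) (h : s'.2 = s.2) :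
    |cov[noiseErr τ χ ξ k i s, noiseErr τ χ ξ k i s'; P]| ≤
      9 * w ^ 2 * delayedExp (c₀ * ε / (1 + ε)) 0 ((s.1 : ℤ) - s'.1).natAbs :=
  he.abs_covariance_le he' hε hw (hξ _ _).comap_le (hξ _ _).comap_le
    (measurable_comap_noiseErr hτ i s) (measurable_comap_noiseErr hτ i s')
    (alphaMix_comap_column_le hα i h) (Nat.cast_nonneg _)

theorem sum_abs_covariance_noiseErr_sq_le (hξ : ∀ i t, Measurable (ξ i t)) (hc₀ : 0 < c₀)
    (hind : iIndepFun (fun (i : ∀ k, Fin (p k)) ω t => ξ (pos i) t ω) P)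
    (hα : ∀ (i : ∀ k, Fin (p k)) (m : ℕ), seriesAlpha P (ξ (pos i)) m ≤ Real.exp (-(c₀ * m)))
    (hτ : 0 ≤ τ) {n : ℕ}
    (he : ∀ i, ∀ s ∈ columnSites n p k, TruncatedMoments P ε w T U B (noiseErr τ χ ξ k i s))
    (hU : 0 ≤ U) {ρ : ℝ} (hρ0 : 0 ≤ ρ) (hρ : 4 * T ^ 4 ≤ U * Real.exp (c₀ * ρ)) (i : Fin (p k))
    {s : ℕ × (∀ j : {j : Fin K // j ≠ k}, Fin (p j))} (hs : s ∈ columnSites n p k) :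
    ∑ s' ∈ columnSites n p k, |cov[fun ω => noiseErr τ χ ξ k i s ω * noiseErr τ χ ξ k i s ω,
      fun ω => noiseErr τ χ ξ k i s' ω * noiseErr τ χ ξ k i s' ω; P]| ≤
      U * (2 * (ρ + expSumConst c₀)) := by
  refine sum_le_of_same_column hc₀ hρ0 hU s (fun s' hs' h => ?_) fun s' hs' h => ?_
  · exact (he i s hs).abs_covariance_mul_le (he i s hs) (he i s' hs') (he i s' hs')
      (hξ _ _).comap_le (hξ _ _).comap_le (measurable_comap_noiseErr hτ i s)
      (measurable_comap_noiseErr hτ i s) (measurable_comap_noiseErr hτ i s')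
      (measurable_comap_noiseErr hτ i s') (alphaMix_comap_column_le hα i h) hρ
  · rw [covariance_noiseErr_mul_eq_zero hξ hind hτ (he · s hs) (he · s' hs') h, abs_zero]

theorem sum_abs_covariance_noiseErr_mul_le (hξ : ∀ i t, Measurable (ξ i t)) (hc₀ : 0 < c₀)
    (hind : iIndepFun (fun (i : ∀ k, Fin (p k)) ω t => ξ (pos i) t ω) P)
    (hα : ∀ (i : ∀ k, Fin (p k)) (m : ℕ), seriesAlpha P (ξ (pos i)) m ≤ Real.exp (-(c₀ * m)))
    (hε : 0 < ε) (hw : 0 < w) (hτ : 0 ≤ τ) {n : ℕ}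
    (he : ∀ i, ∀ s ∈ columnSites n p k, TruncatedMoments P ε w T U B (noiseErr τ χ ξ k i s))
    {i j : Fin (p k)} (hij : i ≠ j)
    {s : ℕ × (∀ j : {j : Fin K // j ≠ k}, Fin (p j))} (hs : s ∈ columnSites n p k) :
    ∑ s' ∈ columnSites n p k, |cov[fun ω => noiseErr τ χ ξ k i s ω * noiseErr τ χ ξ k j s ω,
      fun ω => noiseErr τ χ ξ k i s' ω * noiseErr τ χ ξ k j s' ω; P]| ≤
      18 * w ^ 4 * (2 * expSumConst (c₀ * ε / (1 + ε))) := by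
  have hγ : 0 < c₀ * ε / (1 + ε) := by positivity
  rw [← zero_add (expSumConst _)]
  refine sum_le_of_same_column hγ le_rfl (by positivity) s (fun s' hs' h => ?_) fun s' hs' h => ?_
  · have row_ne (a b : ℕ × (∀ j : {j : Fin K // j ≠ k}, Fin (p j))) :
        fullIdx k i a.2 ≠ fullIdx k j b.2 := fun heq => hij ((fullIdx_inj k).mp heq).1
    have hcov (a : Fin (p k)) := abs_covariance_noiseErr_le_of_same_column hξ hα hε.le hw hτ
      (he a s hs) (he a s' hs') h
    refine ((he i s hs).abs_covariance_mul_le_of_indepFun (he j s hs) (he i s' hs') (he j s' hs')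
      hε.le hw.le (indepFun_noiseErr_prodMk hξ hind hτ (row_ne s s) (row_ne s s') (row_ne s' s)
        (row_ne s' s')) (hcov i) (hcov j)).trans_eq ?_
    ring
  · rw [covariance_noiseErr_mul_eq_zero hξ hind hτ (he · s hs) (he · s' hs') h, abs_zero]

theorem sum_variance_sampleInner_noiseErr_le (hξ : ∀ i t, Measurable (ξ i t)) (hc₀ : 0 < c₀)
    (hind : iIndepFun (fun (i : ∀ k, Fin (p k)) ω t => ξ (pos i) t ω) P)
    (hα : ∀ (i : ∀ k, Fin (p k)) (m : ℕ), seriesAlpha P (ξ (pos i)) m ≤ Real.exp (-(c₀ * m)))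
    (hε : 0 < ε) (hw : 0 < w) (hτ : 0 ≤ τ) {n : ℕ}
    (he : ∀ i, ∀ s ∈ columnSites n p k, TruncatedMoments P ε w T U B (noiseErr τ χ ξ k i s))
    (hU : 0 ≤ U) {ρ : ℝ} (hρ0 : 0 ≤ ρ) (hρ : 4 * T ^ 4 ≤ U * Real.exp (c₀ * ρ)) :
    ∑ i, ∑ j, Var[fun ω => sampleInner (columnSites n p k) (noiseErr τ χ ξ k i · ω)
        (noiseErr τ χ ξ k j · ω); P] ≤
      p k * (U * (2 * (ρ + expSumConst c₀)) / (n * dimExcept p k)) +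
        p k ^ 2 * (18 * w ^ 4 * (2 * expSumConst (c₀ * ε / (1 + ε))) / (n * dimExcept p k)) := by
  set diag := U * (2 * (ρ + expSumConst c₀)) / ((n : ℝ) * dimExcept p k)
  set offDiag := 18 * w ^ 4 * (2 * expSumConst (c₀ * ε / (1 + ε))) / ((n : ℝ) * dimExcept p k)
  have h_offDiag : 0 ≤ offDiag := by
    have := expSumConst_pos (γ := c₀ * ε / (1 + ε)) (by positivity)
    positivity
  have variance_le (i j : Fin (p k)) : Var[fun ω => sampleInner (columnSites n p k)
      (noiseErr τ χ ξ k i · ω) (noiseErr τ χ ξ k j · ω); P] ≤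
      (if i = j then diag else 0) + offDiag := by
    have hmem := fun s hs => memLp_two_mul ((he i s hs).memLp 4) ((he j s hs).memLp 4)
    split_ifs with hij
    · subst hij
      refine le_add_of_le_of_nonneg ?_ h_offDiag
      exact (variance_sampleMean_le hmem fun s hs =>
        sum_abs_covariance_noiseErr_sq_le hξ hc₀ hind hα hτ he hU hρ0 hρ i hs).trans_eq
          (by rw [card_columnSites])
    · rw [zero_add]
      exact (variance_sampleMean_le hmem fun s hs =>
        sum_abs_covariance_noiseErr_mul_le hξ hc₀ hind hα hε hw hτ he hij hs).trans_eq
          (by rw [card_columnSites])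
  refine (Finset.sum_le_sum fun i _ => Finset.sum_le_sum fun j _ => variance_le i j).trans_eq ?_
  simp only [Finset.sum_add_distrib, Finset.sum_ite_eq, Finset.mem_univ, if_true,
    Finset.sum_const, Finset.card_univ, Fintype.card_fin, nsmul_eq_mul]
  ring

theorem weakError_noiseErr_of_indep (hξ : ∀ i t, Measurable (ξ i t)) (hc₀ : 0 < c₀)
    (hind : iIndepFun (fun (i : ∀ k, Fin (p k)) ω t => ξ (pos i) t ω) P)
    (hα : ∀ (i : ∀ k, Fin (p k)) (m : ℕ), seriesAlpha P (ξ (pos i)) m ≤ Real.exp (-(c₀ * m)))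
    (hε : 0 < ε) (hw : 0 < w) (hτ : 0 ≤ τ) {n : ℕ}
    (he : ∀ i, ∀ s ∈ columnSites n p k, TruncatedMoments P ε w T U B (noiseErr τ χ ξ k i s))
    (hU : 0 ≤ U) {ρ : ℝ} (hρ0 : 0 ≤ ρ) (hρ : 4 * T ^ 4 ≤ U * Real.exp (c₀ * ρ)) :
    WeakError P (columnSites n p k) (noiseErr τ χ ξ k) B
      (9 * w ^ 2 * (2 * expSumConst (c₀ * ε / (1 + ε)))) (w ^ 2)
      (p k * (U * (2 * (ρ + expSumConst c₀)) / (n * dimExcept p k)) +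
        p k ^ 2 * (18 * w ^ 4 * (2 * expSumConst (c₀ * ε / (1 + ε))) / (n * dimExcept p k))) where
  memLp i s hs := (he i s hs).memLp 4
  bias i s hs := (he i s hs).bias
  cov_sample i s hs := by
    rw [← zero_add (expSumConst _)]
    refine sum_le_of_same_column (by positivity) le_rfl (by positivity) s
      (fun s' hs' h => abs_covariance_noiseErr_le_of_same_column hξ hα hε.le hw hτ (he i s hs)
        (he i s' hs') h) fun s' hs' h => ?_
    rw [covariance_noiseErr_eq_zero hind hτ (he i s hs) (he i s' hs')
      fun heq => h ((fullIdx_inj k).mp heq).2.symm, abs_zero]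
  cov_coord i s hs := by
    rw [Finset.sum_eq_single_of_mem i (Finset.mem_univ i) fun j _ hji => ?_]
    · rw [covariance_self (he i s hs).measurable.aemeasurable, abs_of_nonneg (variance_nonneg _ _)]
      exact (variance_le_expectation_sq (he i s hs).measurable.aestronglyMeasurable).trans
        ((he i s hs).integral_sq_le hε.le hw.le)
    · rw [covariance_noiseErr_eq_zero hind hτ (he i s hs) (he j s hs)
        fun heq => hji ((fullIdx_inj k).mp heq).1.symm, abs_zero]
  variance := sum_variance_sampleInner_noiseErr_le hξ hc₀ hind hα hε hw hτ he hU hρ0 hρ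

end IndependentSeries

section TruncationLevel

/-- The number `y` with `y ^ (2 + 2ε) = L ^ κ / N`; in both settings `τ^{(k)} = w / y` and
`ψ^{(k)} = w² y ^ (2ε)`, where `N = n p_{-k}` and `L ^ κ` is the logarithmic correction. -/
noncomputable def noiseScale (ε : ℝ) (κ : ℕ) (N L : ℝ) : ℝ :=
  (L ^ κ / N) ^ (1 / (2 + 2 * ε))

variable {ε w c C N L τ : ℝ} {κ : ℕ}

theorem noiseScale_pos (hN : 0 < N) (hL : 0 < L) : 0 < noiseScale ε κ N L :=
  Real.rpow_pos_of_pos (by positivity) _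

theorem noiseScale_rpow_eq (hε : 0 ≤ ε) (hN : 0 ≤ N) (hL : 0 ≤ L) :
    noiseScale ε κ N L ^ (2 + 2 * ε) = L ^ κ / N := by
  rw [noiseScale, ← Real.rpow_mul (by positivity), one_div, inv_mul_cancel₀ (by positivity),
    Real.rpow_one]

theorem rpow_div_one_add_eq_noiseScale_rpow (hε : 0 ≤ ε) (hN : 0 ≤ N) (hL : 0 ≤ L) :
    (L ^ κ / N) ^ (ε / (1 + ε)) = noiseScale ε κ N L ^ (2 * ε) := by
  rw [noiseScale, ← Real.rpow_mul (by positivity)]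
  congr 1
  field_simp

theorem mul_rpow_eq_div_noiseScale (hN : 0 ≤ N) (hL : 0 ≤ L) :
    w * (N / L ^ κ) ^ (1 / (2 + 2 * ε)) = w / noiseScale ε κ N L := by
  rw [noiseScale, div_eq_mul_inv w, ← Real.inv_rpow (by positivity), inv_div]

theorem inv_le_noiseScale_rpow_sq (hε : 0 ≤ ε) (hε1 : ε ≤ 1) (hN : 0 < N) (hL : 1 ≤ L)
    (hy : noiseScale ε κ N L ≤ 1) : N⁻¹ ≤ (noiseScale ε κ N L ^ (2 * ε)) ^ 2 := by
  have hy0 : 0 < noiseScale ε κ N L := noiseScale_pos hN (by positivity)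
  calc N⁻¹ ≤ L ^ κ / N := by
        rw [inv_eq_one_div]
        exact div_le_div_of_nonneg_right (one_le_pow₀ hL) hN.le
    _ = noiseScale ε κ N L ^ (2 + 2 * ε) := (noiseScale_rpow_eq hε hN.le (by positivity)).symm
    _ ≤ noiseScale ε κ N L ^ (2 * ε * (2 : ℕ)) :=
        Real.rpow_le_rpow_of_exponent_ge hy0 hy (by push_cast; linarith)
    _ = (noiseScale ε κ N L ^ (2 * ε)) ^ 2 := by rw [Real.rpow_mul hy0.le, Real.rpow_natCast]

/-- The truncation level `τ` is of order `w / y` with `y = noiseScale ε κ N L`, with constants `c`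
and `C`, for a sample size `N` and a logarithm `L` that are at least `1`. -/
structure IsTruncationLevel (ε w : ℝ) (κ : ℕ) (c C N L τ : ℝ) : Prop where
  one_le_size : 1 ≤ N
  one_le_log : 1 ≤ L
  log_size_le : Real.log N ≤ L
  le_level : c * (w / noiseScale ε κ N L) ≤ τ
  level_le : τ ≤ C * (w / noiseScale ε κ N L)

namespace IsTruncationLevel

theorem size_pos (h : IsTruncationLevel ε w κ c C N L τ) : 0 < N :=
  one_pos.trans_le h.one_le_size

theorem log_pos (h : IsTruncationLevel ε w κ c C N L τ) : 0 < L :=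
  one_pos.trans_le h.one_le_log

theorem scale_pos (h : IsTruncationLevel ε w κ c C N L τ) : 0 < noiseScale ε κ N L :=
  noiseScale_pos h.size_pos h.log_pos

theorem two_mul_rpow_le (h : IsTruncationLevel ε w κ c C N L τ) (hw : 0 ≤ w) (hC : 0 ≤ C)
    (hτ : 0 ≤ τ) {s : ℝ} (hs : 0 ≤ s) :
    (2 * τ) ^ s ≤ (2 * C) ^ s * w ^ s / noiseScale ε κ N L ^ s := by
  rw [← Real.mul_rpow (by positivity) hw, ← Real.div_rpow (by positivity) h.scale_pos.le]
  refine Real.rpow_le_rpow (by positivity) ?_ hs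
  calc 2 * τ ≤ 2 * (C * (w / noiseScale ε κ N L)) := by linarith [h.level_le]
    _ = 2 * C * w / noiseScale ε κ N L := by ring

theorem two_mul_pow_four_le (h : IsTruncationLevel ε w κ c C N L τ) (hε : 0 ≤ ε) (hw : 0 ≤ w)
    (hC : 0 ≤ C) (hτ : 0 < τ) :
    (2 * τ) ^ 4 ≤
      (2 * τ) ^ (4 - (2 + 2 * ε)) * w ^ (2 + 2 * ε) * ((2 * C) ^ (2 + 2 * ε) * N) := by
  have hsplit : (2 * τ) ^ 4 = (2 * τ) ^ (4 - (2 + 2 * ε)) * (2 * τ) ^ (2 + 2 * ε) := by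
    rw [← Real.rpow_add (by positivity), sub_add_cancel]
    norm_cast
  have hle : (2 * τ) ^ (2 + 2 * ε) ≤ (2 * C) ^ (2 + 2 * ε) * w ^ (2 + 2 * ε) * N := by
    refine (h.two_mul_rpow_le hw hC hτ.le (by positivity)).trans ?_
    rw [noiseScale_rpow_eq hε h.size_pos.le h.log_pos.le, div_div_eq_mul_div]
    have := h.size_pos
    exact div_le_self (by positivity) (one_le_pow₀ h.one_le_log)
  calc (2 * τ) ^ 4 ≤ (2 * τ) ^ (4 - (2 + 2 * ε)) *
        ((2 * C) ^ (2 + 2 * ε) * w ^ (2 + 2 * ε) * N) := by rw [hsplit]; gcongr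
    _ = _ := by ring

theorem scale_div_le (h : IsTruncationLevel ε w κ c C N L τ) (hε : 0 ≤ ε) (hε1 : ε ≤ 1)
    (hw : 0 ≤ w) (hC : 0 ≤ C) (hτ : 0 ≤ τ) {A ℓ : ℝ} (hℓ : 0 ≤ ℓ) (hA : ℓ ≤ A * L) :
    (2 * τ) ^ (4 - (2 + 2 * ε)) * w ^ (2 + 2 * ε) * ℓ ^ κ / N ≤
      (2 * C) ^ (4 - (2 + 2 * ε)) * w ^ (4 - (2 + 2 * ε)) * w ^ (2 + 2 * ε) * A ^ κ *
        (noiseScale ε κ N L ^ (2 * ε)) ^ 2 := by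
  have hN := h.size_pos
  have hy := h.scale_pos
  set y := noiseScale ε κ N L
  have hscale : y ^ (2 + 2 * ε) = L ^ κ / N := noiseScale_rpow_eq hε hN.le h.log_pos.le
  have hyy : y ^ (2 + 2 * ε) / y ^ (4 - (2 + 2 * ε)) = (y ^ (2 * ε)) ^ 2 := by
    rw [← Real.rpow_sub hy, ← Real.rpow_natCast, ← Real.rpow_mul hy.le]
    congr 1
    push_cast
    ring
  have hlevel := h.two_mul_rpow_le hw hC hτ (s := 4 - (2 + 2 * ε)) (by linarith)
  calc (2 * τ) ^ (4 - (2 + 2 * ε)) * w ^ (2 + 2 * ε) * ℓ ^ κ / N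
      ≤ (2 * C) ^ (4 - (2 + 2 * ε)) * w ^ (4 - (2 + 2 * ε)) / y ^ (4 - (2 + 2 * ε)) *
          w ^ (2 + 2 * ε) * (A * L) ^ κ / N := by gcongr
    _ = (2 * C) ^ (4 - (2 + 2 * ε)) * w ^ (4 - (2 + 2 * ε)) * w ^ (2 + 2 * ε) * A ^ κ *
          (L ^ κ / N / y ^ (4 - (2 + 2 * ε))) := by rw [mul_pow]; ring
    _ = _ := by rw [← hscale, hyy]

theorem bias_le (h : IsTruncationLevel ε w κ c C N L τ) (hε : 0 ≤ ε) (hw : 0 < w) (hc : 0 < c) :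
    (τ / 2) ^ (1 - (2 + 2 * ε)) * w ^ (2 + 2 * ε) ≤
      (c * w / 2) ^ (1 - (2 + 2 * ε)) * w ^ (2 + 2 * ε) * noiseScale ε κ N L ^ (1 + 2 * ε) := by
  have hy := h.scale_pos
  set y := noiseScale ε κ N L
  have hlevel : c * w / 2 / y ≤ τ / 2 := by
    calc c * w / 2 / y = c * (w / y) / 2 := by ring
      _ ≤ τ / 2 := by linarith [h.le_level]
  calc (τ / 2) ^ (1 - (2 + 2 * ε)) * w ^ (2 + 2 * ε)
      ≤ (c * w / 2 / y) ^ (1 - (2 + 2 * ε)) * w ^ (2 + 2 * ε) :=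
        mul_le_mul_of_nonneg_right
          (Real.rpow_le_rpow_of_nonpos (by positivity) hlevel (by linarith)) (by positivity)
    _ = (c * w / 2) ^ (1 - (2 + 2 * ε)) * w ^ (2 + 2 * ε) * y ^ (-(1 - (2 + 2 * ε))) := by
        rw [Real.div_rpow (by positivity) hy.le, Real.rpow_neg hy.le]
        ring
    _ = _ := by
        congr 2
        ring

theorem bias_sq_le (h : IsTruncationLevel ε w κ c C N L τ) (hε : 0 ≤ ε) (hw : 0 < w) (hc : 0 < c)
    (hτ : 0 ≤ τ) :
    ((τ / 2) ^ (1 - (2 + 2 * ε)) * w ^ (2 + 2 * ε)) ^ 2 ≤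
      ((c * w / 2) ^ (1 - (2 + 2 * ε)) * w ^ (2 + 2 * ε)) ^ 2 *
        (L ^ κ / N * noiseScale ε κ N L ^ (2 * ε)) := by
  have hy := h.scale_pos
  refine (pow_le_pow_left₀ (by positivity) (h.bias_le hε hw hc) 2).trans_eq ?_
  rw [mul_pow, ← noiseScale_rpow_eq hε h.size_pos.le h.log_pos.le, ← Real.rpow_add hy,
    ← Real.rpow_natCast, ← Real.rpow_natCast, ← Real.rpow_mul hy.le]
  congr 2
  push_cast
  ring

end IsTruncationLevel

/-- The dependence range is taken logarithmic in `N`, so that the exponentially small mixing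
coefficients beat the truncation bound `(2 τ) ^ 4`. -/
theorem exists_dependence_range {c₀ E : ℝ} (c κ) (hε : 0 ≤ ε) (hε1 : ε ≤ 1) (hw : 0 ≤ w)
    (hC : 0 ≤ C) (hc₀ : 0 < c₀) (hE : 0 ≤ E) :
    ∃ D : ℝ, 0 ≤ D ∧ ∀ N L τ : ℝ, 0 < τ → IsTruncationLevel ε w κ c C N L τ → ∃ ρ : ℝ, 0 ≤ ρ ∧
      4 * (2 * τ) ^ 4 ≤
        (2 * τ) ^ (4 - (2 + 2 * ε)) * w ^ (2 + 2 * ε) * Real.exp (c₀ * ρ) ∧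
      (2 * τ) ^ (4 - (2 + 2 * ε)) * w ^ (2 + 2 * ε) * (2 * (ρ + E)) ^ κ / N ≤
        D * (noiseScale ε κ N L ^ (2 * ε)) ^ 2 := by
  set b : ℝ := max 1 (4 * (2 * C) ^ (2 + 2 * ε))
  have hb1 : 1 ≤ b := le_max_left _ _
  have hlogb : 0 ≤ Real.log b := Real.log_nonneg hb1
  refine ⟨(2 * C) ^ (4 - (2 + 2 * ε)) * w ^ (4 - (2 + 2 * ε)) * w ^ (2 + 2 * ε) *
    (2 * ((Real.log b + 1) / c₀ + E)) ^ κ, by positivity, fun N L τ hτ h => ?_⟩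
  have hN := h.size_pos
  have hb0 : 0 < b := one_pos.trans_le hb1
  have hrange : 0 ≤ Real.log (b * N) / c₀ :=
    div_nonneg (Real.log_nonneg (one_le_mul_of_one_le_of_one_le hb1 h.one_le_size)) hc₀.le
  refine ⟨Real.log (b * N) / c₀, hrange, ?_, ?_⟩
  · rw [mul_div_cancel₀ _ hc₀.ne', Real.exp_log (by positivity)]
    calc 4 * (2 * τ) ^ 4
        ≤ 4 * ((2 * τ) ^ (4 - (2 + 2 * ε)) * w ^ (2 + 2 * ε) * ((2 * C) ^ (2 + 2 * ε) * N)) := by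
          gcongr
          exact h.two_mul_pow_four_le hε hw hC hτ
      _ = (2 * τ) ^ (4 - (2 + 2 * ε)) * w ^ (2 + 2 * ε) * (4 * (2 * C) ^ (2 + 2 * ε) * N) := by
          ring
      _ ≤ _ := by
          gcongr
          exact le_max_right _ _
  · refine h.scale_div_le hε hε1 hw hC hτ.le (by positivity) ?_
    have hlog : Real.log (b * N) ≤ (Real.log b + 1) * L := by
      rw [Real.log_mul hb0.ne' hN.ne', add_one_mul]
      exact add_le_add (le_mul_of_one_le_right hlogb h.one_le_log) h.log_size_le
    calc 2 * (Real.log (b * N) / c₀ + E) ≤ 2 * ((Real.log b + 1) * L / c₀ + E * L) := by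
          gcongr
          exact le_mul_of_one_le_right hE h.one_le_log
      _ = _ := by ring

end TruncationLevel

section Regime

variable {ι : Type*} {l : Filter ι} {K : ℕ} {n : ι → ℕ} {p : ι → Fin K → ℕ} {ε w : ℝ} {κ : ℕ}

theorem dimAll_eq_mul_dimExcept (d : Fin K → ℕ) (k : Fin K) : dimAll d = d k * dimExcept d k :=
  (Finset.mul_prod_erase _ _ (Finset.mem_univ k)).symm

theorem tendsto_mul_dimExcept (hn : Tendsto n l atTop)
    (hp : ∀ k, Tendsto (fun ν => p ν k) l atTop) (k : Fin K) :
    Tendsto (fun ν => (n ν : ℝ) * dimExcept (p ν) k) l atTop := by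
  have hpos : ∀ᶠ ν in l, ∀ j, 0 < p ν j := eventually_all.mpr fun j => (hp j).eventually_gt_atTop 0
  refine tendsto_atTop_mono' l ?_ (tendsto_natCast_atTop_atTop.comp hn)
  filter_upwards [hpos] with ν hpos
  have hd : 0 < dimExcept (p ν) k := Finset.prod_pos fun j _ => hpos j
  exact le_mul_of_one_le_right (Nat.cast_nonneg _) (by exact_mod_cast hd)

theorem log_mul_dimExcept_le_log_mul_dimAll {m : ℕ} {d : Fin K → ℕ} {k : Fin K} (hk : 0 < d k)
    (hd : 0 < (m : ℝ) * dimExcept d k) :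
    Real.log (m * dimExcept d k) ≤ Real.log (m * dimAll d) := by
  refine Real.log_le_log hd (mul_le_mul_of_nonneg_left ?_ (Nat.cast_nonneg _))
  rw [dimAll_eq_mul_dimExcept d k]
  exact_mod_cast Nat.le_mul_of_pos_left _ hk

theorem GrowthCondition.tendsto_mode {M : ι → ℝ} {τlev : ι → Fin K → ℝ}
    (h : GrowthCondition l n p ε M τlev) (k : Fin K) (hM : ∀ ν, 0 ≤ M ν)
    (hτ : ∀ᶠ ν in l, 0 ≤ τlev ν k)
    (hN : Tendsto (fun ν => (n ν : ℝ) * dimExcept (p ν) k) l atTop) :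
    Tendsto (fun ν => M ν * ((τlev ν k)⁻¹ *
      Real.log ((n ν : ℝ) * dimExcept (p ν) k) ^ (1 / (2 * ε)))) l (𝓝 0) := by
  refine squeeze_zero' ?_ (Eventually.of_forall fun ν => ?_) h
  · filter_upwards [hτ, hN.eventually_ge_atTop 1] with ν hτ hN
    have := hM ν
    have := Real.log_nonneg hN
    positivity
  · exact mul_le_mul_of_nonneg_left (le_ciSup (f := fun k : Fin K => (τlev ν k)⁻¹ *
      Real.log ((n ν : ℝ) * dimExcept (p ν) k) ^ (1 / (2 * ε))) (Set.finite_range _).bddAbove k)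
      (hM ν)

variable {M N L y τ : ι → ℝ}

theorem isLittleO_div_of_growth (hε : 0 ≤ ε) (hw : w ≠ 0) (hM : ∀ ν, 0 ≤ M ν)
    (hN : Tendsto N l atTop) (hy : ∀ᶠ ν in l, 0 < y ν)
    (h : Tendsto (fun ν => M ν * (y ν * Real.log (N ν) ^ (1 / (2 * ε)))) l (𝓝 0)) :
    M =o[l] fun ν => w / y ν := by
  have hlog := (Real.tendsto_log_atTop.comp hN).eventually_ge_atTop 1
  have hMy : Tendsto (fun ν => M ν * y ν) l (𝓝 0) := by
    refine squeeze_zero' ?_ ?_ h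
    · filter_upwards [hy] with ν hy using mul_nonneg (hM ν) hy.le
    · filter_upwards [hlog, hy] with ν hlog hy
      exact mul_le_mul_of_nonneg_left
        (le_mul_of_one_le_right hy.le (Real.one_le_rpow hlog (by positivity))) (hM ν)
  refine (isLittleO_iff_tendsto' ?_).mpr ?_
  · filter_upwards [hy] with ν hy h0
    exact absurd h0 (div_ne_zero hw hy.ne')
  · simpa [div_div_eq_mul_div] using hMy.div_const w

theorem tendsto_zero_of_isLittleO_div (hw : 0 < w) (hwM : ∀ ν, w ≤ M ν)
    (hM : M =o[l] fun ν => w / y ν) : Tendsto y l (𝓝 0) := by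
  have hw_bigO : (fun _ => w) =O[l] M := .of_norm_le fun ν => by
    rw [Real.norm_of_nonneg hw.le]
    exact hwM ν
  have hy := (hw_bigO.trans_isLittleO hM).tendsto_div_nhds_zero
  simpa [div_div_cancel₀ hw.ne'] using hy

theorem eventually_log_mul_rpow_le_one (hε : 0 < ε) (hw : 0 < w) (hwM : ∀ ν, w ≤ M ν)
    (hN : Tendsto N l atTop) (hy : ∀ᶠ ν in l, 0 < y ν)
    (h : Tendsto (fun ν => M ν * (y ν * Real.log (N ν) ^ (1 / (2 * ε)))) l (𝓝 0)) :
    ∀ᶠ ν in l, Real.log (N ν) * y ν ^ (2 * ε) ≤ 1 := by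
  filter_upwards [hN.eventually_ge_atTop 1, hy, h.eventually (gt_mem_nhds hw)] with ν hN hy hsmall
  have hlog := Real.log_nonneg hN
  have hroot : y ν * Real.log (N ν) ^ (1 / (2 * ε)) ≤ 1 := by
    refine le_of_mul_le_mul_left (le_trans ?_ (hsmall.le.trans (mul_one w).ge)) hw
    exact mul_le_mul_of_nonneg_right (hwM ν) (by positivity)
  calc Real.log (N ν) * y ν ^ (2 * ε)
      = (y ν * Real.log (N ν) ^ (1 / (2 * ε))) ^ (2 * ε) := by
        rw [Real.mul_rpow hy.le (by positivity), ← Real.rpow_mul hlog, one_div,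
          inv_mul_cancel₀ (by positivity), Real.rpow_one, mul_comm]
    _ ≤ 1 := Real.rpow_le_one (by positivity) hroot (by positivity)

theorem eventually_mul_le_half_of_isLittleO (A : ℝ) (hτ : ∀ ν, 0 < τ ν) (hM : M =o[l] τ) :
    ∀ᶠ ν in l, A * M ν ≤ τ ν / 2 := by
  filter_upwards [(hM.const_mul_left A).bound (c := 1 / 2) (by norm_num)] with ν h
  rw [Real.norm_of_nonneg (hτ ν).le] at h
  linarith [Real.le_norm_self (A * M ν)]

theorem exists_eventually_isTruncationLevel (hw : 0 < w) (hτ : ∀ ν, 0 < τ ν)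
    (hN : Tendsto N l atTop) (hL : ∀ᶠ ν in l, Real.log (N ν) ≤ L ν)
    (hΘ : τ =Θ[l] fun ν => w / noiseScale ε κ (N ν) (L ν)) :
    ∃ c C : ℝ, 0 < c ∧ 0 < C ∧
      ∀ᶠ ν in l, IsTruncationLevel ε w κ c C (N ν) (L ν) (τ ν) := by
  obtain ⟨C, hC, hupper⟩ := hΘ.1.exists_pos
  obtain ⟨c, hc, hlower⟩ := hΘ.2.exists_pos
  refine ⟨c⁻¹, C, inv_pos.mpr hc, hC, ?_⟩
  filter_upwards [hN.eventually_ge_atTop 1, hL, hupper.bound, hlower.bound,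
    (Real.tendsto_log_atTop.comp hN).eventually_ge_atTop 1] with ν hN hL hupper hlower hlog
  have hL1 : 1 ≤ L ν := le_trans hlog hL
  have hlev : 0 < w / noiseScale ε κ (N ν) (L ν) :=
    div_pos hw (noiseScale_pos (by linarith) (by linarith))
  rw [Real.norm_of_nonneg (hτ ν).le, Real.norm_of_nonneg hlev.le] at hupper hlower
  exact ⟨hN, hL1, hL, by rwa [inv_mul_le_iff₀ hc], hupper⟩

end Regime

section StochasticOrder

variable {Ω ι : Type*} [MeasurableSpace Ω] {P : Measure Ω} {l : Filter ι} {Z Z' : ι → Ω → ℝ}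
  {a b : ι → ℝ} {A B : ℝ}

theorem IsBigOP.of_abs_le_imp (h : IsBigOP P l Z a) (hB : 0 < B)
    (hZ : ∀ᶠ ν in l, ∀ ω, ∀ C > 0, |Z ν ω| ≤ C * a ν → |Z' ν ω| ≤ B * C * b ν) :
    IsBigOP P l Z' b := by
  intro δ hδ
  obtain ⟨C, hC, hbound⟩ := h δ hδ
  refine ⟨B * C, mul_pos hB hC, ?_⟩
  filter_upwards [hbound, hZ] with ν hbound hZ
  refine (measure_mono fun ω hω => ?_).trans hbound
  by_contra hle
  exact (hZ ω C hC (not_lt.mp hle)).not_gt hω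

theorem IsBigOP.mono (h : IsBigOP P l Z a) (hB : 0 < B) (hab : ∀ᶠ ν in l, a ν ≤ B * b ν) :
    IsBigOP P l Z b := by
  refine h.of_abs_le_imp hB ?_
  filter_upwards [hab] with ν hab ω C hC hZ
  calc |Z ν ω| ≤ C * a ν := hZ
    _ ≤ C * (B * b ν) := by gcongr
    _ = B * C * b ν := by ring

theorem IsBigOP.tendstoInMeasure {x : ℝ} (h : IsBigOP P l (fun ν ω => Z ν ω - x) a)
    (ha : Tendsto a l (𝓝 0)) : TendstoInMeasure P Z l fun _ => x := by
  refine tendstoInMeasure_iff_dist.mpr fun η hη => ENNReal.tendsto_nhds_zero.mpr fun δ hδ => ?_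
  rcases eq_or_ne δ ⊤ with rfl | hδ_top
  · exact Eventually.of_forall fun _ => le_top
  obtain ⟨C, -, hbound⟩ := h δ.toReal (ENNReal.toReal_pos hδ.ne' hδ_top)
  have hsmall : ∀ᶠ ν in l, C * a ν < η :=
    Tendsto.eventually_lt_const hη (by simpa using ha.const_mul C)
  filter_upwards [hbound, hsmall] with ν hbound hsmall
  rw [ENNReal.ofReal_toReal hδ_top] at hbound
  exact (measure_mono fun ω hω => hsmall.trans_le hω).trans hbound

theorem isBigOP_of_chebyshev (hA : 0 < A) (ha : ∀ᶠ ν in l, 0 < a ν)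
    (h : ∀ᶠ ν in l, ∃ d V : ℝ, d ≤ A * a ν ∧ V ≤ A * a ν ^ 2 ∧
      ∀ T > 0, P {ω | T + d < |Z ν ω|} ≤ ENNReal.ofReal (V / T ^ 2)) :
    IsBigOP P l Z a := by
  intro δ hδ
  refine ⟨√(A / δ) + A, by positivity, ?_⟩
  filter_upwards [ha, h] with ν ha ⟨d, V, hd, hV, hT⟩
  calc P {ω | (√(A / δ) + A) * a ν < |Z ν ω|}
      ≤ P {ω | √(A / δ) * a ν + d < |Z ν ω|} := by
        refine measure_mono fun ω (hω : _ < _) => lt_of_le_of_lt (b := (√(A / δ) + A) * a ν) ?_ hω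
        rw [add_mul]
        gcongr
    _ ≤ ENNReal.ofReal (V / (√(A / δ) * a ν) ^ 2) := hT _ (by positivity)
    _ ≤ ENNReal.ofReal δ := by
        refine ENNReal.ofReal_le_ofReal ?_
        rw [div_le_iff₀ (by positivity), mul_pow, Real.sq_sqrt (by positivity), ← mul_assoc,
          mul_div_cancel₀ _ hδ.ne']
        exact hV

end StochasticOrder

section Alignment

open scoped Matrix.Norms.L2Operator
open Matrix

variable {Ω ι : Type*} [MeasurableSpace Ω] {P : Measure Ω} {l : Filter ι} {s : ℕ} {q : ι → ℕ}
  {Λ : ∀ ν, Matrix (Fin (q ν)) (Fin s) ℝ} {Λhat : ∀ ν, Ω → Matrix (Fin (q ν)) (Fin s) ℝ}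
  {a b : ι → ℝ}

/-- The estimator `Λhat` recovers `Λ` at the rate `O_P(a)` in normalized spectral norm, up to
asymptotically orthogonal random matrices that are measurable whenever `Λhat` is. -/
def AlignsAtRate (P : Measure Ω) (l : Filter ι) (Λ : ∀ ν, Matrix (Fin (q ν)) (Fin s) ℝ)
    (Λhat : ∀ ν, Ω → Matrix (Fin (q ν)) (Fin s) ℝ) (a : ι → ℝ) : Prop :=
  ∃ H : ι → Ω → Matrix (Fin s) (Fin s) ℝ,
    (∀ ν, (∀ i j, Measurable fun ω => Λhat ν ω i j) → ∀ i j, Measurable fun ω => H ν ω i j) ∧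
    (∀ i j, TendstoInMeasure P (fun ν ω => ((H ν ω).transpose * H ν ω) i j) l
      (fun _ => (1 : Matrix (Fin s) (Fin s) ℝ) i j)) ∧
    IsBigOP P l (fun ν ω => 1 / √(q ν : ℝ) * specNorm (Λhat ν ω - Λ ν * H ν ω)) a

theorem AlignsAtRate.mono {B : ℝ} (h : AlignsAtRate P l Λ Λhat a) (hB : 0 < B)
    (hab : ∀ᶠ ν in l, a ν ≤ B * b ν) : AlignsAtRate P l Λ Λhat b :=
  let ⟨H, hH, horth, herr⟩ := h
  ⟨H, hH, horth, herr.mono hB hab⟩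

theorem alignsAtRate_of_isBigOP {Γ : ∀ ν, Ω → Matrix (Fin (q ν)) (Fin (q ν)) ℝ}
    {G : ι → Matrix (Fin s) (Fin s) ℝ} {α : ℝ} {ρ : ι → ℝ} (hq : Tendsto q l atTop) (hα : 0 < α)
    (hΛ : ∀ ν, (Λ ν)ᵀ * Λ ν = (q ν : ℝ) • 1)
    (hG : ∀ ν x, α * (x ⬝ᵥ x) ≤ x ⬝ᵥ G ν *ᵥ x) (hhat : ∀ ν ω, IsPCLoading (Γ ν ω) (Λhat ν ω))
    (hρ : Tendsto ρ l (𝓝 0))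
    (h : IsBigOP P l (fun ν ω => ‖Γ ν ω - Λ ν * G ν * (Λ ν)ᵀ‖) fun ν => q ν * ρ ν) :
    AlignsAtRate P l Λ Λhat ρ := by
  have hα2 : 0 < 2 / α := by positivity
  have hnorm {ν ω C} (hC : |‖Γ ν ω - Λ ν * G ν * (Λ ν)ᵀ‖| ≤ C * (q ν * ρ ν)) :
      ‖Γ ν ω - Λ ν * G ν * (Λ ν)ᵀ‖ ≤ q ν * (C * ρ ν) := by
    rw [abs_norm] at hC
    exact hC.trans_eq (mul_left_comm _ _ _)
  refine ⟨fun ν ω => pcRotation (Λ ν) (Λhat ν ω), fun ν hmeas i j => ?_, fun i j => ?_, ?_⟩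
  · simp only [pcRotation, Matrix.smul_apply, Matrix.mul_apply, smul_eq_mul]
    exact (Finset.measurable_fun_sum _ fun b _ => (hmeas b j).const_mul _).const_mul _
  · refine IsBigOP.tendstoInMeasure (h.of_abs_le_imp hα2 ?_) hρ
    filter_upwards [hq.eventually_ge_atTop s, hq.eventually_ne_atTop 0] with ν hs hq ω C _ hC
    rw [mul_assoc]
    exact abs_pcRotation_gram_sub_one_le hq hs hα (hΛ ν) (hG ν) (add_sub_cancel _ _).symm
      (hnorm hC) (hhat ν ω) i j
  · refine h.of_abs_le_imp hα2 ?_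
    filter_upwards [hq.eventually_ge_atTop s, hq.eventually_ne_atTop 0] with ν hs hq ω C _ hC
    rw [mul_assoc]
    refine (abs_of_nonneg (mul_nonneg (by positivity) (norm_nonneg _))).trans_le ?_
    exact specNorm_sub_mul_pcRotation_le hq hs hα (hΛ ν) (hG ν) (add_sub_cancel _ _).symm
      (hnorm hC) (hhat ν ω)

end Alignment

section FactorModel

open scoped Matrix.Norms.L2Operator
open Matrix

variable {Ω ι : Type*} [MeasurableSpace Ω] {P : Measure Ω} {K : ℕ} {r : Fin K → ℕ} {l : Filter ι}
  {n : ι → ℕ} {p : ι → Fin K → ℕ} {Λ : ∀ ν k, Matrix (Fin (p ν k)) (Fin (r k)) ℝ}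
  {F : ι → ℕ → Tensor r} {ξ : ι → (Fin K → ℕ) → ℤ → Ω → ℝ} {ε w : ℝ} {M : ι → ℝ}

/-- The tensor factor model with pervasive factors: in every mode, the eigenvalues of the second
moment matrices of the factors are bounded away from zero. -/
structure PervasiveFactorModel (P : Measure Ω) (n : ι → ℕ) (p : ι → Fin K → ℕ)
    (Λ : ∀ ν k, Matrix (Fin (p ν k)) (Fin (r k)) ℝ) (F : ι → ℕ → Tensor r)
    (ξ : ι → (Fin K → ℕ) → ℤ → Ω → ℝ) (ε w : ℝ) (M : ι → ℝ) : Prop where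
  loading : LoadingAssumption Λ
  noise : NoiseAssumption P p ξ
  eps_pos : 0 < ε
  eps_lt_one : ε < 1
  w_pos : 0 < w
  noise_moment : ∀ ν (i : ∀ k, Fin (p ν k)) t,
    eLpNorm (ξ ν (pos i) t) (ENNReal.ofReal (2 + 2 * ε)) P ≤ ENNReal.ofReal w
  pervasive : ∀ k, ∃ a > 0, ∀ ν x, a * (x ⬝ᵥ x) ≤ x ⬝ᵥ factorGram (n ν) (F ν) k *ᵥ x
  factor_moment : ∀ ν, (n ν : ℝ)⁻¹ * ∑ t ∈ Finset.Icc 1 (n ν), tnorm (F ν t) ^ 2 ≤ w ^ 2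
  w_le_M : ∀ ν, w ≤ M ν
  factor_le_M : ∀ ν, ∀ t ∈ Finset.Icc 1 (n ν), tnorm (F ν t) ≤ M ν

theorem LoadingAssumption.transpose_mul_self (h : LoadingAssumption Λ) (ν : ι) (k : Fin K) :
    (Λ ν k)ᵀ * Λ ν k = (p ν k : ℝ) • 1 := by
  have horth := h.orthonormal ν k
  by_cases hp : (p ν k : ℝ) = 0
  · rw [hp, _root_.inv_zero, zero_smul] at horth
    rw [hp, zero_smul, ← Matrix.mul_one ((Λ ν k)ᵀ * Λ ν k), ← horth, Matrix.mul_zero]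
  · rw [← horth, smul_smul, mul_inv_cancel₀ hp, one_smul]

theorem LoadingAssumption.exists_abs_tucker_le (h : LoadingAssumption Λ) :
    ∃ L ≥ 0, ∀ ν (X : Tensor r) i, |tucker X (Λ ν) i| ≤ L * tnorm X := by
  obtain ⟨lam, hlam⟩ := h.bounded
  exact ⟨|lam| ^ K * √(Fintype.card (∀ k, Fin (r k))), by positivity,
    fun ν X i => abs_tucker_le X (hlam ν) i⟩

theorem FactorAssumption.exists_pervasive (h : FactorAssumption n F) (k : Fin K) :
    ∃ a > 0, ∀ ν x, a * (x ⬝ᵥ x) ≤ x ⬝ᵥ factorGram (n ν) (F ν) k *ᵥ x := by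
  obtain ⟨a, b, ha, -, h⟩ := h
  rcases isEmpty_or_nonempty (Fin (r k)) with _ | _
  · exact ⟨1, one_pos, fun ν x => by simp [dotProduct]⟩
  obtain ⟨j₀, hmin⟩ := Finite.exists_min (a k)
  refine ⟨a k j₀, ha k j₀, fun ν x => ?_⟩
  obtain ⟨hdiag, hbounds⟩ := h ν k
  rw [← hdiag.diagonal_diag, ← smul_eq_mul, ← dotProduct_smul]
  refine Finset.sum_le_sum fun j _ => ?_
  rw [mulVec_diagonal, Pi.smul_apply, smul_eq_mul, mul_left_comm, mul_left_comm (x j)]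
  exact mul_le_mul_of_nonneg_right ((hmin j).trans (hbounds j).1) (mul_self_nonneg _)

theorem TailAssumption.pervasiveFactorModel (hT : TailAssumption P n p F ξ ε w M)
    (hΛ : LoadingAssumption Λ) (hF : FactorAssumption n F) (hξ : NoiseAssumption P p ξ) :
    PervasiveFactorModel P n p Λ F ξ ε w M where
  loading := hΛ
  noise := hξ
  eps_pos := hT.eps_pos
  eps_lt_one := hT.eps_lt_one
  w_pos := hT.w_pos
  noise_moment := hT.noise
  pervasive := hF.exists_pervasive
  factor_moment ν := by simpa only [Real.rpow_two] using hT.factor ν 2 (by simp)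
  w_le_M := hT.w_le_M
  factor_le_M := hT.factor_le_M

namespace PervasiveFactorModel

variable (h : PervasiveFactorModel P n p Λ F ξ ε w M) {k : Fin K} {τ : ι → ℝ}
include h

theorem M_nonneg (ν : ι) : 0 ≤ M ν :=
  h.w_pos.le.trans (h.w_le_M ν)

theorem eventually_truncatedMoments [IsProbabilityMeasure P] (k : Fin K) (hτ : ∀ ν, 0 < τ ν)
    (hM : M =o[l] τ) : ∀ᶠ ν in l, ∀ i, ∀ s ∈ columnSites (n ν) (p ν) k,
      TruncatedMoments P ε w (2 * τ ν) ((2 * τ ν) ^ (4 - (2 + 2 * ε)) * w ^ (2 + 2 * ε))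
        ((τ ν / 2) ^ (1 - (2 + 2 * ε)) * w ^ (2 + 2 * ε))
        (noiseErr (τ ν) (fun t => tucker (F ν t) (Λ ν)) (ξ ν) k i s) := by
  obtain ⟨L, hL, htucker⟩ := h.loading.exists_abs_tucker_le
  filter_upwards [eventually_mul_le_half_of_isLittleO L hτ hM] with ν hsignal i s hs
  refine truncatedMoments_noiseErr h.eps_pos.le h.eps_lt_one.le h.w_pos.le (hτ ν)
    (h.noise.measurable ν) (h.noise.centred ν) (h.noise_moment ν) ?_
  calc |tucker (F ν s.1) (Λ ν) _| ≤ L * tnorm (F ν s.1) := htucker ν _ _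
    _ ≤ L * M ν := by
        gcongr
        exact h.factor_le_M ν s.1 (Finset.mem_product.mp hs).1
    _ ≤ τ ν / 2 := hsignal

theorem exists_sampleInner_signal_le (k : Fin K) : ∃ C ≥ 0, ∀ ν, dimExcept (p ν) k ≠ 0 → ∀ i,
    sampleInner (columnSites (n ν) (p ν) k) (unfoldSample (fun t => tucker (F ν t) (Λ ν)) k i)
      (unfoldSample (fun t => tucker (F ν t) (Λ ν)) k i) ≤ C := by
  obtain ⟨L, -, htucker⟩ := h.loading.exists_abs_tucker_le
  refine ⟨L ^ 2 * w ^ 2, by positivity, fun ν hd i => ?_⟩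
  have hsq (t : ℕ) (i) : tucker (F ν t) (Λ ν) i ^ 2 ≤ L ^ 2 * tnorm (F ν t) ^ 2 := by
    rw [← sq_abs, ← mul_pow]
    exact pow_le_pow_left₀ (abs_nonneg _) (htucker ν _ i) 2
  refine (sampleInner_unfoldSample_le hd hsq i).trans ?_
  rw [← Finset.mul_sum, mul_left_comm]
  exact mul_le_mul_of_nonneg_left (h.factor_moment ν) (by positivity)

end PervasiveFactorModel

end FactorModel

section Rates

variable {ι : Type*} {l : Filter ι} {K : ℕ} {n : ι → ℕ} {p : ι → Fin K → ℕ} {ε w : ℝ}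

theorem tauIndep_eq_div_noiseScale (m : ℕ) (d : Fin K → ℕ) (k : Fin K) :
    tauIndep m d ε w k =
      w / noiseScale ε 1 (m * dimExcept d k) (Real.log (m * dimExcept d k)) := by
  rw [← mul_rpow_eq_div_noiseScale (by positivity) (mod_cast Real.log_natCast_nonneg _), pow_one,
    tauIndep]

theorem tauField_eq_div_noiseScale (m : ℕ) (d : Fin K → ℕ) (k : Fin K) :
    tauField m d ε w k = w / noiseScale ε K (m * dimExcept d k) (Real.log (m * dimAll d)) :=
  mul_rpow_eq_div_noiseScale (by positivity) (mod_cast Real.log_natCast_nonneg _)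

theorem psiIndep_eq_mul_noiseScale_rpow (hε : 0 ≤ ε) (m : ℕ) (d : Fin K → ℕ) (k : Fin K) :
    psiIndep m d ε w k =
      w ^ 2 * noiseScale ε 1 (m * dimExcept d k) (Real.log (m * dimExcept d k)) ^ (2 * ε) := by
  rw [← rpow_div_one_add_eq_noiseScale_rpow hε (by positivity)
    (mod_cast Real.log_natCast_nonneg _), pow_one, psiIndep]

theorem psiField_eq_mul_noiseScale_rpow (hε : 0 ≤ ε) (m : ℕ) (d : Fin K → ℕ) (k : Fin K) :
    psiField m d ε w k =
      w ^ 2 * noiseScale ε K (m * dimExcept d k) (Real.log (m * dimAll d)) ^ (2 * ε) := by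
  rw [psiField, rpow_div_one_add_eq_noiseScale_rpow hε (by positivity)
    (mod_cast Real.log_natCast_nonneg _)]

theorem inv_add_sq_div_le_sq {N q y : ℝ} (hN : 0 ≤ N) (hq : 0 ≤ q) (hy : 0 ≤ y) :
    N⁻¹ + y ^ 2 / q ≤ ((√N)⁻¹ + y / √q) ^ 2 := by
  refine le_trans (Eq.le ?_) (pow_add_pow_le (by positivity) (by positivity) two_ne_zero)
  rw [inv_pow, Real.sq_sqrt hN, div_pow, Real.sq_sqrt hq]

theorem rate_le_mul_max_psiField {m : ℕ} {d : Fin K → ℕ} {k : Fin K} (hε : 0 ≤ ε) (hw : 0 < w) :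
    noiseScale ε K (m * dimExcept d k) (Real.log (m * dimAll d)) ^ (2 * ε) + (d k : ℝ)⁻¹ ≤
      ((w ^ 2)⁻¹ + 1) * max (psiField m d ε w k) (1 / (d k : ℝ)) := by
  rw [← inv_mul_cancel_left₀ (pow_ne_zero 2 hw.ne') (noiseScale _ _ _ _ ^ _),
    ← psiField_eq_mul_noiseScale_rpow hε, inv_eq_one_div (d k : ℝ), add_one_mul]
  gcongr
  · exact le_max_left _ _
  · exact le_max_right _ _

theorem rate_le_mul_max_psiIndep {m : ℕ} {d : Fin K → ℕ} {k : Fin K} {M : ℝ} (hε : 0 ≤ ε)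
    (hε1 : ε ≤ 1) (hw : 0 < w) (hwM : w ≤ M) :
    (√((m : ℝ) * dimExcept d k))⁻¹ + noiseScale ε 1 (m * dimExcept d k)
        (Real.log (m * dimExcept d k)) ^ (2 * ε) / √(d k) + (d k : ℝ)⁻¹ ≤
      ((w ^ (1 - ε))⁻¹ + (w ^ 2)⁻¹ + 1) *
        max (max (M ^ (1 - ε) / √((m : ℝ) * dimExcept d k)) (1 / (d k : ℝ)))
          (psiIndep m d ε w k / √(d k : ℝ)) := by
  rw [← inv_mul_cancel_left₀ (pow_ne_zero 2 hw.ne') (noiseScale _ _ _ _ ^ _),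
    ← psiIndep_eq_mul_noiseScale_rpow hε, inv_eq_one_div (d k : ℝ), add_one_mul, add_mul,
    mul_div_assoc]
  have hwMε : w ^ (1 - ε) ≤ M ^ (1 - ε) := Real.rpow_le_rpow hw.le hwM (by linarith)
  have hfactor : (√((m : ℝ) * dimExcept d k))⁻¹ ≤
      (w ^ (1 - ε))⁻¹ * (M ^ (1 - ε) / √((m : ℝ) * dimExcept d k)) := by
    rw [inv_mul_eq_div, div_right_comm, ← one_div]
    gcongr
    exact (one_le_div (by positivity)).mpr hwMε
  refine add_le_add (add_le_add (hfactor.trans ?_) ?_) ?_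
  · gcongr
    exact (le_max_left _ _).trans (le_max_left _ _)
  · gcongr
    exact le_max_right _ _
  · exact (le_max_right _ _).trans (le_max_left _ _)

theorem GrowthCondition.tendsto_scale {M y : ι → ℝ} {τlev : ι → Fin K → ℝ}
    (h : GrowthCondition l n p ε M τlev) {k : Fin K} (hM : ∀ ν, 0 ≤ M ν) (hw : 0 < w)
    (hN : Tendsto (fun ν => (n ν : ℝ) * dimExcept (p ν) k) l atTop) (hy : ∀ᶠ ν in l, 0 < y ν)
    (hlev : ∀ ν, τlev ν k = w / y ν) :
    Tendsto (fun ν => M ν * (y ν * Real.log ((n ν : ℝ) * dimExcept (p ν) k) ^ (1 / (2 * ε))))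
      l (𝓝 0) := by
  have hτ : ∀ᶠ ν in l, 0 ≤ τlev ν k := hy.mono fun ν hy => by
    rw [hlev]
    positivity
  have hmode := (h.tendsto_mode k hM hτ hN).const_mul w
  rw [mul_zero] at hmode
  refine hmode.congr fun ν => ?_
  rw [hlev, inv_div]
  field_simp

end Rates

section Consistency

open scoped Matrix.Norms.L2Operator
open Matrix

variable {Ω ι : Type*} [MeasurableSpace Ω] {P : Measure Ω} [IsProbabilityMeasure P] {K : ℕ}
  {r : Fin K → ℕ} {l : Filter ι} {n : ι → ℕ} {p : ι → Fin K → ℕ}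
  {Λ : ∀ ν k, Matrix (Fin (p ν k)) (Fin (r k)) ℝ} {F : ι → ℕ → Tensor r}
  {ξ : ι → (Fin K → ℕ) → ℤ → Ω → ℝ} {ε w : ℝ} {M : ι → ℝ} {k : Fin K} {τ : ι → ℝ}

theorem measure_lt_norm_truncGram_obs_sub_le {m : ℕ} {d : Fin K → ℕ} {F : ℕ → Tensor r}
    {Λ : ∀ j, Matrix (Fin (d j)) (Fin (r j)) ℝ} {ξ : (Fin K → ℕ) → ℤ → Ω → ℝ}
    {τ B C₁ C₂ C₃ V T : ℝ} (hΛ : ∀ j, (Λ j)ᵀ * Λ j = (d j : ℝ) • 1) (hd : dimExcept d k ≠ 0)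
    (h : WeakError P (columnSites m d k) (noiseErr τ (fun t => tucker (F t) Λ) ξ k) B C₁ C₂ V)
    (hC₁ : 0 ≤ C₁) (hC₂ : 0 ≤ C₂)
    (hsignal : ∀ i, sampleInner (columnSites m d k) (unfoldSample (fun t => tucker (F t) Λ) k i)
      (unfoldSample (fun t => tucker (F t) Λ) k i) ≤ C₃) (hT : 0 < T) :
    P {ω | T + (C₂ + d k * B ^ 2) <
        ‖truncGram m (fun t => obs (F t) Λ fun i => ξ i t ω) τ k -
          Λ k * factorGram m F k * (Λ k)ᵀ‖} ≤
      ENNReal.ofReal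
        (3 * (2 * d k ^ 2 * ((C₁ / (m * dimExcept d k) + B ^ 2) * C₃) + V) / T ^ 2) := by
  have hbound := h.measure_lt_l2_opNorm_sampleGram_sub_le hC₁ hC₂ hsignal hT
  have hgram (ω : Ω) : truncGram m (fun t => obs (F t) Λ fun i => ξ i t ω) τ k =
      sampleGram (columnSites m d k) (fun i s => unfoldSample (fun t => tucker (F t) Λ) k i s +
        noiseErr τ (fun t => tucker (F t) Λ) ξ k i s ω) := by
    rw [unfoldSample_add_noiseErr, sampleGram_unfoldSample]
    rfl
  simp only [sampleGram_unfoldSample_tucker m F hΛ hd, ← hgram, Fintype.card_fin,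
    card_columnSites] at hbound
  exact hbound

namespace PervasiveFactorModel

theorem alignsAtRate_of_weakError (h : PervasiveFactorModel P n p Λ F ξ ε w M)
    (hp : ∀ k, Tendsto (fun ν => p ν k) l atTop)
    {Λhat : ∀ ν, Ω → Matrix (Fin (p ν k)) (Fin (r k)) ℝ}
    (hhat : ∀ ν ω, IsPCLoading
      (truncGram (n ν) (fun t => obs (F ν t) (Λ ν) fun i => ξ ν i t ω) (τ ν) k) (Λhat ν ω))
    {C₁ C₂ D : ℝ} {ρ : ι → ℝ} (hC₁ : 0 ≤ C₁) (hC₂ : 0 ≤ C₂) (hD : 0 ≤ D)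
    (hρ : Tendsto ρ l (𝓝 0)) (hρp : ∀ᶠ ν in l, (p ν k : ℝ)⁻¹ ≤ ρ ν)
    (hρN : ∀ᶠ ν in l, ((n ν : ℝ) * dimExcept (p ν) k)⁻¹ ≤ ρ ν ^ 2)
    (herr : ∀ᶠ ν in l, ∃ B V : ℝ, WeakError P (columnSites (n ν) (p ν) k)
      (noiseErr (τ ν) (fun t => tucker (F ν t) (Λ ν)) (ξ ν) k) B C₁ C₂ V ∧
      B ^ 2 ≤ D * ρ ν ^ 2 ∧ V ≤ D * (p ν k * ρ ν) ^ 2) :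
    AlignsAtRate P l (fun ν => Λ ν k) Λhat ρ := by
  obtain ⟨α, hα, hG⟩ := h.pervasive k
  obtain ⟨C₃, hC₃, hsignal⟩ := h.exists_sampleInner_signal_le k
  have hpos : ∀ᶠ ν in l, ∀ j, 0 < p ν j := eventually_all.mpr fun j => (hp j).eventually_gt_atTop 0
  have hρ_pos : ∀ᶠ ν in l, 0 < p ν k * ρ ν := by
    filter_upwards [hpos, hρp] with ν hpos hρp
    have hpk : (0 : ℝ) < p ν k := mod_cast hpos k
    exact mul_pos hpk ((inv_pos.mpr hpk).trans_le hρp)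
  have hvar_const : 0 ≤ 3 * (2 * ((C₁ + D) * C₃) + D) := by positivity
  refine alignsAtRate_of_isBigOP (hp k) hα (fun ν => h.loading.transpose_mul_self ν k) hG hhat hρ ?_
  refine isBigOP_of_chebyshev (A := C₂ + D + 3 * (2 * ((C₁ + D) * C₃) + D) + 1) (by positivity)
    hρ_pos ?_
  filter_upwards [hpos, hρp, hρN, herr, hρ_pos, hρ.eventually_le_const one_pos] with ν hpos hρp hρN
    ⟨B, V, hweak, hB, hV⟩ hρ_pos hρ_le
  have hpk : (0 : ℝ) < p ν k := mod_cast hpos k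
  have hd : dimExcept (p ν) k ≠ 0 := (Finset.prod_pos fun j _ => hpos j).ne'
  have hone : 1 ≤ p ν k * ρ ν := (inv_le_iff_one_le_mul₀' hpk).mp hρp
  refine ⟨C₂ + p ν k * B ^ 2,
    3 * (2 * p ν k ^ 2 * ((C₁ / (n ν * dimExcept (p ν) k) + B ^ 2) * C₃) + V), ?_, ?_,
    fun T hT => ?_⟩
  · have hB' : B ^ 2 ≤ D * ρ ν := hB.trans <| mul_le_mul_of_nonneg_left
      (pow_le_of_le_one ((inv_pos.mpr hpk).trans_le hρp).le hρ_le two_ne_zero) hD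
    calc C₂ + p ν k * B ^ 2 ≤ C₂ * (p ν k * ρ ν) + p ν k * (D * ρ ν) :=
          add_le_add (le_mul_of_one_le_right hC₂ hone) (mul_le_mul_of_nonneg_left hB' hpk.le)
      _ = (C₂ + D) * (p ν k * ρ ν) := by ring
      _ ≤ _ := mul_le_mul_of_nonneg_right (by linarith) hρ_pos.le
  · calc 3 * (2 * p ν k ^ 2 * ((C₁ / (n ν * dimExcept (p ν) k) + B ^ 2) * C₃) + V)
        ≤ 3 * (2 * p ν k ^ 2 * ((C₁ * ρ ν ^ 2 + D * ρ ν ^ 2) * C₃) + D * (p ν k * ρ ν) ^ 2) := by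
          rw [div_eq_mul_inv C₁]
          gcongr
      _ = 3 * (2 * ((C₁ + D) * C₃) + D) * (p ν k * ρ ν) ^ 2 := by ring
      _ ≤ _ := mul_le_mul_of_nonneg_right (by linarith) (sq_nonneg _)
  · simpa only [abs_norm] using measure_lt_norm_truncGram_obs_sub_le
      (h.loading.transpose_mul_self ν) hd hweak hC₁ hC₂ (hsignal ν hd) hT

theorem alignsAtRate_add_inv_of_weakError (h : PervasiveFactorModel P n p Λ F ξ ε w M)
    (hp : ∀ k, Tendsto (fun ν => p ν k) l atTop)
    {Λhat : ∀ ν, Ω → Matrix (Fin (p ν k)) (Fin (r k)) ℝ}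
    (hhat : ∀ ν ω, IsPCLoading
      (truncGram (n ν) (fun t => obs (F ν t) (Λ ν) fun i => ξ ν i t ω) (τ ν) k) (Λhat ν ω))
    {C₁ C₂ D : ℝ} {Y : ι → ℝ} (hC₁ : 0 ≤ C₁) (hC₂ : 0 ≤ C₂) (hD : 0 ≤ D)
    (hY : Tendsto Y l (𝓝 0)) (hY0 : ∀ᶠ ν in l, 0 ≤ Y ν)
    (hYN : ∀ᶠ ν in l, ((n ν : ℝ) * dimExcept (p ν) k)⁻¹ ≤ Y ν ^ 2)
    (herr : ∀ᶠ ν in l, ∃ B V : ℝ, WeakError P (columnSites (n ν) (p ν) k)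
      (noiseErr (τ ν) (fun t => tucker (F ν t) (Λ ν)) (ξ ν) k) B C₁ C₂ V ∧
      B ^ 2 ≤ D * Y ν ^ 2 ∧ V ≤ D * (p ν k * Y ν) ^ 2) :
    AlignsAtRate P l (fun ν => Λ ν k) Λhat fun ν => Y ν + (p ν k : ℝ)⁻¹ := by
  have hYρ : ∀ᶠ ν in l, Y ν ^ 2 ≤ (Y ν + (p ν k : ℝ)⁻¹) ^ 2 := hY0.mono fun ν hY0 =>
    pow_le_pow_left₀ hY0 (le_add_of_nonneg_right (by positivity)) 2
  have hρ : Tendsto (fun ν => Y ν + (p ν k : ℝ)⁻¹) l (𝓝 0) := by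
    simpa using hY.add ((tendsto_inv_atTop_nhds_zero_nat (𝕜 := ℝ)).comp (hp k))
  refine h.alignsAtRate_of_weakError hp hhat hC₁ hC₂ hD hρ
    (hY0.mono fun ν hY0 => le_add_of_nonneg_left hY0) ?_ ?_
  · filter_upwards [hYN, hYρ] with ν hYN hYρ using hYN.trans hYρ
  · filter_upwards [herr, hYρ] with ν ⟨B, V, hweak, hB, hV⟩ hYρ
    refine ⟨B, V, hweak, hB.trans (mul_le_mul_of_nonneg_left hYρ hD), hV.trans ?_⟩
    rw [mul_pow, mul_pow (p ν k : ℝ)]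
    gcongr

variable {c₀ c C : ℝ} {L : ι → ℝ}

theorem exists_weakError_of_field (h : PervasiveFactorModel P n p Λ F ξ ε w M) (hc₀ : 0 < c₀)
    (hα : ∀ ν (m : ℕ), fieldAlpha P (ξ ν) m ⊤ ⊤ ≤ Real.exp (-(c₀ * m))) (hc : 0 < c) (hC : 0 ≤ C)
    (hτ : ∀ ν, 0 < τ ν)
    (hmom : ∀ᶠ ν in l, ∀ i, ∀ s ∈ columnSites (n ν) (p ν) k,
      TruncatedMoments P ε w (2 * τ ν) ((2 * τ ν) ^ (4 - (2 + 2 * ε)) * w ^ (2 + 2 * ε))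
        ((τ ν / 2) ^ (1 - (2 + 2 * ε)) * w ^ (2 + 2 * ε))
        (noiseErr (τ ν) (fun t => tucker (F ν t) (Λ ν)) (ξ ν) k i s))
    (hlevel : ∀ᶠ ν in l,
      IsTruncationLevel ε w K c C ((n ν : ℝ) * dimExcept (p ν) k) (L ν) (τ ν))
    (hy : ∀ᶠ ν in l, noiseScale ε K ((n ν : ℝ) * dimExcept (p ν) k) (L ν) ≤ 1) :
    ∃ C₁ C₂ D : ℝ, 0 ≤ C₁ ∧ 0 ≤ C₂ ∧ 0 ≤ D ∧ ∀ᶠ ν in l, ∃ B V : ℝ,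
      WeakError P (columnSites (n ν) (p ν) k)
        (noiseErr (τ ν) (fun t => tucker (F ν t) (Λ ν)) (ξ ν) k) B C₁ C₂ V ∧
      B ^ 2 ≤ D * (noiseScale ε K ((n ν : ℝ) * dimExcept (p ν) k) (L ν) ^ (2 * ε)) ^ 2 ∧
      V ≤ D * (p ν k * noiseScale ε K ((n ν : ℝ) * dimExcept (p ν) k) (L ν) ^ (2 * ε)) ^ 2 := by
  have hε := h.eps_pos
  have hw := h.w_pos
  have hK : (0 : ℝ) < K := mod_cast k.pos
  have hE := expSumConst_pos (γ := c₀ / K) (by positivity)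
  have hE₁ := expSumConst_pos (γ := c₀ * ε / (1 + ε) / K) (by positivity)
  have hE₂ := expSumConst_pos (γ := c₀ * ε / (1 + ε)) (by positivity)
  obtain ⟨D, hD, hrange⟩ := exists_dependence_range c K hε.le h.eps_lt_one.le hw.le hC hc₀ hE.le
  refine ⟨9 * w ^ 2 * (2 * expSumConst (c₀ * ε / (1 + ε) / K)) ^ K,
    9 * w ^ 2 * (2 * expSumConst (c₀ * ε / (1 + ε))),
    ((c * w / 2) ^ (1 - (2 + 2 * ε)) * w ^ (2 + 2 * ε)) ^ 2 + D,
    by positivity, by positivity, by positivity, ?_⟩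
  filter_upwards [hmom, hlevel, hy] with ν hmom hlevel hy
  have hτν := hτ ν
  obtain ⟨ρ, hρ0, hρ, hvar⟩ := hrange _ _ _ hτν hlevel
  refine ⟨_, _, weakError_noiseErr_of_field (h.noise.measurable ν) hc₀ (hα ν) hε hw hτν.le hmom
    (by positivity) hρ0 hρ, (hlevel.bias_sq_le hε.le hw hc hτν.le).trans ?_, ?_⟩
  · rw [← noiseScale_rpow_eq hε.le hlevel.size_pos.le hlevel.log_pos.le, sq (_ ^ (2 * ε))]
    have hscale := hlevel.scale_pos
    have hYY := Real.rpow_le_rpow_of_exponent_ge hscale hy (by linarith : 2 * ε ≤ 2 + 2 * ε)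
    gcongr
    exact le_add_of_nonneg_right hD
  · rw [mul_pow (p ν k : ℝ), mul_left_comm (_ + D)]
    refine mul_le_mul_of_nonneg_left (hvar.trans ?_) (sq_nonneg _)
    exact mul_le_mul_of_nonneg_right (le_add_of_nonneg_left (sq_nonneg _)) (sq_nonneg _)

theorem exists_weakError_of_indep (h : PervasiveFactorModel P n p Λ F ξ ε w M) (hc₀ : 0 < c₀)
    (hind : ∀ ν, iIndepFun (fun (i : ∀ k, Fin (p ν k)) (ω : Ω) (t : ℤ) => ξ ν (pos i) t ω) P)
    (hα : ∀ ν (i : ∀ k, Fin (p ν k)) (m : ℕ),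
      seriesAlpha P (ξ ν (pos i)) m ≤ Real.exp (-(c₀ * m))) (hc : 0 < c) (hC : 0 ≤ C)
    (hτ : ∀ ν, 0 < τ ν)
    (hmom : ∀ᶠ ν in l, ∀ i, ∀ s ∈ columnSites (n ν) (p ν) k,
      TruncatedMoments P ε w (2 * τ ν) ((2 * τ ν) ^ (4 - (2 + 2 * ε)) * w ^ (2 + 2 * ε))
        ((τ ν / 2) ^ (1 - (2 + 2 * ε)) * w ^ (2 + 2 * ε))
        (noiseErr (τ ν) (fun t => tucker (F ν t) (Λ ν)) (ξ ν) k i s))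
    (hlevel : ∀ᶠ ν in l,
      IsTruncationLevel ε w 1 c C ((n ν : ℝ) * dimExcept (p ν) k) (L ν) (τ ν))
    (hy : ∀ᶠ ν in l,
      L ν * noiseScale ε 1 ((n ν : ℝ) * dimExcept (p ν) k) (L ν) ^ (2 * ε) ≤ 1) :
    ∃ C₁ C₂ D : ℝ, 0 ≤ C₁ ∧ 0 ≤ C₂ ∧ 0 ≤ D ∧ ∀ᶠ ν in l, ∃ B V : ℝ,
      WeakError P (columnSites (n ν) (p ν) k)
        (noiseErr (τ ν) (fun t => tucker (F ν t) (Λ ν)) (ξ ν) k) B C₁ C₂ V ∧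
      B ^ 2 ≤ D * ((n ν : ℝ) * dimExcept (p ν) k)⁻¹ ∧
      V ≤ D * (p ν k * (noiseScale ε 1 ((n ν : ℝ) * dimExcept (p ν) k) (L ν) ^ (2 * ε)) ^ 2 +
        p ν k ^ 2 * ((n ν : ℝ) * dimExcept (p ν) k)⁻¹) := by
  have hε := h.eps_pos
  have hw := h.w_pos
  have hE := expSumConst_pos hc₀
  have hE₁ := expSumConst_pos (γ := c₀ * ε / (1 + ε)) (by positivity)
  obtain ⟨D, hD, hrange⟩ := exists_dependence_range c 1 hε.le h.eps_lt_one.le hw.le hC hc₀ hE.le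
  set b := ((c * w / 2) ^ (1 - (2 + 2 * ε)) * w ^ (2 + 2 * ε)) ^ 2
  set A := 18 * w ^ 4 * (2 * expSumConst (c₀ * ε / (1 + ε)))
  have hb : 0 ≤ b := sq_nonneg _
  have hA : 0 ≤ A := by positivity
  refine ⟨9 * w ^ 2 * (2 * expSumConst (c₀ * ε / (1 + ε))), w ^ 2, b + A + D,
    by positivity, by positivity, by positivity, ?_⟩
  filter_upwards [hmom, hlevel, hy] with ν hmom hlevel hy
  have hτν := hτ ν
  obtain ⟨ρ, hρ0, hρ, hvar⟩ := hrange _ _ _ hτν hlevel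
  rw [pow_one] at hvar
  refine ⟨_, _, weakError_noiseErr_of_indep (h.noise.measurable ν) hc₀ (hind ν) (hα ν) hε hw hτν.le
    hmom (by positivity) hρ0 hρ, (hlevel.bias_sq_le hε.le hw hc hτν.le).trans ?_, ?_⟩
  · rw [pow_one, div_mul_eq_mul_div, ← one_div]
    have hN := hlevel.size_pos
    have hL := hlevel.log_pos
    have hscale := hlevel.scale_pos
    gcongr
    linarith
  · rw [mul_add (b + A + D), mul_left_comm (b + A + D), mul_left_comm (b + A + D),
      div_eq_mul_inv (18 * w ^ 4 * _)]
    have hN := hlevel.size_pos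
    gcongr
    · exact hvar.trans (mul_le_mul_of_nonneg_right (by linarith) (sq_nonneg _))
    · linarith

theorem exists_truncation_regime (h : PervasiveFactorModel P n p Λ F ξ ε w M)
    (hN : Tendsto (fun ν => (n ν : ℝ) * dimExcept (p ν) k) l atTop) (hτ : ∀ ν, 0 < τ ν)
    {κ : ℕ} {L : ι → ℝ} {τlev : ι → Fin K → ℝ} (hgrowth : GrowthCondition l n p ε M τlev)
    (hlev : ∀ ν, τlev ν k = w / noiseScale ε κ (n ν * dimExcept (p ν) k) (L ν))
    (hL : ∀ᶠ ν in l, Real.log (n ν * dimExcept (p ν) k) ≤ L ν) (hΘ : τ =Θ[l] fun ν => τlev ν k) :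
    ∃ c C : ℝ, 0 < c ∧ 0 < C ∧
      (∀ᶠ ν in l, IsTruncationLevel ε w κ c C (n ν * dimExcept (p ν) k) (L ν) (τ ν)) ∧
      (∀ᶠ ν in l, ∀ i, ∀ s ∈ columnSites (n ν) (p ν) k,
        TruncatedMoments P ε w (2 * τ ν) ((2 * τ ν) ^ (4 - (2 + 2 * ε)) * w ^ (2 + 2 * ε))
          ((τ ν / 2) ^ (1 - (2 + 2 * ε)) * w ^ (2 + 2 * ε))
          (noiseErr (τ ν) (fun t => tucker (F ν t) (Λ ν)) (ξ ν) k i s)) ∧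
      Tendsto (fun ν => noiseScale ε κ (n ν * dimExcept (p ν) k) (L ν)) l (𝓝 0) ∧
      ∀ᶠ ν in l, Real.log (n ν * dimExcept (p ν) k) *
        noiseScale ε κ (n ν * dimExcept (p ν) k) (L ν) ^ (2 * ε) ≤ 1 := by
  have hΘ' : τ =Θ[l] fun ν => w / noiseScale ε κ (n ν * dimExcept (p ν) k) (L ν) := by
    simpa only [hlev] using hΘ
  obtain ⟨c, C, hc, hC, hlevel⟩ := exists_eventually_isTruncationLevel h.w_pos hτ hN hL hΘ'
  have hy := hlevel.mono fun ν hlevel => hlevel.scale_pos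
  have hscale := hgrowth.tendsto_scale h.M_nonneg h.w_pos hN hy hlev
  have hM := isLittleO_div_of_growth h.eps_pos.le h.w_pos.ne' h.M_nonneg hN hy hscale
  exact ⟨c, C, hc, hC, hlevel, h.eventually_truncatedMoments k hτ (hM.trans_isTheta hΘ'.symm),
    tendsto_zero_of_isLittleO_div h.w_pos h.w_le_M hM,
    eventually_log_mul_rpow_le_one h.eps_pos h.w_pos h.w_le_M hN hy hscale⟩

theorem alignsAtRate_of_field (h : PervasiveFactorModel P n p Λ F ξ ε w M)
    (hn : Tendsto n l atTop) (hp : ∀ k, Tendsto (fun ν => p ν k) l atTop) {c₀ : ℝ} (hc₀ : 0 < c₀)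
    (hα : ∀ ν (m : ℕ), fieldAlpha P (ξ ν) m ⊤ ⊤ ≤ Real.exp (-(c₀ * m)))
    (hgrowth : GrowthCondition l n p ε M fun ν => tauField (n ν) (p ν) ε w) (hτ : ∀ ν, 0 < τ ν)
    (hΘ : τ =Θ[l] fun ν => tauField (n ν) (p ν) ε w k)
    {Λhat : ∀ ν, Ω → Matrix (Fin (p ν k)) (Fin (r k)) ℝ}
    (hhat : ∀ ν ω, IsPCLoading
      (truncGram (n ν) (fun t => obs (F ν t) (Λ ν) fun i => ξ ν i t ω) (τ ν) k) (Λhat ν ω)) :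
    AlignsAtRate P l (fun ν => Λ ν k) Λhat
      fun ν => max (psiField (n ν) (p ν) ε w k) (1 / (p ν k : ℝ)) := by
  have hN := tendsto_mul_dimExcept hn hp k
  have hL : ∀ᶠ ν in l,
      Real.log (n ν * dimExcept (p ν) k) ≤ Real.log ((n ν : ℝ) * dimAll (p ν)) := by
    filter_upwards [(hp k).eventually_gt_atTop 0, hN.eventually_gt_atTop 0] with ν hpk hN
    exact log_mul_dimExcept_le_log_mul_dimAll hpk hN
  obtain ⟨c, C, hc, hC, hlevel, hmom, hy, -⟩ := h.exists_truncation_regime hN hτ hgrowth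
    (fun ν => tauField_eq_div_noiseScale (n ν) (p ν) k) hL hΘ
  obtain ⟨C₁, C₂, D, hC₁, hC₂, hD, herr⟩ := h.exists_weakError_of_field hc₀ hα hc hC.le hτ hmom
    hlevel (hy.eventually_le_const one_pos)
  have hε : 0 < 2 * ε := mul_pos two_pos h.eps_pos
  have hY := hy.rpow_const (p := 2 * ε) (.inr hε.le)
  rw [Real.zero_rpow hε.ne'] at hY
  refine (h.alignsAtRate_add_inv_of_weakError hp hhat hC₁ hC₂ hD hY
    (hlevel.mono fun ν hlevel => Real.rpow_nonneg hlevel.scale_pos.le _) ?_ herr).mono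
    (B := (w ^ 2)⁻¹ + 1) (by have := h.w_pos; positivity)
    (.of_forall fun ν => rate_le_mul_max_psiField h.eps_pos.le h.w_pos)
  filter_upwards [hlevel, hy.eventually_le_const one_pos] with ν hlevel hy
  exact inv_le_noiseScale_rpow_sq h.eps_pos.le h.eps_lt_one.le hlevel.size_pos
    hlevel.one_le_log hy

theorem alignsAtRate_of_indep (h : PervasiveFactorModel P n p Λ F ξ ε w M)
    (hn : Tendsto n l atTop) (hp : ∀ k, Tendsto (fun ν => p ν k) l atTop) {c₀ : ℝ} (hc₀ : 0 < c₀)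
    (hind : ∀ ν, iIndepFun (fun (i : ∀ k, Fin (p ν k)) (ω : Ω) (t : ℤ) => ξ ν (pos i) t ω) P)
    (hα : ∀ ν (i : ∀ k, Fin (p ν k)) (m : ℕ),
      seriesAlpha P (ξ ν (pos i)) m ≤ Real.exp (-(c₀ * m)))
    (hgrowth : GrowthCondition l n p ε M fun ν => tauIndep (n ν) (p ν) ε w) (hτ : ∀ ν, 0 < τ ν)
    (hΘ : τ =Θ[l] fun ν => tauIndep (n ν) (p ν) ε w k)
    {Λhat : ∀ ν, Ω → Matrix (Fin (p ν k)) (Fin (r k)) ℝ}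
    (hhat : ∀ ν ω, IsPCLoading
      (truncGram (n ν) (fun t => obs (F ν t) (Λ ν) fun i => ξ ν i t ω) (τ ν) k) (Λhat ν ω)) :
    AlignsAtRate P l (fun ν => Λ ν k) Λhat fun ν =>
      max (max (M ν ^ (1 - ε) / √((n ν : ℝ) * dimExcept (p ν) k)) (1 / (p ν k : ℝ)))
        (psiIndep (n ν) (p ν) ε w k / √(p ν k : ℝ)) := by
  have hN := tendsto_mul_dimExcept hn hp k
  obtain ⟨c, C, hc, hC, hlevel, hmom, hy, hlog⟩ := h.exists_truncation_regime hN hτ hgrowth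
    (fun ν => tauIndep_eq_div_noiseScale (n ν) (p ν) k) (.of_forall fun ν => le_rfl) hΘ
  obtain ⟨C₁, C₂, D, hC₁, hC₂, hD, herr⟩ := h.exists_weakError_of_indep hc₀ hind hα hc hC.le hτ
    hmom hlevel hlog
  have hε : 0 < 2 * ε := mul_pos two_pos h.eps_pos
  have hY := hy.rpow_const (p := 2 * ε) (.inr hε.le)
  rw [Real.zero_rpow hε.ne'] at hY
  set Y : ι → ℝ := fun ν =>
    noiseScale ε 1 (n ν * dimExcept (p ν) k) (Real.log (n ν * dimExcept (p ν) k)) ^ (2 * ε)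
  have hY0 : ∀ᶠ ν in l, 0 ≤ Y ν :=
    hlevel.mono fun ν hlevel => Real.rpow_nonneg hlevel.scale_pos.le _
  have hrate :
      Tendsto (fun ν => (√((n ν : ℝ) * dimExcept (p ν) k))⁻¹ + Y ν / √(p ν k)) l (𝓝 0) := by
    simpa using ((Real.tendsto_sqrt_atTop.comp hN).inv_tendsto_atTop).add
      (hY.div_atTop (Real.tendsto_sqrt_atTop.comp (tendsto_natCast_atTop_atTop.comp (hp k))))
  have hsq : ∀ᶠ ν in l, ((n ν : ℝ) * dimExcept (p ν) k)⁻¹ + Y ν ^ 2 / p ν k ≤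
      ((√((n ν : ℝ) * dimExcept (p ν) k))⁻¹ + Y ν / √(p ν k)) ^ 2 := hY0.mono fun ν hY0 =>
    inv_add_sq_div_le_sq (by positivity) (by positivity) hY0
  refine (h.alignsAtRate_add_inv_of_weakError hp hhat hC₁ hC₂ hD hrate
    (hY0.mono fun ν hY0 => by positivity)
    (hsq.mono fun ν hsq => (le_add_of_nonneg_right (by positivity)).trans hsq) ?_).mono
    (B := (w ^ (1 - ε))⁻¹ + (w ^ 2)⁻¹ + 1) (by have := h.w_pos; positivity)
    (.of_forall fun ν => rate_le_mul_max_psiIndep h.eps_pos.le h.eps_lt_one.le h.w_pos (h.w_le_M ν))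
  filter_upwards [herr, hsq, (hp k).eventually_gt_atTop 0] with ν ⟨B, V, hweak, hB, hV⟩ hsq hpk
  refine ⟨B, V, hweak, hB.trans ?_, hV.trans ?_⟩
  · gcongr
    exact (le_add_of_nonneg_right (by positivity)).trans hsq
  · calc D * (p ν k * Y ν ^ 2 + p ν k ^ 2 * ((n ν : ℝ) * dimExcept (p ν) k)⁻¹)
        = D * (p ν k ^ 2 * (((n ν : ℝ) * dimExcept (p ν) k)⁻¹ + Y ν ^ 2 / p ν k)) := by
          field_simp
          ring
      _ ≤ _ := by
          rw [mul_pow]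
          gcongr

end PervasiveFactorModel

end Consistency

end TensorFactor

theorem theorem1_general {Ω : Type*} [MeasurableSpace Ω] {P : Measure Ω} [IsProbabilityMeasure P]
    {K : ℕ} {r : Fin K → ℕ} {ι : Type*} {l : Filter ι} {n : ι → ℕ} {p : ι → Fin K → ℕ}
    {Λ : ∀ ν k, Matrix (Fin (p ν k)) (Fin (r k)) ℝ} {F : ι → ℕ → Tensor r}
    {ξ : ι → (Fin K → ℕ) → ℤ → Ω → ℝ} {ε w : ℝ} {M : ι → ℝ}
    (h : PervasiveFactorModel P n p Λ F ξ ε w M) (hn : Tendsto n l atTop)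
    (hp : ∀ k, Tendsto (fun ν => p ν k) l atTop) {c₀ : ℝ} (hc₀ : 0 < c₀) (k : Fin K)
    {τ : ι → ℝ} (hτ : ∀ ν, 0 < τ ν) {Λhat : ∀ ν, Ω → Matrix (Fin (p ν k)) (Fin (r k)) ℝ}
    (hhat : ∀ ν ω, IsPCLoading
      (truncGram (n ν) (fun t => obs (F ν t) (Λ ν) fun i => ξ ν i t ω) (τ ν) k) (Λhat ν ω)) :
    ((∀ ν, iIndepFun (fun (i : ∀ k, Fin (p ν k)) (ω : Ω) (t : ℤ) => ξ ν (pos i) t ω) P) →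
      (∀ ν (i : ∀ k, Fin (p ν k)) (m : ℕ),
        seriesAlpha P (ξ ν (pos i)) m ≤ Real.exp (-(c₀ * m))) →
      GrowthCondition l n p ε M (fun ν => tauIndep (n ν) (p ν) ε w) →
      (τ =Θ[l] fun ν => tauIndep (n ν) (p ν) ε w k) →
      AlignsAtRate P l (fun ν => Λ ν k) Λhat fun ν =>
        max (max (M ν ^ (1 - ε) / √((n ν : ℝ) * dimExcept (p ν) k)) (1 / (p ν k : ℝ)))
          (psiIndep (n ν) (p ν) ε w k / √(p ν k : ℝ))) ∧
    ((∀ ν (m : ℕ), fieldAlpha P (ξ ν) m ⊤ ⊤ ≤ Real.exp (-(c₀ * m))) →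
      GrowthCondition l n p ε M (fun ν => tauField (n ν) (p ν) ε w) →
      (τ =Θ[l] fun ν => tauField (n ν) (p ν) ε w k) →
      AlignsAtRate P l (fun ν => Λ ν k) Λhat fun ν =>
        max (psiField (n ν) (p ν) ε w k) (1 / (p ν k : ℝ))) :=
  ⟨fun hind hα hgrowth hΘ => h.alignsAtRate_of_indep hn hp hc₀ hind hα hgrowth hτ hΘ hhat,
    fun hα hgrowth hΘ => h.alignsAtRate_of_field hn hp hc₀ hα hgrowth hτ hΘ hhat⟩

theorem theorem1 {Ω : Type*} [MeasurableSpace Ω] (P : Measure Ω) [IsProbabilityMeasure P]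
    {K : ℕ} (r : Fin K → ℕ) {ι : Type*} (l : Filter ι)
    (n : ι → ℕ) (p : ι → Fin K → ℕ)
    (hn : Tendsto n l atTop) (hp : ∀ k, Tendsto (fun ν => p ν k) l atTop)
    (Λ : ∀ ν k, Matrix (Fin (p ν k)) (Fin (r k)) ℝ)
    (F : ι → ℕ → Tensor r)
    (ξ : ι → (Fin K → ℕ) → ℤ → Ω → ℝ)
    (ε w : ℝ) (M : ι → ℝ)
    (hΛ : LoadingAssumption Λ)
    (hF : FactorAssumption n F)
    (hξ : NoiseAssumption P p ξ)
    (hT : TailAssumption P n p F ξ ε w M) :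
    (IndepAssumption P n p F ξ ε w →
      GrowthCondition l n p ε M (fun ν => tauIndep (n ν) (p ν) ε w) →
      ∀ (k : Fin K) (τ : ι → ℝ), (∀ ν, 0 < τ ν) →
      (τ =Θ[l] fun ν => tauIndep (n ν) (p ν) ε w k) →
      ∀ Λhat : ∀ ν, Ω → Matrix (Fin (p ν k)) (Fin (r k)) ℝ,
      (∀ ν ω, IsPCLoading
        (truncGram (n ν) (fun t => obs (F ν t) (Λ ν) fun i => ξ ν i t ω) (τ ν) k) (Λhat ν ω)) →
      ∃ H : ι → Ω → Matrix (Fin (r k)) (Fin (r k)) ℝ,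
        (∀ ν, (∀ i j, Measurable fun ω => Λhat ν ω i j) → ∀ i j, Measurable fun ω => H ν ω i j) ∧
        (∀ i j, TendstoInMeasure P (fun ν ω => ((H ν ω).transpose * H ν ω) i j) l
          (fun _ => (1 : Matrix (Fin (r k)) (Fin (r k)) ℝ) i j)) ∧
        IsBigOP P l (fun ν ω => 1 / √(p ν k : ℝ) * specNorm (Λhat ν ω - Λ ν k * H ν ω))
          (fun ν => max (max (M ν ^ (1 - ε) / √((n ν : ℝ) * dimExcept (p ν) k)) (1 / (p ν k : ℝ)))
            (psiIndep (n ν) (p ν) ε w k / √(p ν k : ℝ)))) ∧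
    (FieldAssumption P n p F ξ ε w →
      GrowthCondition l n p ε M (fun ν => tauField (n ν) (p ν) ε w) →
      ∀ (k : Fin K) (τ : ι → ℝ), (∀ ν, 0 < τ ν) →
      (τ =Θ[l] fun ν => tauField (n ν) (p ν) ε w k) →
      ∀ Λhat : ∀ ν, Ω → Matrix (Fin (p ν k)) (Fin (r k)) ℝ,
      (∀ ν ω, IsPCLoading
        (truncGram (n ν) (fun t => obs (F ν t) (Λ ν) fun i => ξ ν i t ω) (τ ν) k) (Λhat ν ω)) →
      ∃ H : ι → Ω → Matrix (Fin (r k)) (Fin (r k)) ℝ,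
        (∀ ν, (∀ i j, Measurable fun ω => Λhat ν ω i j) → ∀ i j, Measurable fun ω => H ν ω i j) ∧
        (∀ i j, TendstoInMeasure P (fun ν ω => ((H ν ω).transpose * H ν ω) i j) l
          (fun _ => (1 : Matrix (Fin (r k)) (Fin (r k)) ℝ) i j)) ∧
        IsBigOP P l (fun ν ω => 1 / √(p ν k : ℝ) * specNorm (Λhat ν ω - Λ ν k * H ν ω))
          (fun ν => max (psiField (n ν) (p ν) ε w k) (1 / (p ν k : ℝ)))) :=
  have h := hT.pervasiveFactorModel hΛ hF hξ
  ⟨fun ⟨_, _, hc₀, _, hdep⟩ hgrowth k _ hτ hΘ _ hhat => (theorem1_general h hn hp hc₀ k hτ hhat).1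
      (fun ν => (hdep ν).1) (fun ν => (hdep ν).2.1) hgrowth hΘ,
    fun ⟨_, _, hc₀, _, hdep⟩ hgrowth k _ hτ hΘ _ hhat => (theorem1_general h hn hp hc₀ k hτ hhat).2
      (fun ν => (hdep ν).1) hgrowth hΘ⟩
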